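/- **Setting.** Let $\Omega\subset\mathbb R^3$ be a bounded connected open set with Lipschitz boundary $\Gamma$, whose connected components are $\Gamma_0$ (the exterior boundary) and $\Gamma_1,\dots,\Gamma_m$. Let $\mathcal T_h$ be a finite partition of $\Omega$ into polyhedra with set of faces $\mathcal E_h$, each face lying on $\Gamma$ or being shared by two elements; $h_T$ is the diameter of $T$ and $\mathbf n$ the outward unit normal on $\partial T$ (on $\Gamma_i$ it is written $\mathbf n_i$). Let $\kappa,\mu$ be symmetric positive definite $3\times3$ matrix functions, constant on each $T\in\mathcal T_h$. Let $\mathbf g\in[L^2(\Omega)]^3$, $f\in L^2(\Omega)$, $\xi\in[L^2(\Gamma)]^3$, $\beta_1,\dots,\beta_m\in\mathbb R$. **Model problem.** Let $\mathbf u\in H(\mathrm{curl};\Omega)$ with $\nabla\cdot(\mu\mathbf u)\in L^2(\Omega)$ and $p\in L^2(\Omega)$ satisfy $\mathbf u\times\mathbf n=\xi$ on $\Gamma$, $\langle\mu\mathbf u\cdot\mathbf n_i,1\rangle_{\Gamma_i}=\beta_i$ for $1\le i\le m$, $(\nabla\cdot(\mu\mathbf u),w)=(f,w)$ for all $w\in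 L^2(\Omega)$, and $$(\kappa\nabla\times\mathbf u,\nabla\times\mathbf v)+(\nabla\cdot(\mu\mathbf v),p)=(\mathbf g,\mathbf v)$$ for all $\mathbf v\in H(\mathrm{curl};\Omega)$ with $\nabla\cdot(\mu\mathbf v)\in L^2(\Omega)$, $\mathbf v\times\mathbf n=0$ on $\Gamma$ and $\langle\mu\mathbf v\cdot\mathbf n_i,1\rangle_{\Gamma_i}=0$ for $1\le i\le m$; or let, for some $\lambda\in\mathbb R^m$, $(\mathbf u,p,\lambda)$ solve the equivalent problem in which the condition $\langle\mu\mathbf v\cdot\mathbf n_i,1\rangle_{\Gamma_i}=0$ on test fields is dropped, $\sum_i\langle\mu\mathbf v\cdot\mathbf n_i,\lambda_i\rangle_{\Gamma_i}$ is added to the left side of the displayed equation, and the divergence and flux equations are replaced by $(\nabla\cdot(\mu\mathbf u),w)+\sum_i\langle\mu\mathbf u\cdot\mathbf n_i,s_i\rangle_{\Gamma_i}=(f,w)+\sum_i\beta_is_i$ for all $w\in L^2(\Omega)$, $s\in\mathbb R^m$. Assume that $\mathbf u$, $\nabla\times\mathbf u$ and $p$ are in $H^1$ on each $T\in\mathcal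 T_h$, so that their traces on $\partial T$ are square integrable. **Discrete spaces and operators.** Let $k\ge1$. $V_h$ consists of the pairs $\mathbf v=\{\mathbf v_0,\mathbf v_b\}$ with $\mathbf v_0|_T\in[P_k(T)]^3$ for each $T$ and $\mathbf v_b|_e\in[P_k(e)]^3$, single-valued, for each $e\in\mathcal E_h$; $W_h$ consists of the $q\in L^2(\Omega)$ with $q|_T\in P_{k-1}(T)$ for each $T$. Further $$U_h^0=\{\mathbf v\in V_h:\ \mathbf v_b\times\mathbf n=0\text{ on }\Gamma,\ \langle\mathbf v_b\cdot\mathbf n_i,1\rangle_{\Gamma_i}=0,\ i=1,\dots,m\}.$$ For $\mathbf v\in V_h$, $\nabla_w\cdot(\mu\mathbf v)|_T\in P_{k-1}(T)$ and $\nabla_w\times\mathbf v|_T\in[P_{k-1}(T)]^3$ are given by $$(\nabla_w\cdot(\mu\mathbf v),\varphi)_T=-(\mu\mathbf v_0,\nabla\varphi)_T+\langle\mathbf v_b\cdot\mathbf n,\varphi\rangle_{\partial T}\quad\forall\varphi\in P_{k-1}(T),$$ $$(\nabla_w\times\mathbf v,\varphi)_T=(\mathbf v_0,\nabla\times\varphi)_T-\langle\mathbf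 v_b\times\mathbf n,\varphi\rangle_{\partial T}\quad\forall\varphi\in[P_{k-1}(T)]^3.$$ Set $b(\mathbf v,q)=\sum_T(\nabla_w\cdot(\mu\mathbf v),q)_T$, $a(\mathbf v,\mathbf w)=\sum_T(\kappa\nabla_w\times\mathbf v,\nabla_w\times\mathbf w)_T+s(\mathbf v,\mathbf w)$, where $$s(\mathbf v,\mathbf w)=\sum_Th_T^{-1}\Big(\langle(\mu\mathbf v_0-\mathbf v_b)\cdot\mathbf n,(\mu\mathbf w_0-\mathbf w_b)\cdot\mathbf n\rangle_{\partial T}+\langle(\mathbf v_0-\mathbf v_b)\times\mathbf n,(\mathbf w_0-\mathbf w_b)\times\mathbf n\rangle_{\partial T}\Big).$$ Let $Q_0$, $Q_b$ be the $L^2$ projections onto polynomials of degree at most $k$ on each element and on each face, and $\mathcal Q_h$, $\mathbf Q_h$ the $L^2$ projections onto $P_{k-1}(T)$ and $[P_{k-1}(T)]^3$ on each $T$. Put $Q_h\mathbf u=\{Q_0\mathbf u,\ Q_b(\mu\mathbf u\cdot\mathbf n)\mathbf n+Q_b(\mathbf n\times(\mathbf u\times\mathbf n))\}$, where on an interior face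 the traces may be taken from either of the two elements, and $$l_{\mathbf u}(\mathbf v)=\sum_T\langle(\mathbf Q_h-I)(\kappa\nabla\times\mathbf u),(\mathbf v_0-\mathbf v_b)\times\mathbf n\rangle_{\partial T},\qquad\theta_p(\mathbf v)=\sum_T\langle p-\mathcal Q_hp,(\mu\mathbf v_0-\mathbf v_b)\cdot\mathbf n\rangle_{\partial T}.$$ **Scheme.** Let $\mathbf u_h=\{\mathbf u_0,\mathbf u_b\}\in V_h$ and $p_h\in W_h$ satisfy $\mathbf u_b\times\mathbf n=Q_b\xi$ on $\Gamma$, $a(\mathbf u_h,\mathbf v)+b(\mathbf v,p_h)=(\mathbf g,\mathbf v_0)$ for all $\mathbf v\in U_h^0$, $b(\mathbf u_h,w)=(f,w)$ for all $w\in W_h$, and $\langle\mathbf u_b\cdot\mathbf n_i,1\rangle_{\Gamma_i}=\beta_i$ for $1\le i\le m$. **Theorem.** The errors $\mathbf e_h=Q_h\mathbf u-\mathbf u_h$ and $\epsilon_h=\mathcal Q_hp-p_h$ satisfy $\mathbf e_h\in U_h^0$, $\epsilon_h\in W_h$, and $$a(\mathbf e_h,\mathbf v)+b(\mathbf v,\epsilon_h)=l_{\mathbf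 u}(\mathbf v)+\theta_p(\mathbf v)+s(Q_h\mathbf u,\mathbf v)\qquad\forall\,\mathbf v\in U_h^0,$$ $$b(\mathbf e_h,q)=0\qquad\forall\,q\in W_h.$$ -/

import Mathlib

open MeasureTheory Set Filter Topology
open scoped ContDiff RealInnerProductSpace

noncomputable section

namespace DivCurlWG

/-- Euclidean three-space. -/
abbrev E3 : Type := EuclideanSpace ℝ (Fin 3)

/-- Surface area: the two-dimensional Hausdorff measure, normalised so that it is Lebesgue area
on planes. -/
abbrev area : Measure E3 := Measure.euclideanHausdorffMeasure 2

/-! ### Vector calculus -/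

/-- The cross product `a × b`. -/
def cross (a b : E3) : E3 := WithLp.toLp 2 (crossProduct a.ofLp b.ofLp)

/-- The matrix-vector product `A v`. -/
def app (A : Matrix (Fin 3) (Fin 3) ℝ) (v : E3) : E3 := WithLp.toLp 2 (A.mulVec v.ofLp)

/-- The partial derivative `∂ w_j / ∂ x_i` of a (differentiable) vector field. -/
def pd (w : E3 → E3) (i j : Fin 3) (x : E3) : ℝ :=
  (fderiv ℝ w x (EuclideanSpace.single i 1)) j

/-- The classical curl of a differentiable vector field. -/
def curl (w : E3 → E3) (x : E3) : E3 :=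
  !₂[pd w 1 2 x - pd w 2 1 x, pd w 2 0 x - pd w 0 2 x, pd w 0 1 x - pd w 1 0 x]

/-! ### Weak derivatives and traces -/

/-- `c` is the distributional curl of `u` in `D`: `(u, curl φ) = (c, φ)` for all test fields. -/
def IsWeakCurl (D : Set E3) (u c : E3 → E3) : Prop :=
  ∀ φ : E3 → E3, ContDiff ℝ ∞ φ → HasCompactSupport φ → tsupport φ ⊆ D →
    ∫ x in D, ⟪u x, curl φ x⟫ = ∫ x in D, ⟪c x, φ x⟫

/-- `d` is the distributional divergence of `w` in `D`: `-(w, ∇φ) = (d, φ)` for all test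
functions. -/
def IsWeakDiv (D : Set E3) (w : E3 → E3) (d : E3 → ℝ) : Prop :=
  ∀ φ : E3 → ℝ, ContDiff ℝ ∞ φ → HasCompactSupport φ → tsupport φ ⊆ D →
    -∫ x in D, ⟪w x, gradient φ x⟫ = ∫ x in D, d x * φ x

/-- `u ∈ H(curl; D)`. -/
def MemHCurl (D : Set E3) (u : E3 → E3) : Prop :=
  MemLp u 2 (volume.restrict D) ∧ ∃ c, MemLp c 2 (volume.restrict D) ∧ IsWeakCurl D u c

/-- `w ∈ H(div; D)`. -/
def MemHDiv (D : Set E3) (w : E3 → E3) : Prop :=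
  MemLp w 2 (volume.restrict D) ∧ ∃ d, MemLp d 2 (volume.restrict D) ∧ IsWeakDiv D w d

open Classical in
/-- The curl `∇ × u ∈ [L²(D)]³` of `u ∈ H(curl; D)` (determined almost everywhere in `D`). -/
def wcurl (D : Set E3) (u : E3 → E3) : E3 → E3 :=
  if h : ∃ c, MemLp c 2 (volume.restrict D) ∧ IsWeakCurl D u c then h.choose else 0

open Classical in
/-- The divergence `∇ · w ∈ L²(D)` of `w ∈ H(div; D)` (determined almost everywhere in `D`). -/
def wdiv (D : Set E3) (w : E3 → E3) : E3 → ℝ :=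
  if h : ∃ d, MemLp d 2 (volume.restrict D) ∧ IsWeakDiv D w d then h.choose else 0

/-- For `u ∈ H(curl; D)`: the tangential trace `u × n` on `∂D` is the square-integrable field `ξ`.
The trace is the one given by Green's formula `⟨u × n, φ⟩ = (u, curl φ) - (curl u, φ)`. -/
def HasTangentialTrace (D : Set E3) (u ξ : E3 → E3) : Prop :=
  ∀ φ : E3 → E3, ContDiff ℝ ∞ φ →
    (∫ x in D, ⟪u x, curl φ x⟫) - ∫ x in D, ⟪wcurl D u x, φ x⟫
      = ∫ x in frontier D, ⟪ξ x, φ x⟫ ∂area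

/-- A smooth cut-off function that is one near the part `C` of `∂D` and zero near the rest
of `∂D`. -/
def IsCutoff (D C : Set E3) (χ : E3 → ℝ) : Prop :=
  ContDiff ℝ ∞ χ ∧ (∀ᶠ y in 𝓝ˢ C, χ y = 1) ∧ ∀ᶠ y in 𝓝ˢ (frontier D \ C), χ y = 0

open Classical in
/-- For `w ∈ H(div; D)` and a connected component `C` of `∂D`: the duality pairing `⟨w · n, 1⟩_C`,
that is `⟨w · n, χ⟩_{∂D} = (∇ · w, χ) + (w, ∇χ)` for any `χ` equal to one near `C` and to zero near
the other components (the value does not depend on `χ`). -/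
def normalFlux (D : Set E3) (w : E3 → E3) (C : Set E3) : ℝ :=
  if h : ∃ χ, IsCutoff D C χ then
    (∫ x in D, wdiv D w x * h.choose x) + ∫ x in D, ⟪w x, gradient h.choose x⟫
  else 0

/-- `w ∈ H¹(T)` with trace `γ ∈ L²(∂T)`: there are functions smooth up to the boundary which
converge to `w` in `H¹(T)` and whose restrictions to `∂T` converge to `γ` in `L²(∂T)`. -/
def IsTrace (T : Set E3) (w γ : E3 → ℝ) : Prop :=
  MemLp w 2 (volume.restrict T) ∧ MemLp γ 2 (area.restrict (frontier T)) ∧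
    ∃ G : E3 → E3, MemLp G 2 (volume.restrict T) ∧ ∃ φ : ℕ → E3 → ℝ,
      (∀ n, ContDiff ℝ ∞ (φ n)) ∧
      Tendsto (fun n => eLpNorm (fun x => φ n x - w x) 2 (volume.restrict T)) atTop (𝓝 0) ∧
      Tendsto (fun n => eLpNorm (fun x => gradient (φ n) x - G x) 2 (volume.restrict T))
        atTop (𝓝 0) ∧
      Tendsto (fun n => eLpNorm (fun x => φ n x - γ x) 2 (area.restrict (frontier T)))
        atTop (𝓝 0)

/-- `w ∈ H¹(T)`. -/
def MemH1 (T : Set E3) (w : E3 → ℝ) : Prop := ∃ γ, IsTrace T w γ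

open Classical in
/-- The trace on `∂T` of `w ∈ H¹(T)`. -/
def trace (T : Set E3) (w : E3 → ℝ) : E3 → ℝ :=
  if h : ∃ γ, IsTrace T w γ then h.choose else 0

/-- The componentwise trace on `∂T` of `w ∈ [H¹(T)]³`. -/
def vtrace (T : Set E3) (w : E3 → E3) (x : E3) : E3 :=
  WithLp.toLp 2 fun j => trace T (fun y => w y j) x

/-! ### Polynomials and projections -/

/-- A polynomial in three variables as a function on `ℝ³`. -/
def polyFun : MvPolynomial (Fin 3) ℝ →ₗ[ℝ] (E3 → ℝ) where
  toFun P x := MvPolynomial.eval x.ofLp P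
  map_add' P Q := by ext x; simp
  map_smul' c P := by ext x; simp

/-- Polynomial functions of total degree at most `k`. The space `P_k(T)` or `P_k(e)` consists of
their restrictions to `T` or `e`. -/
def Poly (k : ℕ) : Submodule ℝ (E3 → ℝ) :=
  (MvPolynomial.restrictTotalDegree (Fin 3) ℝ k).map polyFun

/-- Vector fields with components in `Poly k`. -/
def VPoly (k : ℕ) : Set (E3 → E3) := {w | ∀ j, (fun x => w x j) ∈ Poly k}

open Classical in
/-- The `L²(ν)`-projection onto polynomials of degree at most `k`; `ν` is the volume measure on an
element or the area measure on a face. -/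
def proj (ν : Measure E3) (k : ℕ) (w : E3 → ℝ) : E3 → ℝ :=
  if h : ∃ q ∈ Poly k, ∀ φ ∈ Poly k, ∫ x, (w x - q x) * φ x ∂ν = 0 then h.choose else 0

/-- The componentwise `L²(ν)`-projection of a vector field. -/
def vproj (ν : Measure E3) (k : ℕ) (w : E3 → E3) (x : E3) : E3 :=
  WithLp.toLp 2 fun j => proj ν k (fun y => w y j) x

/-! ### The domain and its boundary components -/

/-- A bounded connected open set with Lipschitz boundary: near each boundary point, for some
direction `ν`, it is the region below the graph of a Lipschitz function of the variables orthogonal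
to `ν`. -/
structure IsLipschitzDomain (Ω : Set E3) : Prop where
  isOpen : IsOpen Ω
  isBounded : Bornology.IsBounded Ω
  isConnected : IsConnected Ω
  graph : ∀ x ∈ frontier Ω, ∃ U : Set E3, IsOpen U ∧ x ∈ U ∧ ∃ ν : E3, ‖ν‖ = 1 ∧
    ∃ (K : NNReal) (g : E3 → ℝ), LipschitzWith K g ∧ (∀ (y : E3) (t : ℝ), g (y + t • ν) = g y) ∧
      ∀ y ∈ U, (y ∈ Ω ↔ ⟪ν, y⟫ < g y)

/-- `Γ 0, …, Γ m` are the distinct connected components of `∂Ω`, and `Γ 0` is the exterior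
boundary, that is, it contains the boundary of the unbounded component of the exterior of `Ω`. -/
structure IsBoundaryComponents (Ω : Set E3) {m : ℕ} (Γ : Fin (m + 1) → Set E3) : Prop where
  injective : Function.Injective Γ
  range_eq : range Γ = {C | ∃ x ∈ frontier Ω, C = connectedComponentIn (frontier Ω) x}
  exterior : ∀ x ∈ (closure Ω)ᶜ, ¬ Bornology.IsBounded (connectedComponentIn (closure Ω)ᶜ x) →
    frontier (connectedComponentIn (closure Ω)ᶜ x) ⊆ Γ 0

/-! ### Polyhedral partitions -/

/-- A (closed, connected, not necessarily convex) plane polygon in space: it spans a plane, is the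
closure of its relative interior, and its relative boundary lies on finitely many lines. -/
structure IsPolygon (F : Set E3) : Prop where
  isCompact : IsCompact F
  isConnected : IsConnected F
  planar : Module.finrank ℝ (affineSpan ℝ F).direction = 2
  closure_interior : closure (intrinsicInterior ℝ F) = F
  edges : ∃ S : Set (AffineSubspace ℝ E3), S.Finite ∧
    (∀ l ∈ S, Module.finrank ℝ l.direction = 1) ∧ intrinsicFrontier ℝ F ⊆ ⋃ l ∈ S, (l : Set E3)

/-- A finite element partition of `Ω` into (not necessarily convex) open polyhedra `elem i`, with
the set `face f` of all faces; `faces i` are the faces of `elem i`, and `normal i f` is the unit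
normal of `face f` pointing out of `elem i`. -/
structure PolyPartition (Ω : Set E3) where
  N : ℕ
  L : ℕ
  elem : Fin N → Set E3
  face : Fin L → Set E3
  faces : Fin N → Finset (Fin L)
  normal : Fin N → Fin L → E3
  elem_isOpen : ∀ i, IsOpen (elem i)
  elem_isBounded : ∀ i, Bornology.IsBounded (elem i)
  elem_isConnected : ∀ i, IsConnected (elem i)
  /-- elements have no cracks -/
  elem_regular : ∀ i, interior (closure (elem i)) = elem i
  elem_disjoint : ∀ i j, i ≠ j → Disjoint (elem i) (elem j)
  elem_cover : ⋃ i, closure (elem i) = closure Ω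
  face_isPolygon : ∀ f, IsPolygon (face f)
  /-- the boundary of an element is the union of its faces -/
  frontier_elem : ∀ i, frontier (elem i) = ⋃ f ∈ faces i, face f
  /-- different faces have no area in common; so elements meet along whole faces -/
  face_overlap : ∀ f f', f ≠ f' → area (face f ∩ face f') = 0
  /-- each face is on the boundary of `Ω` or is shared by two elements -/
  face_cases : ∀ f, (face f ⊆ frontier Ω ∧ ∃ i, f ∈ faces i) ∨
    ∃ i j, i ≠ j ∧ f ∈ faces i ∧ f ∈ faces j
  normal_unit : ∀ i, ∀ f ∈ faces i, ‖normal i f‖ = 1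
  normal_orthogonal : ∀ i, ∀ f ∈ faces i, ∀ x ∈ face f, ∀ y ∈ face f, ⟪normal i f, x - y⟫ = 0
  normal_outward : ∀ i, ∀ f ∈ faces i, ∀ᵐ x ∂(area.restrict (face f)),
    ∀ᶠ t : ℝ in 𝓝[>] 0, x + t • normal i f ∉ elem i ∧ x - t • normal i f ∈ elem i

/-- A coefficient matrix that takes the constant value `A i` on the element `elem i`. -/
def PolyPartition.coeff {Ω : Set E3} (M : PolyPartition Ω) (A : Fin M.N → Matrix (Fin 3) (Fin 3) ℝ)
    (x : E3) : Matrix (Fin 3) (Fin 3) ℝ :=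
  ∑ i, (M.elem i).indicator (fun _ => A i) x

/-! ### The model problem -/

section ModelProblem

variable (Ω : Set E3) {m : ℕ} (Γ : Fin (m + 1) → Set E3)
  (κ μ : E3 → Matrix (Fin 3) (Fin 3) ℝ) (g ξ : E3 → E3) (f : E3 → ℝ) (β : Fin m → ℝ)

/-- `v ∈ H(curl; Ω) ∩ H(div_μ; Ω)`. -/
def MemX (v : E3 → E3) : Prop := MemHCurl Ω v ∧ MemHDiv Ω (fun x => app (μ x) (v x))

/-- `∇ · (μ v)`. -/
def divMu (v : E3 → E3) : E3 → ℝ := wdiv Ω fun x => app (μ x) (v x)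

/-- `⟨μ v · n, 1⟩_C`. -/
def fluxMu (v : E3 → E3) (C : Set E3) : ℝ := normalFlux Ω (fun x => app (μ x) (v x)) C

/-- `(u, p)` solves the model problem. -/
structure IsModelSolution (u : E3 → E3) (p : E3 → ℝ) : Prop where
  u_mem : MemX Ω μ u
  p_mem : MemLp p 2 (volume.restrict Ω)
  curl_eq : ∀ v : E3 → E3, MemX Ω μ v → HasTangentialTrace Ω v 0 →
    (∀ i : Fin m, fluxMu Ω μ v (Γ i.succ) = 0) →
    (∫ x in Ω, ⟪app (κ x) (wcurl Ω u x), wcurl Ω v x⟫) + ∫ x in Ω, divMu Ω μ v x * p x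
      = ∫ x in Ω, ⟪g x, v x⟫
  div_eq : ∀ w : E3 → ℝ, MemLp w 2 (volume.restrict Ω) →
    ∫ x in Ω, divMu Ω μ u x * w x = ∫ x in Ω, f x * w x
  flux_eq : ∀ i : Fin m, fluxMu Ω μ u (Γ i.succ) = β i
  boundary : HasTangentialTrace Ω u ξ

/-- `(u, p, lam)` solves the model problem in the formulation with Lagrange multipliers. -/
structure IsMultiplierSolution (u : E3 → E3) (p : E3 → ℝ) (lam : Fin m → ℝ) : Prop where
  u_mem : MemX Ω μ u
  p_mem : MemLp p 2 (volume.restrict Ω)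
  curl_eq : ∀ v : E3 → E3, MemX Ω μ v → HasTangentialTrace Ω v 0 →
    (∫ x in Ω, ⟪app (κ x) (wcurl Ω u x), wcurl Ω v x⟫) + (∫ x in Ω, divMu Ω μ v x * p x)
      + ∑ i : Fin m, fluxMu Ω μ v (Γ i.succ) * lam i = ∫ x in Ω, ⟪g x, v x⟫
  div_eq : ∀ (w : E3 → ℝ) (s : Fin m → ℝ), MemLp w 2 (volume.restrict Ω) →
    (∫ x in Ω, divMu Ω μ u x * w x) + ∑ i : Fin m, fluxMu Ω μ u (Γ i.succ) * s i
      = (∫ x in Ω, f x * w x) + ∑ i : Fin m, β i * s i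
  boundary : HasTangentialTrace Ω u ξ

end ModelProblem

/-! ### The weak Galerkin method -/

namespace PolyPartition

variable {Ω : Set E3} (M : PolyPartition Ω) (k : ℕ) (κ μ : Fin M.N → Matrix (Fin 3) (Fin 3) ℝ)

/-- Weak vector fields `v = {v_0, v_b}`: one interior field per element and one (single-valued)
field per face. -/
abbrev Weak : Type := (Fin M.N → E3 → E3) × (Fin M.L → E3 → E3)

/-- The space `V_h`. -/
def V : Set M.Weak := {v | (∀ i, v.1 i ∈ VPoly k) ∧ ∀ f, v.2 f ∈ VPoly k}

/-- The space `W_h`; a member is given by its polynomial on each element. -/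
def W : Set (Fin M.N → E3 → ℝ) := {q | ∀ i, q i ∈ Poly (k - 1)}

/-- The subspace `V_h^0` of `V_h`: `v_b × n = 0` on `∂Ω`. -/
def V0 : Set M.Weak :=
  {v | v ∈ M.V k ∧ ∀ i, ∀ f ∈ M.faces i, M.face f ⊆ frontier Ω →
    ∀ᵐ x ∂(area.restrict (M.face f)), cross (v.2 f x) (M.normal i f) = 0}

open Classical in
/-- `⟨v_b · n, 1⟩_C` for a connected component `C` of `∂Ω`. -/
def bflux (v : M.Weak) (C : Set E3) : ℝ :=
  ∑ i, ∑ f ∈ M.faces i with M.face f ⊆ C, ∫ x in M.face f, ⟪v.2 f x, M.normal i f⟫ ∂area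

/-- The subspace `U_h^0` of `V_h^0`: `⟨v_b · n_i, 1⟩_{Γ_i} = 0` for `i = 1, …, m`. -/
def U0 {m : ℕ} (Γ : Fin (m + 1) → Set E3) : Set M.Weak :=
  {v | v ∈ M.V0 k ∧ ∀ i : Fin m, M.bflux v (Γ i.succ) = 0}

open Classical in
/-- The discrete weak divergence of `μ v` on the element `i`: the unique polynomial `d` of degree
at most `k - 1` with `(d, φ)_T = -(μ v_0, ∇φ)_T + ⟨v_b · n, φ⟩_{∂T}` for all `φ` of that kind. -/
def weakDiv (v : M.Weak) (i : Fin M.N) : E3 → ℝ :=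
  if h : ∃ d ∈ Poly (k - 1), ∀ φ ∈ Poly (k - 1),
      ∫ x in M.elem i, d x * φ x = -(∫ x in M.elem i, ⟪app (μ i) (v.1 i x), gradient φ x⟫)
        + ∑ f ∈ M.faces i, ∫ x in M.face f, ⟪v.2 f x, M.normal i f⟫ * φ x ∂area
  then h.choose else 0

open Classical in
/-- The discrete weak curl of `v` on the element `i`: the unique polynomial field `c` of degree at
most `k - 1` with `(c, φ)_T = (v_0, ∇ × φ)_T - ⟨v_b × n, φ⟩_{∂T}` for all `φ` of that kind. -/
def weakCurl (v : M.Weak) (i : Fin M.N) : E3 → E3 :=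
  if h : ∃ c ∈ VPoly (k - 1), ∀ φ ∈ VPoly (k - 1),
      ∫ x in M.elem i, ⟪c x, φ x⟫ = (∫ x in M.elem i, ⟪v.1 i x, curl φ x⟫)
        - ∑ f ∈ M.faces i, ∫ x in M.face f, ⟪cross (v.2 f x) (M.normal i f), φ x⟫ ∂area
  then h.choose else 0

/-- The diameter `h_T`. -/
def diam (i : Fin M.N) : ℝ := Metric.diam (M.elem i)

/-- `(μ v_0 - v_b) · n` on the face `f` of the element `i`. -/
def nJump (v : M.Weak) (i : Fin M.N) (f : Fin M.L) (x : E3) : ℝ :=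
  ⟪app (μ i) (v.1 i x) - v.2 f x, M.normal i f⟫

/-- `(v_0 - v_b) × n` on the face `f` of the element `i`. -/
def tJump (v : M.Weak) (i : Fin M.N) (f : Fin M.L) (x : E3) : E3 :=
  cross (v.1 i x - v.2 f x) (M.normal i f)

/-- The stabilizer `s(v, w)`. -/
def s (v w : M.Weak) : ℝ :=
  (∑ i, (M.diam i)⁻¹ * ∑ f ∈ M.faces i,
    ∫ x in M.face f, M.nJump μ v i f x * M.nJump μ w i f x ∂area)
  + ∑ i, (M.diam i)⁻¹ * ∑ f ∈ M.faces i,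
    ∫ x in M.face f, ⟪M.tJump v i f x, M.tJump w i f x⟫ ∂area

/-- The bilinear form `a(v, w) = (κ ∇_w × v, ∇_w × w)_h + s(v, w)`. -/
def a (v w : M.Weak) : ℝ :=
  (∑ i, ∫ x in M.elem i, ⟪app (κ i) (M.weakCurl k v i x), M.weakCurl k w i x⟫) + M.s μ v w

/-- The bilinear form `b(v, q) = (∇_w · (μ v), q)_h`. -/
def b (v : M.Weak) (q : Fin M.N → E3 → ℝ) : ℝ :=
  ∑ i, ∫ x in M.elem i, M.weakDiv k μ v i x * q i x

/-- `(u_h, p_h)` solves the weak Galerkin scheme. -/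
structure IsWGSolution {m : ℕ} (Γ : Fin (m + 1) → Set E3) (g ξ : E3 → E3) (f : E3 → ℝ)
    (β : Fin m → ℝ) (uh : M.Weak) (ph : Fin M.N → E3 → ℝ) : Prop where
  u_mem : uh ∈ M.V k
  p_mem : ph ∈ M.W k
  /-- `u_b × n = Q_b ξ` on `∂Ω` -/
  boundary : ∀ i, ∀ e ∈ M.faces i, M.face e ⊆ frontier Ω →
    ∀ᵐ x ∂(area.restrict (M.face e)),
      cross (uh.2 e x) (M.normal i e) = vproj (area.restrict (M.face e)) k ξ x
  curl_eq : ∀ v ∈ M.U0 k Γ,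
    M.a k κ μ uh v + M.b k μ v ph = ∑ i, ∫ x in M.elem i, ⟪g x, v.1 i x⟫
  div_eq : ∀ w ∈ M.W k, M.b k μ uh w = ∑ i, ∫ x in M.elem i, f x * w i x
  flux_eq : ∀ i : Fin m, M.bflux uh (Γ i.succ) = β i

/-- The projection `Q_h u = {Q_0 u, Q_b (μ u · n) n + Q_b (n × (u × n))}`. On a face `e` the traces
are taken from the element `side e`. -/
def Qh (side : Fin M.L → Fin M.N) (u : E3 → E3) : M.Weak :=
  (fun i => vproj (volume.restrict (M.elem i)) k u,
   fun e =>
    let T := M.elem (side e)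
    let n := M.normal (side e) e
    let ν := area.restrict (M.face e)
    fun x => proj ν k (fun y => ⟪app (μ (side e)) (vtrace T u y), n⟫) x • n
      + vproj ν k (fun y => cross n (cross (vtrace T u y) n)) x)

/-- The elementwise `L²`-projection of `p` onto `W_h`. -/
def Qp (p : E3 → ℝ) : Fin M.N → E3 → ℝ :=
  fun i => proj (volume.restrict (M.elem i)) (k - 1) p

/-- `l_u(v) = ∑_T ⟨(Q - I)(κ ∇ × u), (v_0 - v_b) × n⟩_{∂T}`, where `Q` is the `L²`-projection onto
`[P_{k-1}(T)]³`. -/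
def l (u : E3 → E3) (v : M.Weak) : ℝ :=
  ∑ i, ∑ e ∈ M.faces i, ∫ x in M.face e,
    ⟪vproj (volume.restrict (M.elem i)) (k - 1) (fun y => app (κ i) (wcurl Ω u y)) x
      - app (κ i) (vtrace (M.elem i) (wcurl Ω u) x), M.tJump v i e x⟫ ∂area

/-- `θ_p(v) = ∑_T ⟨p - Q p, (μ v_0 - v_b) · n⟩_{∂T}`, where `Q` is the `L²`-projection onto
`P_{k-1}(T)`. -/
def theta (p : E3 → ℝ) (v : M.Weak) : ℝ :=
  ∑ i, ∑ e ∈ M.faces i, ∫ x in M.face e,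
    (trace (M.elem i) p x - M.Qp k p i x) * M.nJump μ v i e x ∂area

end PolyPartition

end DivCurlWG

end

/-!
The error equations are elementwise integration by parts for the exact solution, minus the scheme;
what has to be shown is that no face terms survive except `l_u` and `θ_p`.

*Green's formulas.* On a polyhedral element `T` one has `∫_T ∂_j φ = ∫_{∂T} φ n_j` for smooth `φ`
(`integral_partial`): on almost every line in the direction `e_j`, the indicator of `T` at a point
is the sum of signed crossings of faces above that point, and area on a face scales by `|n_j|` under
projection along the line. The formula passes to `H¹(T)` by density of smooth functions; the
structures `HasGrad` and `HasVGrad` record a function together with its weak gradient and its trace,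
and `green_curl`, `green_div`, `green_sdiv` are the resulting formulas.

*The projection of `u`.* As `u ∈ H(curl; Ω)` and `μ u ∈ H(div; Ω)`, the tangential trace of `u` and
the normal trace of `μ u` are continuous across faces (`tangential_match`, `normal_match`). So
`Q_h u` does not depend on the side from which traces are taken, its discrete weak divergence and
curl are the projections of `∇ · (μ u)` and `∇ × u` (`divForm_Qh`, `curlForm_Qh`), and its
boundary data are those of the scheme (`Qh_boundary`, `bflux_Qh`). This gives `e_h ∈ U_h^0` and
`b(e_h, q) = 0`.

*What the variational equation says locally.* The equation may be tested with piecewise smooth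
fields `v` for which `v × n` and `μ v · n` match across faces and `v × n = 0` on the boundary
(`IsConforming`). Fields supported in one element give `∇ × (κ ∇ × u) - μ ∇p = g` there
(`strong_form`). Fields supported near one face and prescribed independently on both sides, up to
the matching conditions, show that the tangential trace of `κ ∇ × u` and the trace of `p` do not
jump (`trace_curl_match`, `trace_p_match`). Normal fields on the boundary with vanishing fluxes
through `Γ_1, …, Γ_m` show that `p` is constant on each boundary component, and zero on `Γ_0`, where
the flux is not constrained (`trace_p_boundary`). Hence, for `v ∈ U_h^0`, the sums over all element
boundaries of `κ ∇ × u` against `v_b × n`, and of `p` against `v_b · n`, vanish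
(`sum_trace_curl_eq_zero`, `sum_trace_p_eq_zero`): interior faces cancel in pairs, and on the
boundary `v_b × n = 0` and the flux of `v_b` through `Γ_i` is zero for `i ≥ 1`. The formulation with
multipliers reduces to the first one by taking only test fields without flux
(`IsMultiplierSolution.isModelSolution`).

*Conclusion.* By the definition of the weak operators and Green's formulas, the weak curl of `v`
against the projection of `κ ∇ × u` is `∫ ∇ × (κ ∇ × u) · v_0` plus the face terms of `l_u` and of
the vanishing sum (`curlForm_vproj`), and similarly for `p` and `θ_p` (`divForm_proj`). Adding up,
`a(Q_h u, v) + b(v, 𝒬_h p) = (g, v_0) + l_u(v) + θ_p(v) + s(Q_h u, v)`; subtracting the scheme gives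
the claim.
-/

noncomputable section

namespace DivCurlWG

/-! ### Coordinate projections and the area of plane sets -/

/-- The Euclidean plane, the range of the coordinate projections `drop j`. -/
abbrev E2 : Type := EuclideanSpace ℝ (Fin 2)

/-- The projection of space onto the plane that forgets the coordinate `j`. -/
def drop (j : Fin 3) : E3 →ₗ[ℝ] E2 where
  toFun x := WithLp.toLp 2 fun l => x (j.succAbove l)
  map_add' x y := by ext; simp
  map_smul' c x := by ext; simp

/-- The point of space with `j`-th coordinate `t` and remaining coordinates `y`. -/
def ins (j : Fin 3) (y : E2) (t : ℝ) : E3 := WithLp.toLp 2 (j.insertNth t y.ofLp)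

@[simp] lemma drop_apply (j : Fin 3) (x : E3) (l : Fin 2) : drop j x l = x (j.succAbove l) := rfl

@[simp] lemma ins_self (j : Fin 3) (y : E2) (t : ℝ) : ins j y t j = t := by simp [ins]

@[simp] lemma ins_succAbove (j : Fin 3) (y : E2) (t : ℝ) (l : Fin 2) :
    ins j y t (j.succAbove l) = y l := by simp [ins]

@[simp] lemma drop_ins (j : Fin 3) (y : E2) (t : ℝ) : drop j (ins j y t) = y := by
  ext l; simp

lemma ext_drop {j : Fin 3} {x y : E3} (h : drop j x = drop j y) (h' : x j = y j) : x = y := by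
  ext l
  rcases Fin.eq_self_or_eq_succAbove j l with rfl | ⟨l, rfl⟩
  · exact h'
  · exact congrArg (fun z : E2 => z l) h

@[simp] lemma ins_drop (j : Fin 3) (x : E3) : ins j (drop j x) (x j) = x :=
  ext_drop (j := j) (by simp) (by simp)

lemma ins_add (j : Fin 3) (y : E2) (t s : ℝ) :
    ins j y (t + s) = ins j y t + s • EuclideanSpace.single j 1 := by
  refine ext_drop (j := j) ?_ (by simp)
  ext l; simp [Fin.succAbove_ne]

lemma continuous_drop (j : Fin 3) : Continuous (drop j) :=
  (drop j).continuous_of_finiteDimensional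

lemma continuous_ins (j : Fin 3) : Continuous fun z : E2 × ℝ => ins j z.1 z.2 := by
  refine (PiLp.continuous_toLp 2 _).comp ?_
  exact Continuous.finInsertNth j continuous_snd ((PiLp.continuous_ofLp 2 _).comp continuous_fst)

/-- `(t, y) ↦ ins j y t` identifies Lebesgue measure on `ℝ × ℝ²` with that on space. -/
lemma measurePreserving_ins (j : Fin 3) :
    MeasurePreserving (fun z : ℝ × E2 => ins j z.2 z.1) (volume.prod volume) volume := by
  have h1 : MeasurePreserving (Prod.map id (WithLp.ofLp (p := 2)) : ℝ × E2 → ℝ × (Fin 2 → ℝ))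
      (volume.prod volume) (volume.prod volume) :=
    (MeasurePreserving.id _).prod (PiLp.volume_preserving_ofLp (Fin 2))
  have h2 := (volume_preserving_piFinSuccAbove (fun _ : Fin 3 => ℝ) j).symm
  have h3 := PiLp.volume_preserving_toLp (Fin 3)
  exact h3.comp (h2.comp h1)

lemma measurableEmbedding_ins (j : Fin 3) :
    MeasurableEmbedding (fun z : ℝ × E2 => ins j z.2 z.1) := by
  have hc : Continuous (fun z : ℝ × E2 => ins j z.2 z.1) :=
    (continuous_ins j).comp (continuous_snd.prodMk continuous_fst)
  let e : ℝ × E2 ≃ₜ E3 :=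
    { toFun := fun z => ins j z.2 z.1
      invFun := fun x => (x j, drop j x)
      left_inv := fun z => by simp
      right_inv := fun x => by simp
      continuous_toFun := hc
      continuous_invFun := by
        refine Continuous.prodMk ?_ (continuous_drop j)
        fun_prop }
  exact e.measurableEmbedding

/-- Fubini's theorem along the coordinate direction `j`. -/
lemma integral_eq_integral_ins (j : Fin 3) {F : E3 → ℝ} (hF : Integrable F) :
    ∫ x, F x = ∫ y : E2, ∫ t : ℝ, F (ins j y t) := by
  rw [← (measurePreserving_ins j).integral_comp (measurableEmbedding_ins j) F]
  have : Integrable (fun z : ℝ × E2 => F (ins j z.2 z.1)) (volume.prod volume) :=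
    (measurePreserving_ins j).integrable_comp_of_integrable hF
  exact integral_prod_symm _ this

lemma inner_three (a b : E3) : ⟪a, b⟫ = a 0 * b 0 + a 1 * b 1 + a 2 * b 2 := by
  simp [PiLp.inner_apply, Fin.sum_univ_three, mul_comm]

lemma finrank_orthogonal_span {n : E3} (hn : n ≠ 0) :
    Module.finrank ℝ ((ℝ ∙ n)ᗮ : Submodule ℝ E3) = 2 :=
  haveI : Fact (Module.finrank ℝ E3 = 2 + 1) := ⟨by simp⟩
  Submodule.finrank_orthogonal_span_singleton (𝕜 := ℝ) (n := 2) hn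

/-- The Jacobian of a coordinate projection on the plane with unit normal `n` is `|n j|`. -/
lemma normDet_drop (j : Fin 3) {n : E3} (hn : ‖n‖ = 1) :
    ((drop j) ∘ₗ ((ℝ ∙ n)ᗮ).subtype).normDet = |n j| := by
  have hn0 : n ≠ 0 := by intro h; simp [h] at hn
  have hfin := finrank_orthogonal_span hn0
  let b : OrthonormalBasis (Fin 2) ℝ ((ℝ ∙ n)ᗮ : Submodule ℝ E3) :=
    (stdOrthonormalBasis ℝ _).reindex (finCongr hfin)
  have hsq := LinearMap.normDet_sq_eq_det_gram ((drop j) ∘ₗ ((ℝ ∙ n)ᗮ).subtype) b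
  -- the three unit vectors `n`, `b 0`, `b 1` form an orthonormal basis of space
  have horth : Orthonormal ℝ (![n, (b 0 : E3), (b 1 : E3)] : Fin 3 → E3) := by
    have hb := b.orthonormal
    rw [orthonormal_iff_ite] at hb
    have h00 : ⟪(b 0 : E3), (b 0 : E3)⟫ = 1 := hb 0 0
    have h01 : ⟪(b 0 : E3), (b 1 : E3)⟫ = 0 := hb 0 1
    have h11 : ⟪(b 1 : E3), (b 1 : E3)⟫ = 1 := hb 1 1
    have hn0 : ∀ l, ⟪n, (b l : E3)⟫ = 0 := fun l =>
      Submodule.mem_orthogonal_singleton_iff_inner_right.1 (b l).2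
    have hnn : ⟪n, n⟫ = 1 := by rw [real_inner_self_eq_norm_sq, hn]; norm_num
    have h10 : ⟪(b 1 : E3), (b 0 : E3)⟫ = 0 := by rw [real_inner_comm]; exact h01
    have hn0' : ∀ l, ⟪(b l : E3), n⟫ = 0 := fun l => by rw [real_inner_comm]; exact hn0 l
    rw [orthonormal_iff_ite]
    intro p q
    fin_cases p <;> fin_cases q <;> simp only [Fin.zero_eta, Fin.mk_one, Fin.reduceFinMk,
      Matrix.cons_val, h00, h01, h11, h10, hn0, hn0', hnn] <;> simp
  let B : OrthonormalBasis (Fin 3) ℝ E3 :=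
    (basisOfOrthonormalOfCardEqFinrank horth (by simp)).toOrthonormalBasis (by simpa using horth)
  have hB : ∀ p, B p = (![n, (b 0 : E3), (b 1 : E3)] : Fin 3 → E3) p := by
    intro p; simp [B]
  -- Parseval's identity for the coordinate vector `e j`
  have hpars : n j ^ 2 + (b 0 : E3) j ^ 2 + (b 1 : E3) j ^ 2 = 1 := by
    have := B.sum_sq_norm_inner_right (EuclideanSpace.single j (1 : ℝ))
    simp only [Fin.sum_univ_three, hB, Matrix.cons_val] at this
    simpa [EuclideanSpace.inner_single_right] using this
  have hsum : ∀ v w : E3, ⟪drop j v, drop j w⟫ = ⟪v, w⟫ - v j * w j := by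
    intro v w
    have : ⟪v, w⟫ = v j * w j + ∑ l, v (j.succAbove l) * w (j.succAbove l) := by
      simp only [PiLp.inner_apply, RCLike.inner_apply, conj_trivial]
      rw [Fin.sum_univ_succAbove _ j]
      simp [mul_comm]
    rw [this]
    simp [PiLp.inner_apply, mul_comm]
  rw [Matrix.det_fin_two] at hsq
  simp only [Matrix.gram_apply, LinearMap.comp_apply, Submodule.subtype_apply, hsum] at hsq
  have hi := orthonormal_iff_ite.1 horth
  have h00 := hi 1 1
  have h01 := hi 1 2
  have h10 := hi 2 1
  have h11 := hi 2 2
  simp only [Matrix.cons_val] at h00 h01 h10 h11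
  rw [h00, h01, h10, h11] at hsq
  simp only [Fin.reduceEq, if_true, if_false] at hsq
  have h2 : ((drop j) ∘ₗ ((ℝ ∙ n)ᗮ).subtype).normDet ^ 2 = |n j| ^ 2 := by
    rw [sq_abs]
    have : (((drop j) ∘ₗ ((ℝ ∙ n)ᗮ).subtype).normDet ^ 2) = _ := hsq
    rw [this]
    linear_combination (-1) * hpars
  exact (sq_eq_sq₀ (LinearMap.normDet_nonneg _) (abs_nonneg _)).1 h2

/-- The orthogonal projection along `e j` multiplies areas in a plane with unit normal `n` by
`|n j|`. -/
lemma volume_image_drop (j : Fin 3) {n x₀ : E3} (hn : ‖n‖ = 1) {A : Set E3}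
    (hA : ∀ x ∈ A, ⟪n, x - x₀⟫ = 0) :
    volume (drop j '' A) = ENNReal.ofReal |n j| * area A := by
  have hn0 : n ≠ 0 := by intro h; simp [h] at hn
  have hfin := finrank_orthogonal_span hn0
  let s : Set ((ℝ ∙ n)ᗮ : Submodule ℝ E3) := {v | x₀ + v ∈ A}
  have h1 : A = (fun v : ((ℝ ∙ n)ᗮ : Submodule ℝ E3) => x₀ + (v : E3)) '' s := by
    ext x
    constructor
    · intro hx
      refine ⟨⟨x - x₀, Submodule.mem_orthogonal_singleton_iff_inner_right.2 (hA x hx)⟩, ?_, ?_⟩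
      · simpa [s] using hx
      · simp
    · rintro ⟨v, hv, rfl⟩; exact hv
  have hiso : Isometry (fun v : ((ℝ ∙ n)ᗮ : Submodule ℝ E3) => x₀ + (v : E3)) :=
    (isometry_add_left x₀).comp isometry_subtype_coe
  have h2 : area A = Measure.euclideanHausdorffMeasure 2 s := by
    conv_lhs => rw [h1]
    exact hiso.euclideanHausdorffMeasure_image s
  have h3 : drop j '' A
      = (fun z => drop j x₀ + z) '' (((drop j) ∘ₗ ((ℝ ∙ n)ᗮ).subtype) '' s) := by
    conv_lhs => rw [h1]
    simp [Set.image_image]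
  have h4 := LinearMap.euclideanHausdorffMeasure_image ((drop j) ∘ₗ ((ℝ ∙ n)ᗮ).subtype) s
  rw [hfin, normDet_drop j hn, EuclideanSpace.euclideanHausdorffMeasure_eq_volume] at h4
  rw [h3, h2, ← h4]
  rw [← EuclideanSpace.euclideanHausdorffMeasure_eq_volume]
  exact (isometry_add_left (drop j x₀)).euclideanHausdorffMeasure_image _

/-- The `j`-th coordinate of the point over `y` on the plane `⟪n, x⟫ = c`, for `n j ≠ 0`. -/
def height (n : E3) (c : ℝ) (j : Fin 3) (y : E2) : ℝ := (c - ⟪n, ins j y 0⟫) / n j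

lemma continuous_height (n : E3) (c : ℝ) (j : Fin 3) : Continuous (height n c j) := by
  unfold height
  have : Continuous fun y : E2 => ins j y 0 :=
    (continuous_ins j).comp (continuous_id.prodMk continuous_const)
  fun_prop

lemma height_drop {n x₀ x : E3} {j : Fin 3} (hj : n j ≠ 0) (hx : ⟪n, x - x₀⟫ = 0) :
    height n ⟪n, x₀⟫ j (drop j x) = x j := by
  have h := ins_add j (drop j x) 0 (x j)
  rw [zero_add, ins_drop] at h
  have h2 : ⟪n, x⟫ = ⟪n, ins j (drop j x) 0⟫ + x j * n j := by
    conv_lhs => rw [h]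
    rw [inner_add_right, inner_smul_right]
    simp [EuclideanSpace.inner_single_right]
  rw [inner_sub_right] at hx
  rw [height, div_eq_iff hj]
  linarith

lemma ins_height_drop {n x₀ x : E3} {j : Fin 3} (hj : n j ≠ 0) (hx : ⟪n, x - x₀⟫ = 0) :
    ins j (drop j x) (height n ⟪n, x₀⟫ j (drop j x)) = x := by
  rw [height_drop hj hx, ins_drop]

lemma exists_coord_ne_zero {n : E3} (hn : ‖n‖ = 1) : ∃ j, n j ≠ 0 := by
  by_contra! h
  have : n = 0 := by ext j; simp [h j]
  simp [this] at hn

lemma area_lt_top {n x₀ : E3} (hn : ‖n‖ = 1) {F : Set E3} (hF : IsCompact F)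
    (hp : ∀ x ∈ F, ⟪n, x - x₀⟫ = 0) : area F < ⊤ := by
  obtain ⟨j, hj⟩ := exists_coord_ne_zero hn
  have h := volume_image_drop j hn hp
  have h2 : volume (drop j '' F) < ⊤ := (hF.image (continuous_drop j)).measure_lt_top
  rw [h] at h2
  by_contra h3
  rw [not_lt_top_iff.1 h3, ENNReal.mul_top] at h2
  · exact lt_irrefl _ h2
  · simpa using hj

lemma volume_image_drop_eq_zero (j : Fin 3) {n x₀ : E3} (hn : ‖n‖ = 1) {A : Set E3}
    (hA : ∀ x ∈ A, ⟪n, x - x₀⟫ = 0) (h : area A = 0 ∨ n j = 0) : volume (drop j '' A) = 0 := by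
  rw [volume_image_drop j hn hA]
  rcases h with h | h <;> simp [h]

/-- Integrals over a plane piece of surface as integrals over its coordinate projection. -/
lemma integral_image_drop {j : Fin 3} {n x₀ : E3} (hn : ‖n‖ = 1) (hj : n j ≠ 0) {F : Set E3}
    (hF : IsCompact F) (hp : ∀ x ∈ F, ⟪n, x - x₀⟫ = 0) {ψ : E3 → ℝ} (hψ : Continuous ψ) :
    ∫ y in drop j '' F, ψ (ins j y (height n ⟪n, x₀⟫ j y)) = |n j| * ∫ x in F, ψ x ∂area := by
  have hmap : volume.restrict (drop j '' F)
      = ENNReal.ofReal |n j| • (area.restrict F).map (drop j) := by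
    ext s hs
    rw [Measure.restrict_apply hs, Measure.smul_apply,
      Measure.map_apply (continuous_drop j).measurable hs,
      Measure.restrict_apply ((continuous_drop j).measurable hs), smul_eq_mul,
      ← volume_image_drop j hn (x₀ := x₀) (fun x hx => hp x hx.2)]
    congr 1
    ext y
    constructor
    · rintro ⟨hy, x, hx, rfl⟩; exact ⟨x, ⟨hy, hx⟩, rfl⟩
    · rintro ⟨x, ⟨hy, hx⟩, rfl⟩; exact ⟨hy, x, hx, rfl⟩
  have hc : Continuous fun y : E2 => ψ (ins j y (height n ⟪n, x₀⟫ j y)) :=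
    hψ.comp ((continuous_ins j).comp (continuous_id.prodMk (continuous_height n _ j)))
  rw [hmap, integral_smul_measure, integral_map (continuous_drop j).aemeasurable
    hc.aestronglyMeasurable, ENNReal.toReal_ofReal (abs_nonneg _), smul_eq_mul]
  congr 1
  refine setIntegral_congr_fun hF.measurableSet fun x hx => ?_
  simp only [ins_height_drop hj (hp x hx)]

/-! ### The fundamental theorem of calculus on a finite union of intervals -/

lemma _root_.IsPreconnected.subset_or_disjoint_of_frontier {X : Type*} [TopologicalSpace X]
    {J S : Set X} (hJ : IsPreconnected J) (h : Disjoint J (frontier S)) :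
    J ⊆ S ∨ Disjoint J S := by
  have hsub : J ⊆ interior S ∪ interior Sᶜ := by
    rw [← compl_frontier_eq_union_interior]
    exact h.subset_compl_right
  rcases hJ.subset_or_subset isOpen_interior isOpen_interior
    (disjoint_compl_right.mono interior_subset interior_subset) hsub with h' | h'
  · exact Or.inl (h'.trans interior_subset)
  · exact Or.inr (disjoint_compl_right.symm.mono_left (h'.trans interior_subset))

/-- If the bounded set `S` of reals has its boundary in the finite set of the `τ f`, and `S` lies to
the left of `τ f` for `σ f = 1` and to the right for `σ f = -1`, then a point `t` is in `S` exactly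
if the sum of the `σ f` over the `τ f` beyond `t` is one, and outside if it is zero. -/
lemma indicator_eq_sum_sign {ι : Type*} {S : Set ℝ} {I : Finset ι} {τ σ : ι → ℝ}
    (hb : BddAbove S) (hfr : ∀ t ∈ frontier S, ∃ f ∈ I, τ f = t) (hinj : Set.InjOn τ I)
    (hσ : ∀ f ∈ I, (σ f = 1 ∧ (∀ᶠ t in 𝓝[<] τ f, t ∈ S) ∧ ∀ᶠ t in 𝓝[>] τ f, t ∉ S) ∨
      (σ f = -1 ∧ (∀ᶠ t in 𝓝[<] τ f, t ∉ S) ∧ ∀ᶠ t in 𝓝[>] τ f, t ∈ S))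
    (t : ℝ) (ht : ∀ f ∈ I, τ f ≠ t) :
    S.indicator (fun _ => (1 : ℝ)) t = ∑ f ∈ I, if t < τ f then σ f else 0 := by
  -- `S` does not change along an interval without boundary points
  have hconst : ∀ J : Set ℝ, IsPreconnected J → (∀ s ∈ J, ∀ f ∈ I, τ f ≠ s) →
      J ⊆ S ∨ Disjoint J S := by
    intro J hJ hJf
    refine hJ.subset_or_disjoint_of_frontier (disjoint_left.2 fun x hx hx' => ?_)
    obtain ⟨f, hf, hfx⟩ := hfr x hx'
    exact hJf x hx f hf hfx
  induction hcard : (I.filter fun f => t < τ f).card using Nat.strong_induction_on generalizing t with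
  | _ n ih =>
  by_cases hemp : (I.filter fun f => t < τ f) = ∅
  · have hge : ∀ f ∈ I, ¬ t < τ f := fun f hf h => by
      have : f ∈ I.filter fun f => t < τ f := by simp [hf, h]
      simp [hemp] at this
    have h1 : t ∉ S := by
      intro htS
      rcases hconst (Ici t) isPreconnected_Ici (fun s hs f hf h => by
        rcases hs.out.eq_or_lt with h' | h'
        · exact ht f hf (h.trans h'.symm)
        · exact hge f hf (h ▸ h')) with h | h
      · exact not_bddAbove_Ici t (hb.mono h)
      · exact disjoint_left.1 h (mem_Ici.2 le_rfl) htS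
    rw [Set.indicator_of_notMem h1, Finset.sum_congr rfl fun f hf => if_neg (hge f hf)]
    simp
  · obtain ⟨f₀, hf₀, hmin⟩ := Finset.exists_min_image _ τ (Finset.nonempty_iff_ne_empty.2 hemp)
    rw [Finset.mem_filter] at hf₀
    obtain ⟨hf₀, hlt⟩ := hf₀
    have hne : ∀ f ∈ I, f ≠ f₀ → τ f ≠ τ f₀ := fun f hf hne h => hne (hinj hf hf₀ h)
    -- no boundary point lies in `[t, τ f₀)` or immediately after `τ f₀`
    have hleft : ∀ s ∈ Ico t (τ f₀), ∀ f ∈ I, τ f ≠ s := by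
      rintro s ⟨hs1, hs2⟩ f hf rfl
      rcases hs1.eq_or_lt with h | h
      · exact ht f hf h.symm
      · exact absurd (hmin f (by simp [hf, h])) (not_le.2 hs2)
    have hright : ∀ᶠ s in 𝓝[>] τ f₀, ∀ f ∈ I, f ≠ f₀ → (τ f < τ f₀ ∨ s < τ f) := by
      refine (Filter.eventually_all_finset I).2 fun f hf => ?_
      by_cases hff : f = f₀
      · exact Eventually.of_forall fun _ h => absurd hff h
      rcases lt_or_gt_of_ne (hne f hf hff) with h | h
      · exact Eventually.of_forall fun _ _ => Or.inl h
      · filter_upwards [nhdsWithin_le_nhds (Iio_mem_nhds h)] with s hs _ using Or.inr hs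
    have hS_left : ∀ᶠ s in 𝓝[<] τ f₀, (s ∈ S ↔ t ∈ S) := by
      filter_upwards [Ico_mem_nhdsLT hlt] with s hs
      rcases hconst _ isPreconnected_Ico hleft with h | h
      · exact iff_of_true (h hs) (h ⟨le_rfl, hlt⟩)
      · exact iff_of_false (disjoint_left.1 h hs) (disjoint_left.1 h ⟨le_rfl, hlt⟩)
    have key : ∀ t', τ f₀ < t' → (∀ f ∈ I, f ≠ f₀ → (τ f < τ f₀ ∨ t' < τ f)) →
        S.indicator (fun _ => (1 : ℝ)) t' = ∑ f ∈ I, if t' < τ f then σ f else 0 := by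
      intro t' ht' hsep
      refine ih _ ?_ t' (fun f hf h => ?_) rfl
      · rw [← hcard]
        refine Finset.card_lt_card ⟨fun f hf => ?_, fun h => ?_⟩
        · rw [Finset.mem_filter] at hf ⊢
          exact ⟨hf.1, hlt.trans (ht'.trans hf.2)⟩
        · have := h (Finset.mem_filter.2 ⟨hf₀, hlt⟩)
          rw [Finset.mem_filter] at this
          exact lt_asymm ht' this.2
      · by_cases hff : f = f₀
        · subst hff; exact ht'.ne h
        · rcases hsep f hf hff with h' | h'
          · exact lt_asymm h' (h ▸ ht')
          · exact h'.ne h.symm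
    have hsum : ∀ t', τ f₀ < t' → (∀ f ∈ I, f ≠ f₀ → (τ f < τ f₀ ∨ t' < τ f)) →
        ∑ f ∈ I, (if t < τ f then σ f else 0)
          = σ f₀ + ∑ f ∈ I, if t' < τ f then σ f else 0 := by
      classical
      intro t' ht' hsep
      rw [← Finset.add_sum_erase I _ hf₀, ← Finset.add_sum_erase I _ hf₀, if_pos hlt,
        if_neg (not_lt.2 ht'.le), zero_add]
      congr 1
      refine Finset.sum_congr rfl fun f hf => ?_
      rw [Finset.mem_erase] at hf
      rcases hsep f hf.2 hf.1 with h | h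
      · have h1 : ¬ t < τ f := fun h' => absurd (hmin f (by simp [hf.2, h'])) (not_le.2 h)
        rw [if_neg h1, if_neg (not_lt.2 (h.trans ht').le)]
      · rw [if_pos h, if_pos (hlt.trans (ht'.trans h))]
    rcases hσ f₀ hf₀ with ⟨h1, h2, h3⟩ | ⟨h1, h2, h3⟩
    · obtain ⟨s, hs1, hs2⟩ := (h2.and hS_left).exists
      obtain ⟨t', ⟨ht1, ht2⟩, ht3⟩ := ((h3.and hright).and self_mem_nhdsWithin).exists
      rw [hsum t' ht3 ht2, ← key t' ht3 ht2, Set.indicator_of_mem (hs2.1 hs1),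
        Set.indicator_of_notMem ht1, h1, add_zero]
    · obtain ⟨s, hs1, hs2⟩ := (h2.and hS_left).exists
      obtain ⟨t', ⟨ht1, ht2⟩, ht3⟩ := ((h3.and hright).and self_mem_nhdsWithin).exists
      rw [hsum t' ht3 ht2, ← key t' ht3 ht2, Set.indicator_of_notMem (fun h => hs1 (hs2.2 h)),
        Set.indicator_of_mem ht1, h1]
      norm_num

/-- The fundamental theorem of calculus on a set of reals with finite boundary. -/
lemma setIntegral_deriv_eq_sum_sign {ι : Type*} {S : Set ℝ} {I : Finset ι} {τ σ : ι → ℝ}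
    (hS : MeasurableSet S)
    (hb : BddAbove S) (hfr : ∀ t ∈ frontier S, ∃ f ∈ I, τ f = t) (hinj : Set.InjOn τ I)
    (hσ : ∀ f ∈ I, (σ f = 1 ∧ (∀ᶠ t in 𝓝[<] τ f, t ∈ S) ∧ ∀ᶠ t in 𝓝[>] τ f, t ∉ S) ∨
      (σ f = -1 ∧ (∀ᶠ t in 𝓝[<] τ f, t ∉ S) ∧ ∀ᶠ t in 𝓝[>] τ f, t ∈ S))
    {h : ℝ → ℝ} (hh : ContDiff ℝ 1 h) (hc : HasCompactSupport h) :
    ∫ t in S, deriv h t = ∑ f ∈ I, σ f * h (τ f) := by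
  have hint : Integrable (deriv h) :=
    (hh.continuous_deriv le_rfl).integrable_of_hasCompactSupport hc.deriv
  have hae : ∀ᵐ t : ℝ, S.indicator (deriv h) t
      = ∑ f ∈ I, σ f * (Iio (τ f)).indicator (deriv h) t := by
    have : ∀ᵐ t : ℝ, t ∉ τ '' I :=
      measure_eq_zero_iff_ae_notMem.1 ((I.finite_toSet.image τ).measure_zero _)
    filter_upwards [this] with t ht
    have := indicator_eq_sum_sign hb hfr hinj hσ t (fun f hf h => ht ⟨f, hf, h⟩)
    have h2 : S.indicator (deriv h) t = S.indicator (fun _ => (1 : ℝ)) t * deriv h t := by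
      by_cases hs : t ∈ S <;> simp [hs]
    rw [h2, this, Finset.sum_mul]
    refine Finset.sum_congr rfl fun f _ => ?_
    by_cases hs : t < τ f <;> simp [hs]
  rw [← integral_indicator hS, integral_congr_ae hae, integral_finsetSum]
  · refine Finset.sum_congr rfl fun f _ => ?_
    rw [integral_const_mul, integral_indicator measurableSet_Iio, ← integral_Iic_eq_integral_Iio,
      hc.integral_Iic_deriv_eq hh]
  · intro f _
    exact (hint.indicator measurableSet_Iio).const_mul _

/-! ### Regular points of the faces -/

lemma area_affineSubspace_eq_zero {l : AffineSubspace ℝ E3}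
    (hl : Module.finrank ℝ l.direction = 1) : area (l : Set E3) = 0 := by
  rcases (l : Set E3).eq_empty_or_nonempty with h | ⟨x₀, hx₀⟩
  · rw [h]; exact measure_empty
  have h1 : (l : Set E3) = (fun v : l.direction => (v : E3) + x₀) '' univ := by
    ext x
    simp only [image_univ, mem_range]
    constructor
    · intro hx
      exact ⟨⟨x - x₀, AffineSubspace.vsub_mem_direction hx hx₀⟩, by simp⟩
    · rintro ⟨v, rfl⟩
      exact AffineSubspace.vadd_mem_of_mem_direction v.2 hx₀
  have hiso : Isometry (fun v : l.direction => (v : E3) + x₀) :=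
    (isometry_add_right x₀).comp isometry_subtype_coe
  rw [h1, hiso.euclideanHausdorffMeasure_image, Measure.euclideanHausdorffMeasure_def]
  have : (μH[(2 : ℕ)] : Measure l.direction) = 0 :=
    Real.hausdorffMeasure_of_finrank_lt (by rw [hl]; norm_num)
  rw [this]; simp

namespace PolyPartition

variable {Ω : Set E3} (M : PolyPartition Ω)

lemma face_plane {i : Fin M.N} {f : Fin M.L} (hf : f ∈ M.faces i) {x₀ : E3} (hx₀ : x₀ ∈ M.face f) :
    ∀ x ∈ M.face f, ⟪M.normal i f, x - x₀⟫ = 0 :=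
  fun x hx => M.normal_orthogonal i f hf x hx x₀ hx₀

lemma face_nonempty (f : Fin M.L) : (M.face f).Nonempty := (M.face_isPolygon f).isConnected.nonempty

lemma exists_mem_faces (f : Fin M.L) : ∃ i, f ∈ M.faces i := by
  rcases M.face_cases f with ⟨_, h⟩ | ⟨i, _, _, h, _⟩
  · exact h
  · exact ⟨i, h⟩

lemma area_face_lt_top (f : Fin M.L) : area (M.face f) < ⊤ := by
  obtain ⟨i, hi⟩ := M.exists_mem_faces f
  obtain ⟨x₀, hx₀⟩ := M.face_nonempty f
  exact area_lt_top (M.normal_unit i f hi) (M.face_isPolygon f).isCompact (M.face_plane hi hx₀)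

instance (f : Fin M.L) : IsFiniteMeasure (area.restrict (M.face f)) :=
  ⟨by rw [Measure.restrict_apply_univ]; exact M.area_face_lt_top f⟩

lemma face_subset_frontier {i : Fin M.N} {f : Fin M.L} (hf : f ∈ M.faces i) :
    M.face f ⊆ frontier (M.elem i) := by
  rw [M.frontier_elem i]
  exact subset_biUnion_of_mem (u := M.face) hf

lemma measurableSet_face (f : Fin M.L) : MeasurableSet (M.face f) :=
  (M.face_isPolygon f).isCompact.measurableSet

/-- The points of space outside all faces other than `f`. -/
def around (f : Fin M.L) : Set E3 := ⋂ f' ∈ ({f}ᶜ : Set (Fin M.L)), (M.face f')ᶜ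

lemma isOpen_around (f : Fin M.L) : IsOpen (M.around f) :=
  (Set.toFinite _).isOpen_biInter fun f' _ => (M.face_isPolygon f').isCompact.isClosed.isOpen_compl

lemma notMem_face_of_mem_around {f f' : Fin M.L} (h : f' ≠ f) {x : E3} (hx : x ∈ M.around f) :
    x ∉ M.face f' := by
  have := mem_iInter₂.1 hx f' (by simpa using h)
  exact this

lemma ae_mem_around (f : Fin M.L) : ∀ᵐ x ∂(area.restrict (M.face f)), x ∈ M.around f := by
  simp only [around, mem_iInter]
  refine ae_all_iff.2 fun f' => ae_all_iff.2 fun hf' => ?_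
  rw [ae_restrict_iff' (M.measurableSet_face f)]
  have : ∀ᵐ x ∂area, x ∉ M.face f ∩ M.face f' :=
    measure_eq_zero_iff_ae_notMem.1 (M.face_overlap f f' (by simpa [eq_comm] using hf'))
  filter_upwards [this] with x hx hxf hxf'
  exact hx ⟨hxf, hxf'⟩

/-- A point of a face near which all elements having this face look like half-spaces. -/
def IsRegular (f : Fin M.L) (x : E3) : Prop :=
  ∃ r > 0, Metric.ball x r ⊆ M.around f ∧ ∀ i, f ∈ M.faces i → ∀ y ∈ Metric.ball x r,
    (⟪M.normal i f, y - x⟫ < 0 → y ∈ M.elem i) ∧ (0 ≤ ⟪M.normal i f, y - x⟫ → y ∉ M.elem i)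

lemma ae_mem_intrinsicInterior {F : Set E3} (hF : IsPolygon F) :
    ∀ᵐ x ∂(area.restrict F), x ∈ intrinsicInterior ℝ F := by
  obtain ⟨S, hfin, hS, hsub⟩ := hF.edges
  have h0 : area (intrinsicFrontier ℝ F) = 0 :=
    measure_mono_null hsub ((measure_biUnion_null_iff hfin.countable).2 fun l hl =>
      area_affineSubspace_eq_zero (hS l hl))
  rw [ae_restrict_iff' hF.isCompact.measurableSet]
  filter_upwards [measure_eq_zero_iff_ae_notMem.1 h0] with x hx hxF
  have : x ∈ intrinsicClosure ℝ F := subset_intrinsicClosure hxF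
  rw [← intrinsicInterior_union_intrinsicFrontier] at this
  exact this.resolve_right hx

/-- Around a relative interior point, a polygon fills its plane. -/
lemma exists_ball_inter_plane_subset {F : Set E3} (hF : IsPolygon F) {n : E3} (hn : ‖n‖ = 1)
    (hp : ∀ x ∈ F, ∀ y ∈ F, ⟪n, x - y⟫ = 0) {x : E3} (hx : x ∈ intrinsicInterior ℝ F) :
    ∃ r > 0, ∀ y ∈ Metric.ball x r, ⟪n, y - x⟫ = 0 → y ∈ F := by
  have hn0 : n ≠ 0 := by intro h; simp [h] at hn
  have hxF : x ∈ F := intrinsicInterior_subset hx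
  obtain ⟨z, hz, rfl⟩ := hx
  have hdir : (affineSpan ℝ F).direction = (ℝ ∙ n)ᗮ := by
    refine Submodule.eq_of_le_of_finrank_eq ?_ ?_
    · rw [direction_affineSpan, vectorSpan_def, Submodule.span_le]
      rintro _ ⟨a, ha, b, hb, rfl⟩
      exact Submodule.mem_orthogonal_singleton_iff_inner_right.2 (hp a ha b hb)
    · rw [hF.planar, finrank_orthogonal_span hn0]
  obtain ⟨r, hr, hball⟩ := Metric.mem_nhds_iff.1 (mem_interior_iff_mem_nhds.1 hz)
  refine ⟨r, hr, fun y hy hy0 => ?_⟩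
  have hmem : y ∈ affineSpan ℝ F := by
    have h1 : y - (z : E3) ∈ (affineSpan ℝ F).direction := by
      rw [hdir]; exact Submodule.mem_orthogonal_singleton_iff_inner_right.2 hy0
    have := AffineSubspace.vadd_mem_of_mem_direction h1 z.2
    simpa using this
  exact hball (show (⟨y, hmem⟩ : affineSpan ℝ F) ∈ Metric.ball z r from hy)

lemma convex_halfBall (x n : E3) (r : ℝ) (s : Set ℝ) (hs : Convex ℝ s) :
    Convex ℝ {y | y ∈ Metric.ball x r ∧ ⟪n, y - x⟫ ∈ s} := by
  refine (convex_ball x r).inter fun y hy z hz a b ha hb hab => ?_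
  have h : a • y + b • z - x = a • (y - x) + b • (z - x) := by
    obtain rfl : b = 1 - a := by linarith
    module
  change ⟪n, a • y + b • z - x⟫ ∈ s
  rw [h, inner_add_right, inner_smul_right, inner_smul_right]
  exact hs hy hz ha hb hab

lemma ae_isRegular (f : Fin M.L) : ∀ᵐ x ∂(area.restrict (M.face f)), M.IsRegular f x := by
  have hout : ∀ᵐ x ∂(area.restrict (M.face f)), ∀ i, f ∈ M.faces i →
      ∀ᶠ t : ℝ in 𝓝[>] 0, x + t • M.normal i f ∉ M.elem i ∧ x - t • M.normal i f ∈ M.elem i :=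
    ae_all_iff.2 fun i => ae_all_iff.2 fun hf => M.normal_outward i f hf
  filter_upwards [hout, M.ae_mem_around f, ae_mem_intrinsicInterior (M.face_isPolygon f),
    ae_restrict_mem (M.measurableSet_face f)] with x hx har hint hxf
  obtain ⟨r₁, hr₁, hb₁⟩ := Metric.isOpen_iff.1 (M.isOpen_around f) x har
  have hr₂ : ∀ i, f ∈ M.faces i → ∃ r > 0, ∀ y ∈ Metric.ball x r,
      ⟪M.normal i f, y - x⟫ = 0 → y ∈ M.face f := fun i hi =>
    exists_ball_inter_plane_subset (M.face_isPolygon f) (M.normal_unit i f hi)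
      (M.normal_orthogonal i f hi) hint
  obtain ⟨i₀, hi₀⟩ := M.exists_mem_faces f
  have hr₃ : ∃ r > 0, ∀ i, f ∈ M.faces i → ∀ y ∈ Metric.ball x r,
      ⟪M.normal i f, y - x⟫ = 0 → y ∈ M.face f := by
    choose! R hR hR' using hr₂
    have hne : (Finset.univ.filter fun i => f ∈ M.faces i).Nonempty := ⟨i₀, by simp [hi₀]⟩
    refine ⟨(Finset.univ.filter fun i => f ∈ M.faces i).inf' hne R,
      (Finset.lt_inf'_iff _).2 fun i hi => hR i (by simpa using hi), fun i hi y hy => ?_⟩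
    exact hR' i hi y (Metric.ball_subset_ball (Finset.inf'_le R (by simp [hi])) hy)
  obtain ⟨r₂, hr₂, hb₂⟩ := hr₃
  refine ⟨min r₁ r₂, lt_min hr₁ hr₂,
    (Metric.ball_subset_ball (min_le_left _ _)).trans hb₁, fun i hi => ?_⟩
  set r := min r₁ r₂
  set n := M.normal i f
  have hnn : ⟪n, n⟫ = 1 := by rw [real_inner_self_eq_norm_sq, M.normal_unit i f hi]; norm_num
  have hnn' : ⟪n, M.normal i f⟫ = 1 := hnn
  have hfr : ∀ y ∈ Metric.ball x r, y ∈ frontier (M.elem i) → ⟪n, y - x⟫ = 0 := by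
    intro y hy hyf
    rw [M.frontier_elem i, mem_iUnion₂] at hyf
    obtain ⟨f', hf', hyf'⟩ := hyf
    by_cases hff : f' = f
    · subst hff; exact M.normal_orthogonal i _ hi y hyf' x hxf
    · exact absurd hyf' (M.notMem_face_of_mem_around hff
        (hb₁ (Metric.ball_subset_ball (min_le_left _ _) hy)))
  -- each open half ball is connected and misses the boundary of the element
  have hhalf : ∀ s : Set ℝ, Convex ℝ s → (0 : ℝ) ∉ s →
      {y | y ∈ Metric.ball x r ∧ ⟪n, y - x⟫ ∈ s} ⊆ M.elem i ∨
      Disjoint {y | y ∈ Metric.ball x r ∧ ⟪n, y - x⟫ ∈ s} (M.elem i) := fun s hs h0 =>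
    (convex_halfBall x n r s hs).isPreconnected.subset_or_disjoint_of_frontier
      (disjoint_left.2 fun y hy hyf => h0 (by rw [← hfr y hy.1 hyf]; exact hy.2))
  have hsmall : ∀ᶠ t : ℝ in 𝓝[>] 0, x + t • n ∈ Metric.ball x r ∧ x - t • n ∈ Metric.ball x r := by
    have h1 : ∀ᶠ t : ℝ in 𝓝[>] 0, t < r := nhdsWithin_le_nhds (Iio_mem_nhds (lt_min hr₁ hr₂))
    filter_upwards [h1, self_mem_nhdsWithin] with t ht ht0
    have h2 : ‖t • n‖ < r := by
      rw [norm_smul, M.normal_unit i f hi, mul_one, Real.norm_of_nonneg (le_of_lt ht0)]; exact ht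
    simpa [Metric.mem_ball, dist_eq_norm] using h2
  obtain ⟨t, ⟨⟨ht1, ht2⟩, ht3, ht4⟩, ht0⟩ :=
    (((hx i hi).and hsmall).and self_mem_nhdsWithin).exists
  have ht0 : 0 < t := ht0
  have hneg := hhalf (Iio 0) (convex_Iio _) (by simp)
  have hpos := hhalf (Ioi 0) (convex_Ioi _) (by simp)
  intro y hy
  constructor
  · intro hlt
    rcases hneg with h | h
    · exact h ⟨hy, hlt⟩
    · refine absurd ht2 (disjoint_left.1 h ⟨ht4, by
        simp only [sub_sub_cancel_left, inner_neg_right, inner_smul_right, hnn', mem_Iio]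
        linarith⟩)
  · intro hge
    rcases hge.eq_or_lt with h0 | hgt
    · have := M.face_subset_frontier hi
        (hb₂ i hi y (Metric.ball_subset_ball (min_le_right _ _) hy) h0.symm)
      exact fun hy' => (disjoint_left.1 (disjoint_frontier_iff_isOpen.2 (M.elem_isOpen i)).symm hy') this
    · rcases hpos with h | h
      · refine absurd (h ⟨ht3, by
          simp only [add_sub_cancel_left, inner_smul_right, hnn, mem_Ioi]
          linarith⟩) ht1
      · exact disjoint_left.1 h ⟨hy, hgt⟩

end PolyPartition

/-! ### The divergence theorem on an element -/

lemma hasDerivAt_ins (j : Fin 3) (y : E2) (t : ℝ) :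
    HasDerivAt (ins j y) (EuclideanSpace.single j 1) t := by
  have : ins j y = fun s => ins j y 0 + s • EuclideanSpace.single j (1 : ℝ) := by
    funext s; rw [← ins_add, zero_add]
  rw [this]
  simpa using ((hasDerivAt_id t).smul_const (EuclideanSpace.single j (1 : ℝ))).const_add (ins j y 0)

lemma contDiff_ins (j : Fin 3) (y : E2) : ContDiff ℝ 1 (ins j y) := by
  have : ins j y = fun s => ins j y 0 + s • EuclideanSpace.single j (1 : ℝ) := by
    funext s; rw [← ins_add, zero_add]
  rw [this]
  fun_prop

lemma abs_le_norm_ins (j : Fin 3) (y : E2) (t : ℝ) : |t| ≤ ‖ins j y t‖ := by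
  have := PiLp.norm_apply_le (ins j y t) j
  simpa using this

lemma hasCompactSupport_comp_ins {φ : E3 → ℝ} (hφ : HasCompactSupport φ) (j : Fin 3) (y : E2) :
    HasCompactSupport fun t => φ (ins j y t) := by
  obtain ⟨R, hR⟩ := hφ.isCompact.isBounded.exists_norm_le
  refine HasCompactSupport.intro (K := Icc (-R) R) isCompact_Icc fun t ht => ?_
  by_contra h
  have h1 := hR _ (subset_tsupport φ h)
  exact ht (abs_le.1 ((abs_le_norm_ins j y t).trans h1))

namespace PolyPartition

variable {Ω : Set E3} (M : PolyPartition Ω)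

/-- The height over `y` of the plane of a face, along the coordinate direction `j`. -/
def faceHeight (i : Fin M.N) (j : Fin 3) (y : E2) (f : Fin M.L) : ℝ :=
  height (M.normal i f) ⟪M.normal i f, (M.face_nonempty f).some⟫ j y

variable {M}

lemma faceHeight_eq {i : Fin M.N} {f : Fin M.L} (hf : f ∈ M.faces i) {j : Fin 3}
    (hj : M.normal i f j ≠ 0) {x : E3} (hx : x ∈ M.face f) :
    M.faceHeight i j (drop j x) f = x j :=
  height_drop hj (M.face_plane hf (M.face_nonempty f).some_mem x hx)

open Classical in
/-- The divergence theorem along a line in direction `e j` that meets faces at regular points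
only and no face parallel to it. -/
lemma setIntegral_deriv_line (i : Fin M.N) (j : Fin 3) (y : E2)
    (hreg : ∀ f ∈ M.faces i, ∀ x ∈ M.face f, drop j x = y → M.IsRegular f x)
    (hpar : ∀ f ∈ M.faces i, M.normal i f j = 0 → y ∉ drop j '' M.face f)
    {h : ℝ → ℝ} (hh : ContDiff ℝ 1 h) (hc : HasCompactSupport h) :
    ∫ t in {t | ins j y t ∈ M.elem i}, deriv h t
      = ∑ f ∈ M.faces i with y ∈ drop j '' M.face f,
          Real.sign (M.normal i f j) * h (M.faceHeight i j y f) := by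
  have hcont : Continuous (ins j y) :=
    (continuous_ins j).comp (continuous_const.prodMk continuous_id)
  -- the point of a face over `y`, and its height
  have hpt : ∀ f ∈ M.faces i, y ∈ drop j '' M.face f →
      M.normal i f j ≠ 0 ∧ ins j y (M.faceHeight i j y f) ∈ M.face f := by
    intro f hf hy
    have hj : M.normal i f j ≠ 0 := fun h0 => hpar f hf h0 hy
    obtain ⟨x, hx, rfl⟩ := hy
    exact ⟨hj, by rw [faceHeight_eq hf hj hx, ins_drop]; exact hx⟩
  refine setIntegral_deriv_eq_sum_sign ((M.elem_isOpen i).preimage hcont).measurableSet ?_ ?_ ?_ ?_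
    hh hc
  · obtain ⟨R, hR⟩ := (M.elem_isBounded i).exists_norm_le
    exact ⟨R, fun t ht => (le_abs_self t).trans ((abs_le_norm_ins j y t).trans (hR _ ht))⟩
  · intro t ht
    have h1 : ins j y t ∈ frontier (M.elem i) := hcont.frontier_preimage_subset _ ht
    rw [M.frontier_elem i, mem_iUnion₂] at h1
    obtain ⟨f, hf, hx⟩ := h1
    have hy : y ∈ drop j '' M.face f := ⟨_, hx, by simp⟩
    refine ⟨f, Finset.mem_filter.2 ⟨hf, hy⟩, ?_⟩
    have := faceHeight_eq hf (hpt f hf hy).1 hx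
    simpa using this
  · intro f hf f' hf' heq
    rw [Finset.mem_coe, Finset.mem_filter] at hf hf'
    by_contra hne
    have h1 := (hpt f hf.1 hf.2).2
    have h2 := (hpt f' hf'.1 hf'.2).2
    rw [← heq] at h2
    obtain ⟨r, hr, hb, -⟩ := hreg f hf.1 _ h1 (by simp)
    exact M.notMem_face_of_mem_around (Ne.symm hne) (hb (Metric.mem_ball_self hr)) h2
  · intro f hf
    rw [Finset.mem_filter] at hf
    obtain ⟨hj, hx⟩ := hpt f hf.1 hf.2
    obtain ⟨r, hr, -, hb⟩ := hreg f hf.1 _ hx (by simp)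
    set τ := M.faceHeight i j y f
    have hball : ∀ᶠ t in 𝓝 τ, ins j y t ∈ Metric.ball (ins j y τ) r :=
      hcont.continuousAt.eventually (Metric.ball_mem_nhds _ hr)
    have hinn : ∀ t, ⟪M.normal i f, ins j y t - ins j y τ⟫ = (t - τ) * M.normal i f j := by
      intro t
      have : ins j y t = ins j y τ + (t - τ) • EuclideanSpace.single j (1 : ℝ) := by
        rw [← ins_add]; congr 1; ring
      rw [this, add_sub_cancel_left, inner_smul_right]
      simp [EuclideanSpace.inner_single_right]
    have hL : ∀ᶠ t in 𝓝[<] τ, t < τ := self_mem_nhdsWithin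
    have hR : ∀ᶠ t in 𝓝[>] τ, τ < t := self_mem_nhdsWithin
    rcases lt_or_gt_of_ne hj with hneg | hpos
    · refine Or.inr ⟨Real.sign_of_neg hneg, ?_, ?_⟩
      · filter_upwards [hL, nhdsWithin_le_nhds hball] with t ht htb
        refine (hb i hf.1 _ htb).2 ?_
        rw [hinn]; nlinarith
      · filter_upwards [hR, nhdsWithin_le_nhds hball] with t ht htb
        refine (hb i hf.1 _ htb).1 ?_
        rw [hinn]; nlinarith
    · refine Or.inl ⟨Real.sign_of_pos hpos, ?_, ?_⟩
      · filter_upwards [hL, nhdsWithin_le_nhds hball] with t ht htb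
        refine (hb i hf.1 _ htb).1 ?_
        rw [hinn]; nlinarith
      · filter_upwards [hR, nhdsWithin_le_nhds hball] with t ht htb
        refine (hb i hf.1 _ htb).2 ?_
        rw [hinn]; nlinarith

/-- Almost every line in direction `e j` meets the faces of an element at regular points only, and
no face parallel to it. -/
lemma ae_line (i : Fin M.N) (j : Fin 3) : ∀ᵐ y : E2,
    (∀ f ∈ M.faces i, ∀ x ∈ M.face f, drop j x = y → M.IsRegular f x) ∧
    (∀ f ∈ M.faces i, M.normal i f j = 0 → y ∉ drop j '' M.face f) := by
  refine Filter.Eventually.and ?_ ?_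
  · refine (Filter.eventually_all_finset _).2 fun f hf => ?_
    have h0 : area {x | x ∈ M.face f ∧ ¬ M.IsRegular f x} = 0 := by
      have := M.ae_isRegular f
      rw [ae_restrict_iff' (M.measurableSet_face f)] at this
      refine measure_mono_null (fun x hx => ?_) (ae_iff.1 this)
      simpa using hx
    have h1 := volume_image_drop_eq_zero j (M.normal_unit i f hf)
      (x₀ := (M.face_nonempty f).some)
      (A := {x | x ∈ M.face f ∧ ¬ M.IsRegular f x})
      (fun x hx => M.face_plane hf (M.face_nonempty f).some_mem x hx.1) (Or.inl h0)
    filter_upwards [measure_eq_zero_iff_ae_notMem.1 h1] with y hy x hx hxy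
    by_contra h
    exact hy ⟨x, ⟨hx, h⟩, hxy⟩
  · refine (Filter.eventually_all_finset _).2 fun f hf => ?_
    by_cases h0 : M.normal i f j = 0
    · have h1 := volume_image_drop_eq_zero j (M.normal_unit i f hf)
        (M.face_plane hf (M.face_nonempty f).some_mem) (Or.inr h0)
      filter_upwards [measure_eq_zero_iff_ae_notMem.1 h1] with y hy _ using hy
    · exact Eventually.of_forall fun y h => absurd h h0

lemma integral_partial_of_hasCompactSupport (i : Fin M.N) (j : Fin 3) {φ : E3 → ℝ}
    (hφ : ContDiff ℝ 1 φ) (hc : HasCompactSupport φ) :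
    ∫ x in M.elem i, fderiv ℝ φ x (EuclideanSpace.single j 1)
      = ∑ f ∈ M.faces i, ∫ x in M.face f, φ x * M.normal i f j ∂area := by
  classical
  set F : E3 → ℝ := fun x => fderiv ℝ φ x (EuclideanSpace.single j 1) with hF
  have hFc : Continuous F := by
    have := hφ.continuous_fderiv one_ne_zero
    fun_prop
  have hFi : Integrable F := hFc.integrable_of_hasCompactSupport (hc.fderiv_apply ℝ _)
  have hTm := (M.elem_isOpen i).measurableSet
  have hψc : ∀ f, Continuous fun y : E2 => φ (ins j y (M.faceHeight i j y f)) := fun f =>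
    hφ.continuous.comp ((continuous_ins j).comp (continuous_id.prodMk (continuous_height _ _ j)))
  have hinner : ∀ᵐ y : E2, ∫ t, (M.elem i).indicator F (ins j y t)
      = ∑ f ∈ M.faces i, Real.sign (M.normal i f j) * (drop j '' M.face f).indicator
          (fun y => φ (ins j y (M.faceHeight i j y f))) y := by
    filter_upwards [ae_line (M := M) i j] with y hy
    have h1 := setIntegral_deriv_line i j y hy.1 hy.2 (hφ.comp (contDiff_ins j y))
      (hasCompactSupport_comp_ins hc j y)
    have hd : ∀ t, deriv (φ ∘ ins j y) t = F (ins j y t) := fun t =>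
      ((hφ.differentiable one_ne_zero _).hasFDerivAt.comp_hasDerivAt t
        (hasDerivAt_ins j y t)).deriv
    have hcont : Continuous (ins j y) :=
      (continuous_ins j).comp (continuous_const.prodMk continuous_id)
    have h2 : ∫ t, (M.elem i).indicator F (ins j y t)
        = ∫ t in {t | ins j y t ∈ M.elem i}, deriv (φ ∘ ins j y) t := by
      have hm : MeasurableSet {t | ins j y t ∈ M.elem i} :=
        ((M.elem_isOpen i).preimage hcont).measurableSet
      rw [← integral_indicator hm]
      refine integral_congr_ae (Eventually.of_forall fun t => ?_)
      dsimp only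
      by_cases ht : ins j y t ∈ M.elem i
      · rw [Set.indicator_of_mem ht, Set.indicator_of_mem (by exact ht), hd]
      · rw [Set.indicator_of_notMem ht, Set.indicator_of_notMem (by exact ht)]
    rw [h2, h1, Finset.sum_filter]
    refine Finset.sum_congr rfl fun f _ => ?_
    by_cases hf : y ∈ drop j '' M.face f
    · rw [if_pos hf, Set.indicator_of_mem hf]; rfl
    · rw [if_neg hf, Set.indicator_of_notMem hf, mul_zero]
  rw [← integral_indicator hTm, integral_eq_integral_ins j (hFi.indicator hTm),
    integral_congr_ae hinner]
  have hKc : ∀ f, IsCompact (drop j '' M.face f) := fun f =>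
    (M.face_isPolygon f).isCompact.image (continuous_drop j)
  rw [integral_finsetSum]
  · refine Finset.sum_congr rfl fun f hf => ?_
    rw [integral_const_mul, integral_indicator (hKc f).measurableSet]
    by_cases hj : M.normal i f j = 0
    · simp [hj]
    · have := integral_image_drop (M.normal_unit i f hf) hj (M.face_isPolygon f).isCompact
        (M.face_plane hf (M.face_nonempty f).some_mem) hφ.continuous
      rw [integral_mul_const]
      unfold faceHeight
      have hs : Real.sign (M.normal i f j) * |M.normal i f j| = M.normal i f j := by
        rcases lt_or_gt_of_ne hj with h | h
        · rw [Real.sign_of_neg h, abs_of_neg h]; ring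
        · rw [Real.sign_of_pos h, abs_of_pos h]; ring
      rw [this, ← mul_assoc, hs, mul_comm]
  · intro f _
    exact (((hψc f).continuousOn.integrableOn_compact (hKc f)).integrable_indicator
      (hKc f).measurableSet).const_mul _

/-- The divergence theorem on an element of the partition, for one partial derivative:
`∫_T ∂_j φ = ∫_{∂T} φ n_j`. Counting the signed crossings of each line in direction `e j` with the
faces reduces it to the fundamental theorem of calculus and the projection of areas. -/
theorem integral_partial (i : Fin M.N) (j : Fin 3) {φ : E3 → ℝ} (hφ : ContDiff ℝ ∞ φ) :
    ∫ x in M.elem i, fderiv ℝ φ x (EuclideanSpace.single j 1)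
      = ∑ f ∈ M.faces i, ∫ x in M.face f, φ x * M.normal i f j ∂area := by
  obtain ⟨R, hR0, hR⟩ := (M.elem_isBounded i).closure.subset_ball_lt 0 0
  let χ : ContDiffBump (0 : E3) := ⟨R, R + 1, hR0, by linarith⟩
  have h1 : ∀ x ∈ closure (M.elem i), χ =ᶠ[𝓝 x] fun _ => 1 := by
    intro x hx
    filter_upwards [Metric.isOpen_ball.mem_nhds (hR hx)] with y hy
    exact χ.one_of_mem_closedBall (Metric.ball_subset_closedBall hy)
  have h := integral_partial_of_hasCompactSupport i j (φ := fun x => χ x * φ x)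
    ((χ.contDiff.mul hφ).of_le (by exact_mod_cast le_top)) χ.hasCompactSupport.mul_right
  rw [setIntegral_congr_fun (g := fun x => fderiv ℝ φ x (EuclideanSpace.single j 1))
    (M.elem_isOpen i).measurableSet] at h
  · rw [h]
    refine Finset.sum_congr rfl fun f hf => ?_
    refine setIntegral_congr_fun (M.measurableSet_face f) fun x hx => ?_
    have := (h1 x (frontier_subset_closure (M.face_subset_frontier hf hx))).eq_of_nhds
    simp only [this, one_mul]
  · intro x hx
    have : (fun x => χ x * φ x) =ᶠ[𝓝 x] φ := by
      filter_upwards [h1 x (subset_closure hx)] with y hy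
      rw [hy, one_mul]
    simp only [this.fderiv_eq]

end PolyPartition

/-! ### How elements and faces fit together -/

/-- A Lipschitz domain lies on one side of its boundary. -/
lemma IsLipschitzDomain.interior_closure {Ω : Set E3} (hΩ : IsLipschitzDomain Ω) :
    interior (closure Ω) = Ω := by
  refine Subset.antisymm (fun x hx => ?_) hΩ.isOpen.subset_interior_closure
  by_contra hxΩ
  have hfr : x ∈ frontier Ω := ⟨interior_subset hx, fun h => hxΩ (interior_subset h)⟩
  obtain ⟨U, hU, hxU, ν, hν, K, g, hg, hinv, hgr⟩ := hΩ.graph x hfr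
  have hge : g x ≤ ⟪ν, x⟫ := not_lt.1 fun h => hxΩ ((hgr x hxU).2 h)
  have hc : Continuous fun t : ℝ => x + t • ν := by fun_prop
  -- just above the graph there is a point of `U` and of the interior of the closure
  have h1 : ∀ᶠ t : ℝ in 𝓝[>] 0, x + t • ν ∈ U ∩ interior (closure Ω) := by
    refine nhdsWithin_le_nhds (hc.continuousAt.eventually ?_)
    simpa using (hU.inter isOpen_interior).mem_nhds ⟨hxU, hx⟩
  obtain ⟨t, ⟨htU, htc⟩, ht⟩ := (h1.and self_mem_nhdsWithin).exists
  have ht : 0 < t := ht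
  have hlt : g (x + t • ν) < ⟪ν, x + t • ν⟫ := by
    rw [hinv, inner_add_right, inner_smul_right, real_inner_self_eq_norm_sq, hν]
    linarith
  have hopen : IsOpen {y | g y < ⟪ν, y⟫} :=
    isOpen_lt hg.continuous (continuous_const.inner continuous_id)
  obtain ⟨z, ⟨hz1, hz2⟩, hz3⟩ := mem_closure_iff.1 (interior_subset htc) _ (hU.inter hopen)
    ⟨htU, hlt⟩
  exact lt_asymm ((hgr z hz1).1 hz3) hz2

namespace PolyPartition

variable {Ω : Set E3} {M : PolyPartition Ω}

lemma elem_subset (hΩ : IsLipschitzDomain Ω) (i : Fin M.N) : M.elem i ⊆ Ω := by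
  refine Subset.trans ?_ hΩ.interior_closure.subset
  refine (M.elem_isOpen i).subset_interior_iff.2 (subset_closure.trans ?_)
  refine Subset.trans ?_ M.elem_cover.subset
  exact subset_iUnion (fun i => closure (M.elem i)) i

lemma volume_face (f : Fin M.L) : volume (M.face f) = 0 := by
  refine measure_mono_null (subset_affineSpan ℝ _)
    (Measure.addHaar_affineSubspace volume (affineSpan ℝ (M.face f)) fun h => ?_)
  have := (M.face_isPolygon f).planar
  rw [h, AffineSubspace.direction_top, finrank_top] at this
  simp at this

lemma ae_eq_iUnion_elem (hΩ : IsLipschitzDomain Ω) :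
    Ω =ᵐ[volume] ⋃ i, M.elem i := by
  refine EventuallyLE.antisymm ?_ (iUnion_subset (elem_subset hΩ)).eventuallyLE
  have h0 : volume (⋃ f, M.face f) = 0 := measure_iUnion_null fun f => volume_face f
  filter_upwards [measure_eq_zero_iff_ae_notMem.1 h0] with x hx hxΩ
  have : x ∈ ⋃ i, closure (M.elem i) := by rw [M.elem_cover]; exact subset_closure hxΩ
  obtain ⟨i, hi⟩ := mem_iUnion.1 this
  refine mem_iUnion.2 ⟨i, ?_⟩
  by_contra hni
  have hfr : x ∈ frontier (M.elem i) := by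
    rw [(M.elem_isOpen i).frontier_eq]; exact ⟨hi, hni⟩
  rw [M.frontier_elem i] at hfr
  obtain ⟨f, -, hf⟩ := mem_iUnion₂.1 hfr
  exact hx (mem_iUnion.2 ⟨f, hf⟩)

lemma integral_domain (hΩ : IsLipschitzDomain Ω) {F : E3 → ℝ} (hF : ∀ i, IntegrableOn F (M.elem i)) :
    ∫ x in Ω, F x = ∑ i, ∫ x in M.elem i, F x := by
  rw [setIntegral_congr_set (ae_eq_iUnion_elem (M := M) hΩ)]
  exact integral_iUnion_fintype (fun i => (M.elem_isOpen i).measurableSet)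
    (fun i j hij => M.elem_disjoint i j hij) hF

lemma area_face_ne_zero (f : Fin M.L) : area (M.face f) ≠ 0 := by
  intro h0
  obtain ⟨i, hi⟩ := M.exists_mem_faces f
  have hn := M.normal_unit i f hi
  obtain ⟨j, hj⟩ := exists_coord_ne_zero hn
  have hint : (intrinsicInterior ℝ (M.face f)).Nonempty := by
    rw [← closure_nonempty_iff, (M.face_isPolygon f).closure_interior]
    exact M.face_nonempty f
  obtain ⟨x, hx⟩ := hint
  have hxf : x ∈ M.face f := intrinsicInterior_subset hx
  obtain ⟨r, hr, hb⟩ := exists_ball_inter_plane_subset (M.face_isPolygon f) hn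
    (M.normal_orthogonal i f hi) hx
  set G : E2 → E3 := fun y => ins j y (height (M.normal i f) ⟪M.normal i f, x⟫ j y) with hG
  have hGc : Continuous G :=
    (continuous_ins j).comp (continuous_id.prodMk (continuous_height _ _ j))
  have hpl : ∀ y, ⟪M.normal i f, G y - x⟫ = 0 := by
    intro y
    have h := ins_add j y 0 (height (M.normal i f) ⟪M.normal i f, x⟫ j y)
    rw [zero_add] at h
    simp only [hG]
    rw [h, inner_sub_right, inner_add_right, inner_smul_right]
    simp only [EuclideanSpace.inner_single_right, one_mul, conj_trivial]
    rw [height]; field_simp; ring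
  have hsub : G ⁻¹' Metric.ball x r ⊆ drop j '' M.face f := fun y hy =>
    ⟨G y, hb _ hy (hpl y), by simp [hG]⟩
  have hpos : 0 < volume (G ⁻¹' Metric.ball x r) :=
    (Metric.isOpen_ball.preimage hGc).measure_pos _ ⟨drop j x, by
      simp [hG, ins_height_drop hj (M.face_plane hi hxf x hxf), hr]⟩
  exact hpos.ne' (measure_mono_null hsub
    (volume_image_drop_eq_zero j hn (M.face_plane hi hxf) (Or.inl h0)))

lemma exists_isRegular (f : Fin M.L) : ∃ x ∈ M.face f, M.IsRegular f x := by
  have : NeZero (area.restrict (M.face f)) :=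
    ⟨by rw [Ne, Measure.restrict_eq_zero]; exact area_face_ne_zero f⟩
  obtain ⟨x, hx, hx'⟩ := ((ae_restrict_mem (M.measurableSet_face f)).and (M.ae_isRegular f)).exists
  exact ⟨x, hx, hx'⟩

lemma inner_normal_self {i : Fin M.N} {f : Fin M.L} (hi : f ∈ M.faces i) :
    ⟪M.normal i f, M.normal i f⟫ = 1 := by
  rw [real_inner_self_eq_norm_sq, M.normal_unit i f hi]; norm_num

/-- The outward normals of two elements on a common face are opposite. -/
lemma normal_eq_neg {i j : Fin M.N} {f : Fin M.L} (hij : i ≠ j) (hi : f ∈ M.faces i)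
    (hj : f ∈ M.faces j) : M.normal j f = - M.normal i f := by
  obtain ⟨x, hx, r, hr, -, hb⟩ := exists_isRegular (M := M) f
  by_contra hne
  set n := M.normal i f
  set n' := M.normal j f
  have hnn : ⟪n, n⟫ = 1 := inner_normal_self hi
  have hnn' : ⟪n', n'⟫ = 1 := inner_normal_self hj
  have hpos : 0 < 1 + ⟪n, n'⟫ := by
    have h1 : n' + n ≠ 0 := fun h => hne (eq_neg_of_add_eq_zero_left h)
    have h2 : 0 < ⟪n' + n, n' + n⟫ := real_inner_self_pos.2 h1
    rw [inner_add_left, inner_add_right, inner_add_right, hnn, hnn', real_inner_comm n n'] at h2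
    have h3 := real_inner_comm n n'
    linarith
  -- a point slightly in direction `-(n + n')` is inside both elements
  have hc : Continuous fun t : ℝ => x - t • (n + n') := by fun_prop
  have h1 : ∀ᶠ t : ℝ in 𝓝[>] 0, x - t • (n + n') ∈ Metric.ball x r := by
    refine nhdsWithin_le_nhds (hc.continuousAt.eventually ?_)
    simpa only [zero_smul, sub_zero, Filter.eventually_mem_set] using Metric.ball_mem_nhds x hr
  obtain ⟨t, htb, ht⟩ := (h1.and self_mem_nhdsWithin).exists
  have ht : 0 < t := ht
  have hA : x - t • (n + n') ∈ M.elem i := by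
    refine (hb i hi _ htb).1 ?_
    change ⟪n, _⟫ < 0
    rw [sub_sub_cancel_left, inner_neg_right, inner_smul_right, inner_add_right, hnn]
    nlinarith
  have hB : x - t • (n + n') ∈ M.elem j := by
    refine (hb j hj _ htb).1 ?_
    change ⟪n', _⟫ < 0
    rw [sub_sub_cancel_left, inner_neg_right, inner_smul_right, inner_add_right, hnn',
      real_inner_comm]
    nlinarith
  exact disjoint_left.1 (M.elem_disjoint i j hij) hA hB

lemma eq_or_eq_of_mem_faces {i j l : Fin M.N} {f : Fin M.L} (hij : i ≠ j) (hi : f ∈ M.faces i)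
    (hj : f ∈ M.faces j) (hl : f ∈ M.faces l) : l = i ∨ l = j := by
  by_contra! h
  have h1 := normal_eq_neg hij hi hj
  have h2 := normal_eq_neg h.1 hl hi
  have h3 := normal_eq_neg h.2 hl hj
  have h4 : M.normal i f = 0 := by
    have : M.normal i f = - M.normal i f := by rw [← h1, h3, ← h2]
    have h5 : (2 : ℝ) • M.normal i f = 0 := by
      rw [two_smul]; nth_rewrite 1 [this]; exact neg_add_cancel _
    simpa using h5
  simpa [h4] using M.normal_unit i f hi

/-- A face shared by two elements is almost everywhere inside the domain. -/
lemma ae_mem_domain (hΩ : IsLipschitzDomain Ω) {i j : Fin M.N} {f : Fin M.L} (hij : i ≠ j)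
    (hi : f ∈ M.faces i) (hj : f ∈ M.faces j) :
    ∀ᵐ x ∂(area.restrict (M.face f)), x ∈ Ω := by
  filter_upwards [M.ae_isRegular f, ae_restrict_mem (M.measurableSet_face f)] with x hx hxf
  obtain ⟨r, hr, -, hb⟩ := hx
  rw [← hΩ.interior_closure, mem_interior]
  have hnn : ⟪M.normal i f, M.normal i f⟫ = 1 := inner_normal_self hi
  have hcover : ∀ y ∈ Metric.ball x r, ⟪M.normal i f, y - x⟫ ≠ 0 → y ∈ closure Ω := by
    intro y hy hne
    refine subset_closure ?_
    rcases lt_or_gt_of_ne hne with h | h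
    · exact elem_subset hΩ i ((hb i hi y hy).1 h)
    · refine elem_subset hΩ j ((hb j hj y hy).1 ?_)
      rw [normal_eq_neg hij hi hj, inner_neg_left]; linarith
  refine ⟨Metric.ball x r, fun y hy => ?_, Metric.isOpen_ball, Metric.mem_ball_self hr⟩
  by_cases hy0 : ⟪M.normal i f, y - x⟫ = 0
  · -- a point of the face is a limit of points off the face
    have hc : Continuous fun t : ℝ => y + t • M.normal i f := by fun_prop
    have h1 : ∀ᶠ t : ℝ in 𝓝[>] 0, y + t • M.normal i f ∈ Metric.ball x r := by
      refine nhdsWithin_le_nhds (hc.continuousAt.eventually ?_)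
      simpa only [zero_smul, add_zero, Filter.eventually_mem_set] using Metric.isOpen_ball.mem_nhds hy
    have h2 : Tendsto (fun t : ℝ => y + t • M.normal i f) (𝓝[>] 0) (𝓝 y) := by
      have := hc.tendsto 0
      simp only [zero_smul, add_zero] at this
      exact this.mono_left nhdsWithin_le_nhds
    refine isClosed_closure.mem_of_tendsto h2 ?_
    filter_upwards [h1, self_mem_nhdsWithin] with t ht ht0
    refine hcover _ ht ?_
    rw [add_sub_right_comm, inner_add_right, hy0, inner_smul_right, hnn]
    simpa using ne_of_gt (show (0 : ℝ) < t from ht0)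
  · exact hcover y hy hy0

lemma not_subset_frontier (hΩ : IsLipschitzDomain Ω) {i j : Fin M.N} {f : Fin M.L} (hij : i ≠ j)
    (hi : f ∈ M.faces i) (hj : f ∈ M.faces j) : ¬ M.face f ⊆ frontier Ω := by
  intro hsub
  have : NeZero (area.restrict (M.face f)) :=
    ⟨by rw [Ne, Measure.restrict_eq_zero]; exact area_face_ne_zero f⟩
  obtain ⟨x, hx, hx'⟩ := ((ae_restrict_mem (M.measurableSet_face f)).and
    (ae_mem_domain hΩ hij hi hj)).exists
  exact disjoint_left.1 (disjoint_frontier_iff_isOpen.2 hΩ.isOpen) (hsub hx) hx'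

lemma eq_of_subset_frontier (hΩ : IsLipschitzDomain Ω) {i j : Fin M.N} {f : Fin M.L}
    (hsub : M.face f ⊆ frontier Ω) (hi : f ∈ M.faces i) (hj : f ∈ M.faces j) : i = j := by
  by_contra h
  exact not_subset_frontier hΩ h hi hj hsub

lemma frontier_subset_iUnion_face (hΩ : IsLipschitzDomain Ω) : frontier Ω ⊆ ⋃ f, M.face f := by
  intro x hx
  have hxΩ : x ∉ Ω := fun h => disjoint_left.1 (disjoint_frontier_iff_isOpen.2 hΩ.isOpen) hx h
  have : x ∈ ⋃ i, closure (M.elem i) := by rw [M.elem_cover]; exact hx.1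
  obtain ⟨i, hi⟩ := mem_iUnion.1 this
  have hfr : x ∈ frontier (M.elem i) := by
    rw [(M.elem_isOpen i).frontier_eq]; exact ⟨hi, fun h => hxΩ (elem_subset hΩ i h)⟩
  rw [M.frontier_elem i] at hfr
  obtain ⟨f, -, hf⟩ := mem_iUnion₂.1 hfr
  exact mem_iUnion.2 ⟨f, hf⟩

lemma mem_face_of_mem_around (hΩ : IsLipschitzDomain Ω) {f : Fin M.L} {x : E3}
    (hx : x ∈ frontier Ω) (hxf : x ∈ M.around f) : x ∈ M.face f := by
  obtain ⟨f', hf'⟩ := mem_iUnion.1 (frontier_subset_iUnion_face (M := M) hΩ hx)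
  by_cases h : f' = f
  · exact h ▸ hf'
  · exact absurd hf' (M.notMem_face_of_mem_around h hxf)

open Classical in
/-- Contributions of the element boundaries that cancel on shared faces add up to a sum over the
faces on the boundary of the domain. -/
lemma sum_faces_eq_boundary {I : Fin M.N → Fin M.L → ℝ}
    (hI : ∀ i j f, i ≠ j → f ∈ M.faces i → f ∈ M.faces j → I i f + I j f = 0) :
    ∑ i, ∑ f ∈ M.faces i, I i f
      = ∑ i, ∑ f ∈ M.faces i with M.face f ⊆ frontier Ω, I i f := by
  have h0 : ∑ i, ∑ f ∈ M.faces i with ¬ M.face f ⊆ frontier Ω, I i f = 0 := by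
    have hswap : ∑ i, ∑ f ∈ M.faces i with ¬ M.face f ⊆ frontier Ω, I i f
        = ∑ f with ¬ M.face f ⊆ frontier Ω, ∑ i with f ∈ M.faces i, I i f := by
      refine Finset.sum_comm' fun i f => ?_
      simp
    rw [hswap]
    refine Finset.sum_eq_zero fun f hf => ?_
    rw [Finset.mem_filter] at hf
    rcases M.face_cases f with ⟨h, -⟩ | ⟨i, j, hij, hi, hj⟩
    · exact absurd h hf.2
    · have : (Finset.univ.filter fun l => f ∈ M.faces l) = {i, j} := by
        ext l
        simp only [Finset.mem_filter, Finset.mem_univ, true_and, Finset.mem_insert,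
          Finset.mem_singleton]
        constructor
        · exact eq_or_eq_of_mem_faces hij hi hj
        · rintro (rfl | rfl) <;> assumption
      rw [this, Finset.sum_pair hij, hI i j f hij hi hj]
  rw [← sub_eq_zero, ← h0, ← Finset.sum_sub_distrib]
  refine Finset.sum_congr rfl fun i _ => ?_
  rw [← Finset.sum_filter_add_sum_filter_not (M.faces i) fun f => M.face f ⊆ frontier Ω]
  ring

end PolyPartition

/-! ### Partial derivatives of smooth fields -/

/-- The unit vector in direction `j`. -/
abbrev ev (j : Fin 3) : E3 := EuclideanSpace.single j 1

lemma gradient_apply (φ : E3 → ℝ) (x : E3) (j : Fin 3) :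
    gradient φ x j = fderiv ℝ φ x (ev j) := by
  have h : ⟪gradient φ x, ev j⟫ = fderiv ℝ φ x (ev j) := by
    rw [gradient]; exact InnerProductSpace.toDual_symm_apply
  rw [← h, EuclideanSpace.inner_single_right]; simp

lemma contDiff_comp_apply {w : E3 → E3} (hw : ContDiff ℝ ∞ w) (j : Fin 3) :
    ContDiff ℝ ∞ fun x => w x j := by
  exact (contDiff_euclidean.1 hw) j

lemma contDiff_partial {φ : E3 → ℝ} (hφ : ContDiff ℝ ∞ φ) (e : E3) :
    ContDiff ℝ ∞ fun x => fderiv ℝ φ x e :=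
  (hφ.fderiv_right (m := ∞) (by simp)).clm_apply contDiff_const

lemma pd_eq {w : E3 → E3} (hw : ContDiff ℝ ∞ w) (i j : Fin 3) (x : E3) :
    pd w i j x = fderiv ℝ (fun y => w y j) x (ev i) := by
  have h1 : HasFDerivAt w (fderiv ℝ w x) x :=
    (hw.differentiable (by simp) x).hasFDerivAt
  have h2 : HasFDerivAt (fun y => w y j) ((EuclideanSpace.proj j).comp (fderiv ℝ w x)) x :=
    (EuclideanSpace.proj (𝕜 := ℝ) j).hasFDerivAt.comp x h1
  rw [h2.fderiv]; rfl

lemma contDiff_gradient {φ : E3 → ℝ} (hφ : ContDiff ℝ ∞ φ) : ContDiff ℝ ∞ (gradient φ) := by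
  rw [contDiff_euclidean]
  intro j
  simp only [gradient_apply]
  exact contDiff_partial hφ _

lemma contDiff_curl {w : E3 → E3} (hw : ContDiff ℝ ∞ w) : ContDiff ℝ ∞ (curl w) := by
  rw [contDiff_euclidean]
  have h : ∀ i j, ContDiff ℝ ∞ (pd w i j) := fun i j => by
    have : pd w i j = fun x => fderiv ℝ (fun y => w y j) x (ev i) := funext fun x => pd_eq hw i j x
    rw [this]
    exact contDiff_partial (contDiff_comp_apply hw j) _
  intro j
  fin_cases j
  · exact (h 1 2).sub (h 2 1)
  · exact (h 2 0).sub (h 0 2)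
  · exact (h 0 1).sub (h 1 0)

/-- The divergence of a smooth vector field. -/
def sdiv (w : E3 → E3) (x : E3) : ℝ := ∑ j, fderiv ℝ (fun y => w y j) x (ev j)

lemma contDiff_sdiv {w : E3 → E3} (hw : ContDiff ℝ ∞ w) : ContDiff ℝ ∞ (sdiv w) :=
  ContDiff.sum fun j _ => contDiff_partial (contDiff_comp_apply hw j) _

@[simp] lemma app_apply (A : Matrix (Fin 3) (Fin 3) ℝ) (v : E3) (j : Fin 3) :
    app A v j = ∑ a, A j a * v a := by
  simp [app, Matrix.mulVec, dotProduct]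

@[simp] lemma cross_zero' (a b : E3) : cross a b 0 = a 1 * b 2 - a 2 * b 1 := by
  simp [cross, crossProduct]

@[simp] lemma cross_one' (a b : E3) : cross a b 1 = a 2 * b 0 - a 0 * b 2 := by
  simp [cross, crossProduct]

@[simp] lemma cross_two' (a b : E3) : cross a b 2 = a 0 * b 1 - a 1 * b 0 := by
  simp [cross, crossProduct]

lemma contDiff_app {w : E3 → E3} (hw : ContDiff ℝ ∞ w) (A : Matrix (Fin 3) (Fin 3) ℝ) :
    ContDiff ℝ ∞ fun x => app A (w x) := by
  rw [contDiff_euclidean]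
  intro j
  simp only [app_apply]
  exact ContDiff.sum fun a _ => contDiff_const.mul (contDiff_comp_apply hw a)

/-! ### Square integrable functions -/

lemma memLp_apply {ν : Measure E3} {w : E3 → E3} (hw : MemLp w 2 ν) (j : Fin 3) :
    MemLp (fun x => w x j) 2 ν := by
  have : (fun x => w x j) = fun x => ⟪ev j, w x⟫ := by
    funext x; simp [EuclideanSpace.inner_single_left]
  rw [this]; exact hw.const_inner _

lemma memLp_of_apply {ν : Measure E3} {w : E3 → E3} (hw : ∀ j, MemLp (fun x => w x j) 2 ν) :
    MemLp w 2 ν := by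
  have : w = fun x => ∑ j, w x j • ev j := by
    funext x
    ext l
    simp [Fin.sum_univ_three]
    fin_cases l <;> simp
  rw [this]
  refine memLp_finsetSum _ fun j _ => ?_
  have := (hw j)
  exact this.of_le_mul (c := 1) (this.1.smul_const _) (Eventually.of_forall fun x => by
    simp [norm_smul])

lemma integrable_mul_of_memLp {ν : Measure E3} {f g : E3 → ℝ} (hf : MemLp f 2 ν)
    (hg : MemLp g 2 ν) : Integrable (fun x => f x * g x) ν := hf.integrable_mul hg

lemma integrable_inner_of_memLp {ν : Measure E3} {f g : E3 → E3} (hf : MemLp f 2 ν)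
    (hg : MemLp g 2 ν) : Integrable (fun x => ⟪f x, g x⟫) ν := by
  simp only [inner_three]
  exact ((integrable_mul_of_memLp (memLp_apply hf 0) (memLp_apply hg 0)).add
    (integrable_mul_of_memLp (memLp_apply hf 1) (memLp_apply hg 1))).add
    (integrable_mul_of_memLp (memLp_apply hf 2) (memLp_apply hg 2))

lemma memLp_app {ν : Measure E3} {w : E3 → E3} (hw : MemLp w 2 ν)
    (A : Matrix (Fin 3) (Fin 3) ℝ) : MemLp (fun x => app A (w x)) 2 ν := by
  refine memLp_of_apply fun j => ?_
  simp only [app_apply]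
  exact memLp_finsetSum _ fun a _ => (memLp_apply hw a).const_mul _

lemma memLp_cross {ν : Measure E3} {w : E3 → E3} (hw : MemLp w 2 ν) (n : E3) :
    MemLp (fun x => cross (w x) n) 2 ν := by
  refine memLp_of_apply fun j => ?_
  have h := fun a b => (memLp_apply hw a).mul_const (n b)
  fin_cases j <;> simp
  · exact (h 1 2).sub (h 2 1)
  · exact (h 2 0).sub (h 0 2)
  · exact (h 0 1).sub (h 1 0)

/-- Square-mean convergence of one factor passes to the integral of a product. -/
lemma tendsto_integral_mul {ν : Measure E3} {φ : ℕ → E3 → ℝ} {w h : E3 → ℝ}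
    (hφ : ∀ n, MemLp (φ n) 2 ν) (hw : MemLp w 2 ν) (hh : MemLp h 2 ν)
    (hlim : Tendsto (fun n => eLpNorm (fun x => φ n x - w x) 2 ν) atTop (𝓝 0)) :
    Tendsto (fun n => ∫ x, φ n x * h x ∂ν) atTop (𝓝 (∫ x, w x * h x ∂ν)) := by
  refine tendsto_integral_of_L1' _ (integrable_mul_of_memLp hw hh).1
    (Eventually.of_forall fun n => integrable_mul_of_memLp (hφ n) hh) ?_
  have hle : ∀ n, eLpNorm ((fun x => φ n x * h x) - fun x => w x * h x) 1 ν
      ≤ eLpNorm (fun x => φ n x - w x) 2 ν * eLpNorm h 2 ν := by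
    intro n
    have : ((fun x => φ n x * h x) - fun x => w x * h x) = (fun x => φ n x - w x) • h := by
      funext x; simp [sub_mul]
    rw [this]
    exact eLpNorm_smul_le_mul_eLpNorm hh.1 ((hφ n).sub hw).1
  refine tendsto_of_tendsto_of_tendsto_of_le_of_le tendsto_const_nhds ?_ (fun _ => zero_le) hle
  have := ENNReal.Tendsto.mul_const (b := eLpNorm h 2 ν) hlim (Or.inr hh.2.ne)
  simpa using this

namespace PolyPartition

variable {Ω : Set E3} {M : PolyPartition Ω}

instance (i : Fin M.N) : IsFiniteMeasure (volume.restrict (M.elem i)) :=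
  ⟨by rw [Measure.restrict_apply_univ]; exact (M.elem_isBounded i).measure_lt_top⟩

lemma memLp_elem {φ : E3 → ℝ} (hφ : Continuous φ) (i : Fin M.N) :
    MemLp φ 2 (volume.restrict (M.elem i)) := by
  have hK := (M.elem_isBounded i).isCompact_closure
  obtain ⟨C, hC⟩ := hK.exists_bound_of_continuousOn hφ.continuousOn
  refine MemLp.of_bound hφ.aestronglyMeasurable C ?_
  filter_upwards [ae_restrict_mem (M.elem_isOpen i).measurableSet] with x hx
  exact hC x (subset_closure hx)

lemma memLp_elem_vec {φ : E3 → E3} (hφ : Continuous φ) (i : Fin M.N) :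
    MemLp φ 2 (volume.restrict (M.elem i)) :=
  memLp_of_apply fun j => memLp_elem (by fun_prop) i

lemma measure_frontier_lt_top (i : Fin M.N) : area (frontier (M.elem i)) < ⊤ := by
  rw [M.frontier_elem i]
  exact (measure_biUnion_finset_le _ _).trans_lt
    (ENNReal.sum_lt_top.2 fun f _ => M.area_face_lt_top f)

lemma memLp_frontier {φ : E3 → ℝ} (hφ : Continuous φ) (i : Fin M.N) :
    MemLp φ 2 (area.restrict (frontier (M.elem i))) := by
  have : IsFiniteMeasure (area.restrict (frontier (M.elem i))) :=
    ⟨by rw [Measure.restrict_apply_univ]; exact measure_frontier_lt_top i⟩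
  have hK : IsCompact (frontier (M.elem i)) :=
    (M.elem_isBounded i).isCompact_closure.of_isClosed_subset isClosed_frontier
      frontier_subset_closure
  obtain ⟨C, hC⟩ := hK.exists_bound_of_continuousOn hφ.continuousOn
  refine MemLp.of_bound hφ.aestronglyMeasurable C ?_
  filter_upwards [ae_restrict_mem hK.measurableSet] with x hx
  exact hC x hx

lemma restrict_face_le {i : Fin M.N} {f : Fin M.L} (hf : f ∈ M.faces i) :
    area.restrict (M.face f) ≤ area.restrict (frontier (M.elem i)) :=
  Measure.restrict_mono (M.face_subset_frontier hf) le_rfl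

lemma memLp_face {φ : E3 → ℝ} (hφ : Continuous φ) (f : Fin M.L) :
    MemLp φ 2 (area.restrict (M.face f)) := by
  obtain ⟨i, hi⟩ := M.exists_mem_faces f
  exact (memLp_frontier hφ i).mono_measure (restrict_face_le hi)

lemma memLp_face_vec {φ : E3 → E3} (hφ : Continuous φ) (f : Fin M.L) :
    MemLp φ 2 (area.restrict (M.face f)) :=
  memLp_of_apply fun j => memLp_face (by fun_prop) f

variable (M)

/-! ### Green's formulas -/

/-- `w ∈ H¹(T)` with gradient `G` and trace `γ`, expressed by Green's formula
`(w, ∂_j ψ)_T + (G_j, ψ)_T = ⟨γ, ψ n_j⟩_{∂T}` on the element `T` with index `i`. -/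
structure HasGrad (i : Fin M.N) (w : E3 → ℝ) (G : E3 → E3) (γ : E3 → ℝ) : Prop where
  memLp : MemLp w 2 (volume.restrict (M.elem i))
  memLp_grad : MemLp G 2 (volume.restrict (M.elem i))
  memLp_trace : ∀ f ∈ M.faces i, MemLp γ 2 (area.restrict (M.face f))
  green : ∀ ψ : E3 → ℝ, ContDiff ℝ ∞ ψ → ∀ j,
    (∫ x in M.elem i, w x * fderiv ℝ ψ x (ev j)) + ∫ x in M.elem i, G x j * ψ x
      = ∑ f ∈ M.faces i, ∫ x in M.face f, γ x * ψ x * M.normal i f j ∂area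

/-- `w ∈ [H¹(T)]³` with componentwise gradients `G` and trace `γ`. -/
def HasVGrad (i : Fin M.N) (w : E3 → E3) (G : Fin 3 → E3 → E3) (γ : E3 → E3) : Prop :=
  ∀ a, M.HasGrad i (fun x => w x a) (G a) fun x => γ x a

variable {M} {i : Fin M.N}

lemma hasGrad_of_contDiff {φ : E3 → ℝ} (hφ : ContDiff ℝ ∞ φ) (i : Fin M.N) :
    M.HasGrad i φ (gradient φ) φ where
  memLp := memLp_elem hφ.continuous i
  memLp_grad := memLp_elem_vec (contDiff_gradient hφ).continuous i
  memLp_trace f _ := memLp_face hφ.continuous f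
  green ψ hψ j := by
    rw [← integral_partial i j (hφ.mul hψ), ← integral_add]
    · refine setIntegral_congr_fun (M.elem_isOpen i).measurableSet fun x _ => ?_
      have h1 := (hφ.differentiable (by simp) x)
      have h2 := (hψ.differentiable (by simp) x)
      simp only [fderiv_fun_mul h1 h2, gradient_apply]
      simp [mul_comm]
    · exact integrable_mul_of_memLp (memLp_elem hφ.continuous i)
        (memLp_elem (contDiff_partial hψ _).continuous i)
    · simp only [gradient_apply]
      exact integrable_mul_of_memLp (memLp_elem (contDiff_partial hφ _).continuous i)
        (memLp_elem hψ.continuous i)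

/-- Green's formula for the trace of an `H¹` function, by density. -/
lemma hasGrad_of_memH1 {w : E3 → ℝ} (hw : MemH1 (M.elem i) w) :
    ∃ G, M.HasGrad i w G (trace (M.elem i) w) := by
  have htr : IsTrace (M.elem i) w (trace (M.elem i) w) := by
    have h : ∃ γ, IsTrace (M.elem i) w γ := hw
    rw [trace, dif_pos h]; exact h.choose_spec
  obtain ⟨h1, h2, G, hG, φ, hφ, l1, l2, l3⟩ := htr
  refine ⟨G, h1, hG, fun f hf => h2.mono_measure (restrict_face_le hf), fun ψ hψ j => ?_⟩
  have t1 := tendsto_integral_mul (fun n => memLp_elem (hφ n).continuous i) h1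
    (memLp_elem (contDiff_partial hψ (ev j)).continuous i) l1
  have l2' : Tendsto (fun n => eLpNorm (fun x => gradient (φ n) x j - G x j) 2
      (volume.restrict (M.elem i))) atTop (𝓝 0) := by
    refine tendsto_of_tendsto_of_tendsto_of_le_of_le tendsto_const_nhds l2 (fun _ => zero_le)
      fun n => eLpNorm_mono fun x => ?_
    exact PiLp.norm_apply_le (gradient (φ n) x - G x) j
  have t2 := tendsto_integral_mul
    (fun n => memLp_apply (memLp_elem_vec (contDiff_gradient (hφ n)).continuous i) j)
    (memLp_apply hG j) (memLp_elem hψ.continuous i) l2'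
  have t3 : Tendsto (fun n => ∑ f ∈ M.faces i,
      ∫ x in M.face f, φ n x * ψ x * M.normal i f j ∂area) atTop
      (𝓝 (∑ f ∈ M.faces i, ∫ x in M.face f, trace (M.elem i) w x * ψ x * M.normal i f j ∂area)) := by
    refine tendsto_finsetSum _ fun f hf => ?_
    simp only [mul_assoc]
    refine tendsto_integral_mul (fun n => memLp_face (hφ n).continuous f)
      (h2.mono_measure (restrict_face_le hf)) ((memLp_face hψ.continuous f).mul_const _) ?_
    exact tendsto_of_tendsto_of_tendsto_of_le_of_le tendsto_const_nhds l3 (fun _ => zero_le)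
      fun n => eLpNorm_mono_measure _ (restrict_face_le hf)
  refine tendsto_nhds_unique (t1.add t2) (t3.congr fun n => ?_)
  exact ((hasGrad_of_contDiff (hφ n) i).green ψ hψ j).symm

lemma hasVGrad_of_contDiff {φ : E3 → E3} (hφ : ContDiff ℝ ∞ φ) (i : Fin M.N) :
    M.HasVGrad i φ (fun a => gradient fun x => φ x a) φ :=
  fun a => hasGrad_of_contDiff (contDiff_comp_apply hφ a) i

lemma hasVGrad_of_memH1 {w : E3 → E3} (hw : ∀ j, MemH1 (M.elem i) fun x => w x j) :
    ∃ G, M.HasVGrad i w G (vtrace (M.elem i) w) := by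
  choose G hG using fun j => hasGrad_of_memH1 (hw j)
  exact ⟨G, fun a => hG a⟩

lemma HasVGrad.memLp {w γ : E3 → E3} {G : Fin 3 → E3 → E3} (h : M.HasVGrad i w G γ) :
    MemLp w 2 (volume.restrict (M.elem i)) := memLp_of_apply fun a => (h a).memLp

lemma HasVGrad.memLp_trace {w γ : E3 → E3} {G : Fin 3 → E3 → E3} (h : M.HasVGrad i w G γ)
    {f : Fin M.L} (hf : f ∈ M.faces i) : MemLp γ 2 (area.restrict (M.face f)) :=
  memLp_of_apply fun a => (h a).memLp_trace f hf

/-- A constant matrix may be applied to an `H¹` field. -/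
lemma HasVGrad.app {w γ : E3 → E3} {G : Fin 3 → E3 → E3} (h : M.HasVGrad i w G γ)
    (A : Matrix (Fin 3) (Fin 3) ℝ) :
    M.HasVGrad i (fun x => app A (w x)) (fun j x => ∑ a, A j a • G a x)
      fun x => DivCurlWG.app A (γ x) := by
  intro j
  refine ⟨memLp_apply (memLp_app h.memLp A) j, ?_, fun f hf =>
    memLp_apply (memLp_app (h.memLp_trace hf) A) j, fun ψ hψ l => ?_⟩
  · exact memLp_finsetSum _ fun a _ => (h a).memLp_grad.const_smul (A j a)
  · have e1 : ∀ x, DivCurlWG.app A (w x) j * fderiv ℝ ψ x (ev l)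
        = ∑ a, A j a * (w x a * fderiv ℝ ψ x (ev l)) := fun x => by
      rw [app_apply, Finset.sum_mul]; simp only [mul_assoc]
    have e2 : ∀ x, (∑ a, A j a • G a x) l * ψ x = ∑ a, A j a * (G a x l * ψ x) := fun x => by
      simp [Finset.sum_mul, mul_assoc]
    have e3 : ∀ f x, DivCurlWG.app A (γ x) j * ψ x * M.normal i f l
        = ∑ a, A j a * (γ x a * ψ x * M.normal i f l) := fun f x => by
      rw [app_apply, Finset.sum_mul, Finset.sum_mul]; simp only [mul_assoc]
    have i1 := fun a => integrable_mul_of_memLp (h a).memLp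
      (memLp_elem (contDiff_partial hψ (ev l)).continuous i)
    have i2 := fun a => integrable_mul_of_memLp (memLp_apply (h a).memLp_grad l)
      (memLp_elem hψ.continuous i)
    have i3 := fun a f (hf : f ∈ M.faces i) => (integrable_mul_of_memLp ((h a).memLp_trace f hf)
      (memLp_face hψ.continuous f)).mul_const (M.normal i f l)
    simp only [e1, e2, e3]
    rw [integral_finsetSum _ fun a _ => (i1 a).const_mul _,
      integral_finsetSum _ fun a _ => (i2 a).const_mul _,
      Finset.sum_congr rfl fun f hf => integral_finsetSum _ fun a _ => (i3 a f hf).const_mul _,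
      Finset.sum_comm, ← Finset.sum_add_distrib]
    refine Finset.sum_congr rfl fun a _ => ?_
    simp only [integral_const_mul, ← Finset.mul_sum, ← mul_add]
    rw [(h a).green ψ hψ l]

/-- The curl of a field with componentwise gradients `G`. -/
def curlOf (G : Fin 3 → E3 → E3) (x : E3) : E3 :=
  !₂[G 2 x 1 - G 1 x 2, G 0 x 2 - G 2 x 0, G 1 x 0 - G 0 x 1]

/-- The divergence of a field with componentwise gradients `G`. -/
def divOf (G : Fin 3 → E3 → E3) (x : E3) : ℝ := ∑ j, G j x j

/-- The Levi-Civita symbol. -/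
def eps (a j c : Fin 3) : ℝ := (((j : ℕ) : ℝ) - (a : ℕ)) * (((c : ℕ) : ℝ) - (a : ℕ)) *
  (((c : ℕ) : ℝ) - (j : ℕ)) / 2

/-- A linear combination of Green's formulas. -/
lemma HasVGrad.green_sum {w γ : E3 → E3} {G : Fin 3 → E3 → E3} (h : M.HasVGrad i w G γ)
    {ι : Type*} [Fintype ι] (C : Fin 3 → Fin 3 → ι → ℝ) {ψ : ι → E3 → ℝ}
    (hψ : ∀ c, ContDiff ℝ ∞ (ψ c)) :
    (∫ x in M.elem i, ∑ a, ∑ j, ∑ c, C a j c * (w x a * fderiv ℝ (ψ c) x (ev j)))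
      + ∫ x in M.elem i, ∑ a, ∑ j, ∑ c, C a j c * (G a x j * ψ c x)
      = ∑ f ∈ M.faces i, ∫ x in M.face f,
          ∑ a, ∑ j, ∑ c, C a j c * (γ x a * ψ c x * M.normal i f j) ∂area := by
  have i1 := fun a j c => (integrable_mul_of_memLp (h a).memLp
      (memLp_elem (contDiff_partial (hψ c) (ev j)).continuous i)).const_mul (C a j c)
  have i2 := fun a j c => (integrable_mul_of_memLp (memLp_apply (h a).memLp_grad j)
      (memLp_elem (hψ c).continuous i)).const_mul (C a j c)
  have i3 := fun a j c f (hf : f ∈ M.faces i) => ((integrable_mul_of_memLp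
      ((h a).memLp_trace f hf)
      (memLp_face (hψ c).continuous f)).mul_const (M.normal i f j)).const_mul (C a j c)
  have e1 : ∀ {ν : Measure E3} {F : Fin 3 → Fin 3 → ι → E3 → ℝ},
      (∀ a j c, Integrable (F a j c) ν) →
      ∫ x, ∑ a, ∑ j, ∑ c, F a j c x ∂ν = ∑ a, ∑ j, ∑ c, ∫ x, F a j c x ∂ν := by
    intro ν F hF
    rw [integral_finsetSum _ fun a _ => integrable_finsetSum _ fun j _ =>
      integrable_finsetSum _ fun c _ => hF a j c]
    refine Finset.sum_congr rfl fun a _ => ?_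
    rw [integral_finsetSum _ fun j _ => integrable_finsetSum _ fun c _ => hF a j c]
    refine Finset.sum_congr rfl fun j _ => ?_
    rw [integral_finsetSum _ fun c _ => hF a j c]
  have e3 : ∀ f ∈ M.faces i, (∫ x in M.face f,
      ∑ a, ∑ j, ∑ c, C a j c * (γ x a * ψ c x * M.normal i f j) ∂area) = ∑ a, ∑ j, ∑ c,
        ∫ x in M.face f, C a j c * (γ x a * ψ c x * M.normal i f j) ∂area :=
    fun f hf => e1 fun a j c => i3 a j c f hf
  rw [e1 i1, e1 i2, Finset.sum_congr rfl e3]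
  simp only [integral_const_mul, ← Finset.sum_add_distrib, ← mul_add]
  conv_rhs => rw [Finset.sum_comm]
  refine Finset.sum_congr rfl fun a _ => ?_
  conv_rhs => rw [Finset.sum_comm]
  refine Finset.sum_congr rfl fun j _ => ?_
  conv_rhs => rw [Finset.sum_comm]
  refine Finset.sum_congr rfl fun c _ => ?_
  rw [← Finset.mul_sum, (h a).green (ψ c) (hψ c) j]

/-- Green's formula for the curl. -/
lemma HasVGrad.green_curl {w γ : E3 → E3} {G : Fin 3 → E3 → E3} (h : M.HasVGrad i w G γ)
    {φ : E3 → E3} (hφ : ContDiff ℝ ∞ φ) :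
    (∫ x in M.elem i, ⟪w x, curl φ x⟫) - ∫ x in M.elem i, ⟪curlOf G x, φ x⟫
      = ∑ f ∈ M.faces i, ∫ x in M.face f, ⟪cross (γ x) (M.normal i f), φ x⟫ ∂area := by
  have key := h.green_sum eps (ψ := fun c x => φ x c) fun c => contDiff_comp_apply hφ c
  rw [sub_eq_add_neg, ← integral_neg]
  convert key using 4 with x x f hf x
  · simp only [inner_three, curl, pd_eq hφ]
    simp [eps, Fin.sum_univ_three]
    ring
  · simp only [inner_three, curlOf]
    simp [eps, Fin.sum_univ_three]
    ring
  · simp only [inner_three]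
    simp [eps, Fin.sum_univ_three]
    ring

/-- Green's formula for the divergence. -/
lemma HasVGrad.green_div {w γ : E3 → E3} {G : Fin 3 → E3 → E3} (h : M.HasVGrad i w G γ)
    {φ : E3 → ℝ} (hφ : ContDiff ℝ ∞ φ) :
    (∫ x in M.elem i, ⟪w x, gradient φ x⟫) + ∫ x in M.elem i, divOf G x * φ x
      = ∑ f ∈ M.faces i, ∫ x in M.face f, ⟪γ x, M.normal i f⟫ * φ x ∂area := by
  have key := h.green_sum (fun a j (_ : Unit) => if a = j then 1 else 0) (ψ := fun _ => φ)
    fun _ => hφ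
  convert key using 4 with x x f hf x
  · simp only [inner_three, gradient_apply]
    simp [Fin.sum_univ_three]
  · simp [divOf, Fin.sum_univ_three]
    ring
  · simp only [inner_three]
    simp [Fin.sum_univ_three]
    ring

/-- Green's formula for an `H¹` function and a smooth field. -/
lemma HasGrad.green_sdiv {w γ : E3 → ℝ} {G : E3 → E3} (h : M.HasGrad i w G γ)
    {φ : E3 → E3} (hφ : ContDiff ℝ ∞ φ) :
    (∫ x in M.elem i, w x * sdiv φ x) + ∫ x in M.elem i, ⟪G x, φ x⟫
      = ∑ f ∈ M.faces i, ∫ x in M.face f, γ x * ⟪φ x, M.normal i f⟫ ∂area := by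
  have i1 := fun j => integrable_mul_of_memLp h.memLp
      (memLp_elem (contDiff_partial (contDiff_comp_apply hφ j) (ev j)).continuous i)
  have i2 := fun j => integrable_mul_of_memLp (memLp_apply h.memLp_grad j)
      (memLp_elem (contDiff_comp_apply hφ j).continuous i)
  have i3 := fun j f (hf : f ∈ M.faces i) => (integrable_mul_of_memLp
      (h.memLp_trace f hf)
      (memLp_face (contDiff_comp_apply hφ j).continuous f)).mul_const (M.normal i f j)
  have e1 : ∀ x, w x * sdiv φ x = ∑ j, w x * fderiv ℝ (fun y => φ y j) x (ev j) := fun x => by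
    rw [sdiv, Finset.mul_sum]
  have e2 : ∀ x, ⟪G x, φ x⟫ = ∑ j, G x j * φ x j := fun x => by
    rw [inner_three, Fin.sum_univ_three]
  have e3 : ∀ f x, γ x * ⟪φ x, M.normal i f⟫ = ∑ j, γ x * φ x j * M.normal i f j := fun f x => by
    rw [inner_three, Fin.sum_univ_three]; ring
  simp only [e1, e2, e3]
  have e4 : ∀ f ∈ M.faces i, (∫ x in M.face f, ∑ j, γ x * φ x j * M.normal i f j ∂area)
      = ∑ j, ∫ x in M.face f, γ x * φ x j * M.normal i f j ∂area :=
    fun f hf => integral_finsetSum _ fun a _ => i3 a f hf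
  rw [integral_finsetSum _ fun a _ => i1 a, integral_finsetSum _ fun a _ => i2 a,
    Finset.sum_congr rfl e4, Finset.sum_comm, ← Finset.sum_add_distrib]
  refine Finset.sum_congr rfl fun j _ => ?_
  exact h.green _ (contDiff_comp_apply hφ j) j

end PolyPartition

/-! ### Weak derivatives -/

lemma gradient_eq_zero {φ : E3 → ℝ} {x : E3} (hx : x ∉ tsupport φ) : gradient φ x = 0 := by
  rw [gradient, fderiv_of_notMem_tsupport ℝ hx, map_zero]

lemma curl_eq_zero {φ : E3 → E3} {x : E3} (hx : x ∉ tsupport φ) : curl φ x = 0 := by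
  ext j
  fin_cases j <;> simp [curl, pd, fderiv_of_notMem_tsupport ℝ hx]

lemma eq_zero_of_notMem_tsupport {F : Type*} [Zero F] {φ : E3 → F} {x : E3}
    (hx : x ∉ tsupport φ) : φ x = 0 := image_eq_zero_of_notMem_tsupport hx

/-- Weak curls restrict to open subsets. -/
lemma IsWeakCurl.mono {D T : Set E3} {u c : E3 → E3} (h : IsWeakCurl D u c)
    (hD : MeasurableSet D) (hTD : T ⊆ D) : IsWeakCurl T u c := by
  intro φ hφ hc hs
  have := h φ hφ hc (hs.trans hTD)
  rwa [setIntegral_eq_of_subset_of_forall_sdiff_eq_zero hD hTD fun x hx => by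
      rw [curl_eq_zero fun h => hx.2 (hs h), inner_zero_right],
    setIntegral_eq_of_subset_of_forall_sdiff_eq_zero hD hTD fun x hx => by
      rw [eq_zero_of_notMem_tsupport fun h => hx.2 (hs h), inner_zero_right]] at this

/-- Weak divergences restrict to open subsets. -/
lemma IsWeakDiv.mono {D T : Set E3} {w : E3 → E3} {d : E3 → ℝ} (h : IsWeakDiv D w d)
    (hD : MeasurableSet D) (hTD : T ⊆ D) : IsWeakDiv T w d := by
  intro φ hφ hc hs
  have := h φ hφ hc (hs.trans hTD)
  rwa [setIntegral_eq_of_subset_of_forall_sdiff_eq_zero hD hTD fun x hx => by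
      rw [gradient_eq_zero fun h => hx.2 (hs h), inner_zero_right],
    setIntegral_eq_of_subset_of_forall_sdiff_eq_zero hD hTD fun x hx => by
      rw [eq_zero_of_notMem_tsupport fun h => hx.2 (hs h), mul_zero]] at this

/-- The fundamental lemma of the calculus of variations for a finite measure. -/
lemma ae_eq_zero_of_test {ν : Measure E3} {U : Set E3} (hU : IsOpen U) {h : E3 → ℝ}
    (hh : Integrable h ν)
    (ht : ∀ η : E3 → ℝ, ContDiff ℝ ∞ η → HasCompactSupport η → tsupport η ⊆ U →
      ∫ x, η x * h x ∂ν = 0) : ∀ᵐ x ∂ν, x ∈ U → h x = 0 :=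
  hU.ae_eq_zero_of_integral_contDiff_smul_eq_zero (hh.locallyIntegrable.locallyIntegrableOn U)
    fun η h1 h2 h3 => by simpa only [smul_eq_mul] using ht η h1 h2 h3

lemma integrable_of_memLp_two {ν : Measure E3} [IsFiniteMeasure ν] {h : E3 → ℝ}
    (hh : MemLp h 2 ν) : Integrable h ν := hh.integrable (by norm_num)

lemma tsupport_smul_const_subset {η : E3 → ℝ} (e : E3) :
    tsupport (fun x => η x • e) ⊆ tsupport η :=
  closure_mono fun x hx h => hx (by simp [h])

lemma contDiff_smul_const {η : E3 → ℝ} (hη : ContDiff ℝ ∞ η) (e : E3) :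
    ContDiff ℝ ∞ fun x => η x • e := hη.smul contDiff_const

lemma inner_smul_ev (a : E3) (t : ℝ) (k : Fin 3) : ⟪a, t • ev k⟫ = t * a k := by
  rw [inner_smul_right, EuclideanSpace.inner_single_right]; simp

lemma IsWeakCurl.ae_eq {T : Set E3} (hT : IsOpen T) [IsFiniteMeasure (volume.restrict T)]
    {u c c' : E3 → E3} (h : IsWeakCurl T u c) (h' : IsWeakCurl T u c')
    (hc : MemLp c 2 (volume.restrict T)) (hc' : MemLp c' 2 (volume.restrict T)) :
    ∀ᵐ x ∂(volume.restrict T), c x = c' x := by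
  have key : ∀ k, ∀ᵐ x ∂(volume.restrict T), c x k - c' x k = 0 := by
    intro k
    have hd := integrable_of_memLp_two ((memLp_apply hc k).sub (memLp_apply hc' k))
    have := ae_eq_zero_of_test hT hd fun η h1 h2 h3 => by
      have e1 := h _ (contDiff_smul_const h1 (ev k))
        (h2.mono' (subset_tsupport _ |>.trans (tsupport_smul_const_subset _)))
        ((tsupport_smul_const_subset _).trans h3)
      have e2 := h' _ (contDiff_smul_const h1 (ev k))
        (h2.mono' (subset_tsupport _ |>.trans (tsupport_smul_const_subset _)))
        ((tsupport_smul_const_subset _).trans h3)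
      have e3 := e1.symm.trans e2
      simp only [inner_smul_ev] at e3
      obtain ⟨C, hC⟩ := h1.continuous.bounded_above_of_compact_support h2
      have i1 := (integrable_of_memLp_two (memLp_apply hc k)).bdd_mul
        h1.continuous.aestronglyMeasurable (Eventually.of_forall hC)
      have i2 := (integrable_of_memLp_two (memLp_apply hc' k)).bdd_mul
        h1.continuous.aestronglyMeasurable (Eventually.of_forall hC)
      simp only [Pi.sub_apply, mul_sub]
      rw [integral_sub i1 i2, e3, sub_self]
    filter_upwards [this, ae_restrict_mem hT.measurableSet] with x hx hxT
    exact hx hxT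
  filter_upwards [ae_all_iff.2 key] with x hx
  ext k
  exact sub_eq_zero.1 (hx k)

lemma IsWeakDiv.ae_eq {T : Set E3} (hT : IsOpen T) [IsFiniteMeasure (volume.restrict T)]
    {w : E3 → E3} {d d' : E3 → ℝ} (h : IsWeakDiv T w d) (h' : IsWeakDiv T w d')
    (hd : MemLp d 2 (volume.restrict T)) (hd' : MemLp d' 2 (volume.restrict T)) :
    ∀ᵐ x ∂(volume.restrict T), d x = d' x := by
  have hi := integrable_of_memLp_two (hd.sub hd')
  have := ae_eq_zero_of_test hT hi fun η h1 h2 h3 => by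
    have e3 := (h _ h1 h2 h3).symm.trans (h' _ h1 h2 h3)
    obtain ⟨C, hC⟩ := h1.continuous.bounded_above_of_compact_support h2
    have i1 := (integrable_of_memLp_two hd).bdd_mul
      h1.continuous.aestronglyMeasurable (Eventually.of_forall hC)
    have i2 := (integrable_of_memLp_two hd').bdd_mul
      h1.continuous.aestronglyMeasurable (Eventually.of_forall hC)
    simp only [Pi.sub_apply, mul_sub]
    rw [integral_sub i1 i2]
    simp only [mul_comm (η _)]
    rw [e3, sub_self]
  filter_upwards [this, ae_restrict_mem hT.measurableSet] with x hx hxT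
  exact sub_eq_zero.1 (hx hxT)

lemma MemHCurl.wcurl_spec {D : Set E3} {u : E3 → E3} (h : MemHCurl D u) :
    MemLp (wcurl D u) 2 (volume.restrict D) ∧ IsWeakCurl D u (wcurl D u) := by
  rw [wcurl, dif_pos h.2]; exact h.2.choose_spec

lemma MemHDiv.wdiv_spec {D : Set E3} {w : E3 → E3} (h : MemHDiv D w) :
    MemLp (wdiv D w) 2 (volume.restrict D) ∧ IsWeakDiv D w (wdiv D w) := by
  rw [wdiv, dif_pos h.2]; exact h.2.choose_spec

lemma curlOf_gradient {w : E3 → E3} (hw : ContDiff ℝ ∞ w) :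
    PolyPartition.curlOf (fun a => gradient fun x => w x a) = curl w := by
  funext x
  ext j
  fin_cases j <;> simp only [PolyPartition.curlOf, curl, gradient_apply, pd_eq hw]

lemma divOf_gradient (w : E3 → E3) :
    PolyPartition.divOf (fun a => gradient fun x => w x a) = sdiv w := by
  funext x
  simp only [PolyPartition.divOf, sdiv, gradient_apply]

namespace PolyPartition

variable {Ω : Set E3} {M : PolyPartition Ω} {i : Fin M.N}

lemma notMem_face_of_mem_elem {f : Fin M.L} (hf : f ∈ M.faces i) {x : E3} (hx : x ∈ M.face f) :
    x ∉ M.elem i :=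
  disjoint_left.1 (disjoint_frontier_iff_isOpen.2 (M.elem_isOpen i)) (M.face_subset_frontier hf hx)

lemma memLp_curlOf {G : Fin 3 → E3 → E3} {ν : Measure E3} (hG : ∀ a, MemLp (G a) 2 ν) :
    MemLp (curlOf G) 2 ν := by
  refine memLp_of_apply fun j => ?_
  have h := fun a b => memLp_apply (hG a) b
  fin_cases j
  · exact (h 2 1).sub (h 1 2)
  · exact (h 0 2).sub (h 2 0)
  · exact (h 1 0).sub (h 0 1)

lemma memLp_divOf {G : Fin 3 → E3 → E3} {ν : Measure E3} (hG : ∀ a, MemLp (G a) 2 ν) :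
    MemLp (divOf G) 2 ν :=
  memLp_finsetSum _ fun j _ => memLp_apply (hG j) j

lemma HasVGrad.isWeakCurl {w γ : E3 → E3} {G : Fin 3 → E3 → E3} (h : M.HasVGrad i w G γ) :
    IsWeakCurl (M.elem i) w (curlOf G) := by
  intro φ hφ _ hs
  refine sub_eq_zero.1 ((h.green_curl hφ).trans (Finset.sum_eq_zero fun f hf => ?_))
  refine setIntegral_eq_zero_of_forall_eq_zero fun x hx => ?_
  simp [eq_zero_of_notMem_tsupport fun h => notMem_face_of_mem_elem hf hx (hs h)]

lemma HasVGrad.isWeakDiv {w γ : E3 → E3} {G : Fin 3 → E3 → E3} (h : M.HasVGrad i w G γ) :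
    IsWeakDiv (M.elem i) w (divOf G) := by
  intro φ hφ _ hs
  have h0 := h.green_div hφ
  rw [Finset.sum_eq_zero fun f hf => ?_] at h0
  · linarith
  · refine setIntegral_eq_zero_of_forall_eq_zero fun x hx => ?_
    simp [eq_zero_of_notMem_tsupport fun h => notMem_face_of_mem_elem hf hx (hs h)]

lemma restrict_elem_le (hΩ : IsLipschitzDomain Ω) (i : Fin M.N) :
    volume.restrict (M.elem i) ≤ volume.restrict Ω :=
  Measure.restrict_mono (elem_subset hΩ i) le_rfl

lemma HasVGrad.wcurl_ae_eq (hΩ : IsLipschitzDomain Ω) {w γ : E3 → E3} {G : Fin 3 → E3 → E3}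
    (h : M.HasVGrad i w G γ) (hw : MemHCurl Ω w) :
    ∀ᵐ x ∂(volume.restrict (M.elem i)), wcurl Ω w x = curlOf G x :=
  (hw.wcurl_spec.2.mono hΩ.isOpen.measurableSet (elem_subset hΩ i)).ae_eq (M.elem_isOpen i)
    h.isWeakCurl (hw.wcurl_spec.1.mono_measure (restrict_elem_le hΩ i))
    (memLp_curlOf fun a => (h a).memLp_grad)

lemma IsWeakDiv_congr {T : Set E3} (hT : MeasurableSet T) {w w' : E3 → E3} {d : E3 → ℝ}
    (h : IsWeakDiv T w d) (hw : ∀ x ∈ T, w x = w' x) : IsWeakDiv T w' d := by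
  intro φ h1 h2 h3
  rw [← h φ h1 h2 h3]
  congr 1
  exact setIntegral_congr_fun hT fun x hx => by simp only [hw x hx]

lemma HasVGrad.wdiv_ae_eq (hΩ : IsLipschitzDomain Ω) {w W γ : E3 → E3} {G : Fin 3 → E3 → E3}
    (h : M.HasVGrad i w G γ) (hW : MemHDiv Ω W) (hwW : ∀ x ∈ M.elem i, w x = W x) :
    ∀ᵐ x ∂(volume.restrict (M.elem i)), wdiv Ω W x = divOf G x :=
  (hW.wdiv_spec.2.mono hΩ.isOpen.measurableSet (elem_subset hΩ i)).ae_eq (M.elem_isOpen i)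
    (IsWeakDiv_congr (M.elem_isOpen i).measurableSet h.isWeakDiv hwW)
    (hW.wdiv_spec.1.mono_measure (restrict_elem_le hΩ i))
    (memLp_divOf fun a => (h a).memLp_grad)

/-- Green's formula on an element for a field of `H(curl; Ω)` that is in `H¹` on the element. -/
lemma HasVGrad.green_wcurl (hΩ : IsLipschitzDomain Ω) {w γ : E3 → E3} {G : Fin 3 → E3 → E3}
    (h : M.HasVGrad i w G γ) (hw : MemHCurl Ω w) {φ : E3 → E3} (hφ : ContDiff ℝ ∞ φ) :
    (∫ x in M.elem i, ⟪w x, curl φ x⟫) - ∫ x in M.elem i, ⟪wcurl Ω w x, φ x⟫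
      = ∑ f ∈ M.faces i, ∫ x in M.face f, ⟪cross (γ x) (M.normal i f), φ x⟫ ∂area := by
  rw [← h.green_curl hφ]
  congr 1
  refine integral_congr_ae ?_
  filter_upwards [h.wcurl_ae_eq hΩ hw] with x hx
  rw [hx]

/-- Green's formula on an element for a field of `H(div; Ω)` that is in `H¹` on the element. -/
lemma HasVGrad.green_wdiv (hΩ : IsLipschitzDomain Ω) {w W γ : E3 → E3} {G : Fin 3 → E3 → E3}
    (h : M.HasVGrad i w G γ) (hW : MemHDiv Ω W) (hwW : ∀ x ∈ M.elem i, w x = W x)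
    {φ : E3 → ℝ} (hφ : ContDiff ℝ ∞ φ) :
    (∫ x in M.elem i, ⟪W x, gradient φ x⟫) + ∫ x in M.elem i, wdiv Ω W x * φ x
      = ∑ f ∈ M.faces i, ∫ x in M.face f, ⟪γ x, M.normal i f⟫ * φ x ∂area := by
  rw [← h.green_div hφ]
  congr 1
  · refine setIntegral_congr_fun (M.elem_isOpen i).measurableSet fun x hx => ?_
    simp only [hwW x hx]
  · refine integral_congr_ae ?_
    filter_upwards [h.wdiv_ae_eq hΩ hW hwW] with x hx
    rw [hx]

lemma coeff_eq (A : Fin M.N → Matrix (Fin 3) (Fin 3) ℝ) {x : E3} (hx : x ∈ M.elem i) :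
    M.coeff A x = A i := by
  rw [coeff, Finset.sum_eq_single i, Set.indicator_of_mem hx]
  · intro j _ hji
    exact Set.indicator_of_notMem (fun h => disjoint_left.1 (M.elem_disjoint j i hji) h hx) _
  · simp

/-! ### Piecewise smooth fields -/

variable (M) in
/-- The field that equals `v i` on the element with index `i`. -/
def glue {F : Type*} [AddCommMonoid F] (v : Fin M.N → E3 → F) (x : E3) : F :=
  ∑ i, (M.elem i).indicator (v i) x

lemma glue_eq {F : Type*} [AddCommMonoid F] (v : Fin M.N → E3 → F) {x : E3}
    (hx : x ∈ M.elem i) : M.glue v x = v i x := by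
  rw [glue, Finset.sum_eq_single i, Set.indicator_of_mem hx]
  · intro j _ hji
    exact Set.indicator_of_notMem (fun h => disjoint_left.1 (M.elem_disjoint j i hji) h hx) _
  · simp

lemma memLp_glue {F : Type*} [NormedAddCommGroup F] {v : Fin M.N → E3 → F}
    (hv : ∀ i, MemLp (v i) 2 (volume.restrict (M.elem i))) :
    MemLp (M.glue v) 2 (volume.restrict Ω) := by
  have : M.glue v = fun x => ∑ i, (M.elem i).indicator (v i) x := rfl
  rw [this]
  refine memLp_finsetSum _ fun i _ => ?_
  exact (((memLp_indicator_iff_restrict (M.elem_isOpen i).measurableSet).2 (hv i))).mono_measure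
    Measure.restrict_le_self

end PolyPartition

/-! ### Boundary components and fluxes -/

section Components

variable {Ω : Set E3} {m : ℕ} {Γ : Fin (m + 1) → Set E3}

lemma isClosed_connectedComponentIn' {F : Set E3} (hF : IsClosed F) (x : E3) :
    IsClosed (connectedComponentIn F x) := by
  by_cases hx : x ∈ F
  · rw [connectedComponentIn_eq_image hx]
    exact hF.isClosedEmbedding_subtypeVal.isClosedMap _ isClosed_connectedComponent
  · rw [connectedComponentIn_eq_empty hx]; exact isClosed_empty

lemma IsBoundaryComponents.exists_eq (hΓ : IsBoundaryComponents Ω Γ) (b : Fin (m + 1)) :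
    ∃ x ∈ frontier Ω, Γ b = connectedComponentIn (frontier Ω) x := by
  have : Γ b ∈ range Γ := mem_range_self b
  rwa [hΓ.range_eq] at this

lemma IsBoundaryComponents.subset_frontier (hΓ : IsBoundaryComponents Ω Γ) (b : Fin (m + 1)) :
    Γ b ⊆ frontier Ω := by
  obtain ⟨x, -, h⟩ := hΓ.exists_eq b
  rw [h]; exact connectedComponentIn_subset _ _

lemma IsBoundaryComponents.isClosed (hΓ : IsBoundaryComponents Ω Γ) (b : Fin (m + 1)) :
    IsClosed (Γ b) := by
  obtain ⟨x, -, h⟩ := hΓ.exists_eq b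
  rw [h]; exact isClosed_connectedComponentIn' isClosed_frontier x

/-- A connected part of the boundary that meets a component is contained in it. -/
lemma IsBoundaryComponents.subset_of_mem (hΓ : IsBoundaryComponents Ω Γ) {b : Fin (m + 1)}
    {F : Set E3} (hF : IsPreconnected F) (hsub : F ⊆ frontier Ω) {x : E3} (hx : x ∈ F)
    (hxb : x ∈ Γ b) : F ⊆ Γ b := by
  obtain ⟨y, -, h⟩ := hΓ.exists_eq b
  rw [h] at hxb ⊢
  rw [connectedComponentIn_eq hxb]
  exact hF.subset_connectedComponentIn hx hsub

lemma IsBoundaryComponents.exists_mem (hΓ : IsBoundaryComponents Ω Γ) {x : E3}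
    (hx : x ∈ frontier Ω) : ∃ b, x ∈ Γ b := by
  have : connectedComponentIn (frontier Ω) x ∈ range Γ := by
    rw [hΓ.range_eq]; exact ⟨x, hx, rfl⟩
  obtain ⟨b, hb⟩ := this
  exact ⟨b, by rw [hb]; exact mem_connectedComponentIn hx⟩

lemma IsBoundaryComponents.eq_of_mem (hΓ : IsBoundaryComponents Ω Γ) {b c : Fin (m + 1)} {x : E3}
    (hb : x ∈ Γ b) (hc : x ∈ Γ c) : b = c := by
  obtain ⟨y, -, hy⟩ := hΓ.exists_eq b
  obtain ⟨z, -, hz⟩ := hΓ.exists_eq c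
  refine hΓ.injective ?_
  rw [hy] at hb
  rw [hz] at hc
  rw [hy, hz, connectedComponentIn_eq hb, connectedComponentIn_eq hc]

lemma IsBoundaryComponents.exists_isCutoff (hΓ : IsBoundaryComponents Ω Γ) (b : Fin (m + 1)) :
    ∃ χ, IsCutoff Ω (Γ b) χ := by
  have hrest : frontier Ω \ Γ b = ⋃ c ∈ ({b}ᶜ : Set (Fin (m + 1))), Γ c := by
    ext x
    simp only [mem_iUnion, exists_prop, mem_compl_iff, mem_singleton_iff]
    constructor
    · rintro ⟨hx, hxb⟩
      obtain ⟨c, hc⟩ := hΓ.exists_mem hx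
      exact ⟨c, fun h => hxb (h ▸ hc), hc⟩
    · rintro ⟨c, hcb, hc⟩
      exact ⟨hΓ.subset_frontier c hc, fun h => hcb (hΓ.eq_of_mem hc h)⟩
  have hclosed : IsClosed (frontier Ω \ Γ b) := by
    rw [hrest]
    exact (Set.toFinite _).isClosed_biUnion fun c _ => hΓ.isClosed c
  obtain ⟨χ, h0, h1, -⟩ := exists_contMDiffMap_zero_one_nhds_of_isClosed
    (modelWithCornersSelf ℝ E3) (n := ⊤) hclosed (hΓ.isClosed b) disjoint_sdiff_left
  exact ⟨χ, χ.contMDiff.contDiff, h1, h0⟩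

end Components

namespace PolyPartition

variable {Ω : Set E3} {M : PolyPartition Ω}

open Classical in
/-- If only the face `f` contributes, the sum over all faces of all elements runs over the elements
with this face. -/
lemma sum_faces_single {f : Fin M.L} {I : Fin M.N → Fin M.L → ℝ}
    (h : ∀ l f', f' ≠ f → I l f' = 0) :
    ∑ l, ∑ f' ∈ M.faces l, I l f' = ∑ l with f ∈ M.faces l, I l f := by
  rw [Finset.sum_filter]
  refine Finset.sum_congr rfl fun l _ => ?_
  split_ifs with hf
  · exact Finset.sum_eq_single_of_mem f hf fun f' _ hne => h l f' hne
  · exact Finset.sum_eq_zero fun f' hf' => h l f' fun h => hf (h ▸ hf')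

lemma sum_faces_shared {i j : Fin M.N} {f : Fin M.L} (hij : i ≠ j) (hi : f ∈ M.faces i)
    (hj : f ∈ M.faces j) {I : Fin M.N → Fin M.L → ℝ} (h : ∀ l f', f' ≠ f → I l f' = 0) :
    ∑ l, ∑ f' ∈ M.faces l, I l f' = I i f + I j f := by
  classical
  rw [sum_faces_single h]
  have : (Finset.univ.filter fun l => f ∈ M.faces l) = {i, j} := by
    ext l
    simp only [Finset.mem_filter, Finset.mem_univ, true_and, Finset.mem_insert,
      Finset.mem_singleton]
    constructor
    · exact eq_or_eq_of_mem_faces hij hi hj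
    · rintro (rfl | rfl) <;> assumption
  rw [this, Finset.sum_pair hij]

lemma sum_faces_boundary (hΩ : IsLipschitzDomain Ω) {i : Fin M.N} {f : Fin M.L}
    (hi : f ∈ M.faces i) (hsub : M.face f ⊆ frontier Ω)
    {I : Fin M.N → Fin M.L → ℝ} (h : ∀ l f', f' ≠ f → I l f' = 0) :
    ∑ l, ∑ f' ∈ M.faces l, I l f' = I i f := by
  classical
  rw [sum_faces_single h]
  have : (Finset.univ.filter fun l => f ∈ M.faces l) = {i} := by
    ext l
    simp only [Finset.mem_filter, Finset.mem_univ, true_and, Finset.mem_singleton]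
    exact ⟨fun hl => eq_of_subset_frontier hΩ hsub hl hi, fun h => h ▸ hi⟩
  rw [this, Finset.sum_singleton]

lemma face_subset_or {m : ℕ} {Γ : Fin (m + 1) → Set E3}
    (hΓ : IsBoundaryComponents Ω Γ) (b : Fin (m + 1)) {f : Fin M.L}
    (hsub : M.face f ⊆ frontier Ω) : M.face f ⊆ Γ b ∨ M.face f ⊆ frontier Ω \ Γ b := by
  by_cases h : ∃ x ∈ M.face f, x ∈ Γ b
  · obtain ⟨x, hx, hxb⟩ := h
    exact Or.inl (hΓ.subset_of_mem (M.face_isPolygon f).isConnected.isPreconnected hsub hx hxb)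
  · push Not at h
    exact Or.inr fun x hx => ⟨hsub hx, h x hx⟩

open Classical in
/-- The flux of an `H(div)` field with square integrable normal traces through a component of the
boundary is the integral of the normal trace. -/
lemma normalFlux_eq (hΩ : IsLipschitzDomain Ω) {m : ℕ} {Γ : Fin (m + 1) → Set E3}
    (hΓ : IsBoundaryComponents Ω Γ) (b : Fin (m + 1)) {W : E3 → E3} (hW : MemHDiv Ω W)
    {τ : Fin M.N → Fin M.L → E3 → ℝ}
    (hg : ∀ i (φ : E3 → ℝ), ContDiff ℝ ∞ φ →
      (∫ x in M.elem i, ⟪W x, gradient φ x⟫) + ∫ x in M.elem i, wdiv Ω W x * φ x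
        = ∑ f ∈ M.faces i, ∫ x in M.face f, τ i f x * φ x ∂area)
    (hτ : ∀ i, ∀ f ∈ M.faces i, MemLp (τ i f) 2 (area.restrict (M.face f)))
    (hcancel : ∀ i j f, i ≠ j → f ∈ M.faces i → f ∈ M.faces j →
      ∀ᵐ x ∂(area.restrict (M.face f)), τ i f x + τ j f x = 0) :
    normalFlux Ω W (Γ b)
      = ∑ i, ∑ f ∈ M.faces i with M.face f ⊆ Γ b, ∫ x in M.face f, τ i f x ∂area := by
  have hex := hΓ.exists_isCutoff b
  rw [normalFlux, dif_pos hex]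
  set χ := hex.choose
  obtain ⟨hχ, hχ1, hχ0⟩ : IsCutoff Ω (Γ b) χ := hex.choose_spec
  have i1 : ∀ i, IntegrableOn (fun x => wdiv Ω W x * χ x) (M.elem i) := fun i =>
    integrable_mul_of_memLp (hW.wdiv_spec.1.mono_measure (restrict_elem_le hΩ i))
      (memLp_elem hχ.continuous i)
  have i2 : ∀ i, IntegrableOn (fun x => ⟪W x, gradient χ x⟫) (M.elem i) := fun i =>
    integrable_inner_of_memLp (hW.1.mono_measure (restrict_elem_le hΩ i))
      (memLp_elem_vec (contDiff_gradient hχ).continuous i)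
  rw [integral_domain (M := M) hΩ i1, integral_domain (M := M) hΩ i2, ← Finset.sum_add_distrib]
  simp only [add_comm (∫ x in M.elem _, wdiv Ω W x * χ x), hg _ _ hχ]
  rw [sum_faces_eq_boundary]
  · refine Finset.sum_congr rfl fun i _ => ?_
    have hfil : (M.faces i).filter (fun f => M.face f ⊆ Γ b)
        = ((M.faces i).filter fun f => M.face f ⊆ frontier Ω).filter
          fun f => M.face f ⊆ Γ b := by
      ext f
      simp only [Finset.mem_filter]
      exact ⟨fun h => ⟨⟨h.1, h.2.trans (hΓ.subset_frontier b)⟩, h.2⟩, fun h => ⟨h.1.1, h.2⟩⟩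
    rw [hfil, Finset.sum_filter _ (s := (M.faces i).filter fun f => M.face f ⊆ frontier Ω)]
    refine Finset.sum_congr rfl fun f hf => ?_
    rw [Finset.mem_filter] at hf
    split_ifs with hfb
    · refine setIntegral_congr_fun (M.measurableSet_face f) fun x hx => ?_
      simp only [hχ1.self_of_nhdsSet x (hfb hx), mul_one]
    · refine setIntegral_eq_zero_of_forall_eq_zero fun x hx => ?_
      have := (face_subset_or hΓ b hf.2).resolve_left hfb hx
      simp only [hχ0.self_of_nhdsSet x this, mul_zero]
  · intro i j f hij hi hj
    rw [← integral_add (integrable_mul_of_memLp (hτ i f hi) (memLp_face hχ.continuous f))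
      (integrable_mul_of_memLp (hτ j f hj) (memLp_face hχ.continuous f))]
    refine integral_eq_zero_of_ae ?_
    filter_upwards [hcancel i j f hij hi hj] with x hx
    rw [← add_mul, hx, zero_mul, Pi.zero_apply]

/-! ### Matching of traces across faces -/

/-- Test functions supported off the other faces detect functions on a face. -/
lemma ae_face_eq_zero {f : Fin M.L} {h : E3 → ℝ} (hh : MemLp h 2 (area.restrict (M.face f)))
    (U : Set E3) (hU : IsOpen U) (hUf : ∀ᵐ x ∂(area.restrict (M.face f)), x ∈ U)
    (ht : ∀ η : E3 → ℝ, ContDiff ℝ ∞ η → HasCompactSupport η → tsupport η ⊆ U ∩ M.around f →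
      ∫ x in M.face f, η x * h x ∂area = 0) :
    ∀ᵐ x ∂(area.restrict (M.face f)), h x = 0 := by
  filter_upwards [ae_eq_zero_of_test (hU.inter (M.isOpen_around f)) (integrable_of_memLp_two hh) ht,
    hUf, M.ae_mem_around f] with x hx hxU hxa
  exact hx ⟨hxU, hxa⟩

lemma setIntegral_face_eq_zero {f f' : Fin M.L} (hne : f' ≠ f) {F : E3 → ℝ} {S : Set E3}
    (hS : S ⊆ M.around f) (hF : ∀ x, x ∉ S → F x = 0) :
    ∫ x in M.face f', F x ∂area = 0 :=
  setIntegral_eq_zero_of_forall_eq_zero fun x hx =>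
    hF x fun h => M.notMem_face_of_mem_around hne (hS h) hx

variable {u : E3 → E3} {γ : Fin M.N → E3 → E3} {G : Fin M.N → Fin 3 → E3 → E3}

lemma sum_green_wcurl (hΩ : IsLipschitzDomain Ω) (hu : MemHCurl Ω u)
    (h : ∀ i, M.HasVGrad i u (G i) (γ i)) {φ : E3 → E3} (hφ : ContDiff ℝ ∞ φ) :
    (∫ x in Ω, ⟪u x, curl φ x⟫) - ∫ x in Ω, ⟪wcurl Ω u x, φ x⟫
      = ∑ i, ∑ f ∈ M.faces i, ∫ x in M.face f, ⟪cross (γ i x) (M.normal i f), φ x⟫ ∂area := by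
  rw [integral_domain (M := M) hΩ fun i => integrable_inner_of_memLp (h i).memLp
      (memLp_elem_vec (contDiff_curl hφ).continuous i),
    integral_domain (M := M) hΩ fun i => integrable_inner_of_memLp
      (hu.wcurl_spec.1.mono_measure (restrict_elem_le hΩ i)) (memLp_elem_vec hφ.continuous i),
    ← Finset.sum_sub_distrib]
  exact Finset.sum_congr rfl fun i _ => (h i).green_wcurl hΩ hu hφ

/-- The tangential trace of an `H(curl)` field is continuous across faces. -/
lemma tangential_match (hΩ : IsLipschitzDomain Ω) (hu : MemHCurl Ω u)
    (h : ∀ i, M.HasVGrad i u (G i) (γ i)) {i j : Fin M.N} {f : Fin M.L} (hij : i ≠ j)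
    (hi : f ∈ M.faces i) (hj : f ∈ M.faces j) : ∀ᵐ x ∂(area.restrict (M.face f)),
      cross (γ i x) (M.normal i f) + cross (γ j x) (M.normal j f) = 0 := by
  have mi := memLp_cross ((h i).memLp_trace hi) (M.normal i f)
  have mj := memLp_cross ((h j).memLp_trace hj) (M.normal j f)
  have key : ∀ k, ∀ᵐ x ∂(area.restrict (M.face f)),
      cross (γ i x) (M.normal i f) k + cross (γ j x) (M.normal j f) k = 0 := by
    intro k
    refine ae_face_eq_zero ((memLp_apply mi k).add (memLp_apply mj k)) Ω hΩ.isOpen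
      (ae_mem_domain hΩ hij hi hj) fun η h1 h2 h3 => ?_
    have hs := (tsupport_smul_const_subset (η := η) (ev k)).trans h3
    have h0 := hu.wcurl_spec.2 _ (contDiff_smul_const h1 (ev k))
      (h2.mono' (subset_tsupport _ |>.trans (tsupport_smul_const_subset _)))
      (hs.trans inter_subset_left)
    have hsum := sum_green_wcurl hΩ hu h (contDiff_smul_const h1 (ev k))
    rw [h0, sub_self, sum_faces_shared hij hi hj fun l f' hne =>
      setIntegral_face_eq_zero hne (hs.trans inter_subset_right) fun x hx => by
        rw [eq_zero_of_notMem_tsupport hx, inner_zero_right]] at hsum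
    simp only [inner_smul_ev] at hsum
    simp only [mul_add]
    rw [integral_add (integrable_mul_of_memLp (memLp_face h1.continuous f) (memLp_apply mi k))
      (integrable_mul_of_memLp (memLp_face h1.continuous f) (memLp_apply mj k)), ← hsum]
  filter_upwards [ae_all_iff.2 key] with x hx
  ext k
  exact hx k

/-- The tangential trace in the sense of Green's formula is the trace from the element. -/
lemma tangential_boundary (hΩ : IsLipschitzDomain Ω) (hu : MemHCurl Ω u)
    (h : ∀ i, M.HasVGrad i u (G i) (γ i)) {ξ : E3 → E3} (hξ : HasTangentialTrace Ω u ξ)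
    (hξ2 : MemLp ξ 2 (area.restrict (frontier Ω)))
    {i : Fin M.N} {f : Fin M.L} (hi : f ∈ M.faces i) (hsub : M.face f ⊆ frontier Ω) :
    ∀ᵐ x ∂(area.restrict (M.face f)), cross (γ i x) (M.normal i f) = ξ x := by
  have mi := memLp_cross ((h i).memLp_trace hi) (M.normal i f)
  have mξ : MemLp ξ 2 (area.restrict (M.face f)) :=
    hξ2.mono_measure (Measure.restrict_mono hsub le_rfl)
  have key : ∀ k, ∀ᵐ x ∂(area.restrict (M.face f)),
      cross (γ i x) (M.normal i f) k - ξ x k = 0 := by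
    intro k
    refine ae_face_eq_zero ((memLp_apply mi k).sub (memLp_apply mξ k)) univ isOpen_univ
      (Eventually.of_forall fun _ => mem_univ _) fun η h1 h2 h3 => ?_
    have hs := (tsupport_smul_const_subset (η := η) (ev k)).trans h3
    have h0 := hξ _ (contDiff_smul_const h1 (ev k))
    rw [sum_green_wcurl hΩ hu h (contDiff_smul_const h1 (ev k)),
      sum_faces_boundary hΩ hi hsub fun l f' hne =>
      setIntegral_face_eq_zero hne (hs.trans inter_subset_right) fun x hx => by
        rw [eq_zero_of_notMem_tsupport hx, inner_zero_right],
      setIntegral_eq_of_subset_of_forall_sdiff_eq_zero isClosed_frontier.measurableSet hsub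
        fun x hx => by
          rw [eq_zero_of_notMem_tsupport fun h => hx.2 (mem_face_of_mem_around hΩ hx.1 (hs h).2),
            inner_zero_right]] at h0
    simp only [inner_smul_ev] at h0
    simp only [mul_sub]
    rw [integral_sub (integrable_mul_of_memLp (memLp_face h1.continuous f) (memLp_apply mi k))
      (integrable_mul_of_memLp (memLp_face h1.continuous f) (memLp_apply mξ k)), h0, sub_self]
  filter_upwards [ae_all_iff.2 key] with x hx
  ext k
  exact sub_eq_zero.1 (hx k)

/-- The normal trace of an `H(div)` field is continuous across faces. -/
lemma normal_match (hΩ : IsLipschitzDomain Ω) {W : E3 → E3} (hW : MemHDiv Ω W)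
    {w : Fin M.N → E3 → E3} (h : ∀ i, M.HasVGrad i (w i) (G i) (γ i))
    (hwW : ∀ i, ∀ x ∈ M.elem i, w i x = W x) {i j : Fin M.N} {f : Fin M.L} (hij : i ≠ j)
    (hi : f ∈ M.faces i) (hj : f ∈ M.faces j) : ∀ᵐ x ∂(area.restrict (M.face f)),
      ⟪γ i x, M.normal i f⟫ + ⟪γ j x, M.normal j f⟫ = 0 := by
  have mi := ((h i).memLp_trace hi).inner_const (𝕜 := ℝ) (M.normal i f)
  have mj := ((h j).memLp_trace hj).inner_const (𝕜 := ℝ) (M.normal j f)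
  refine ae_face_eq_zero (mi.add mj) Ω hΩ.isOpen
    (ae_mem_domain hΩ hij hi hj) fun η h1 h2 h3 => ?_
  have h0 := hW.wdiv_spec.2 _ h1 h2 (h3.trans inter_subset_left)
  have hsum : ∑ i, ∑ f ∈ M.faces i, ∫ x in M.face f, ⟪γ i x, M.normal i f⟫ * η x ∂area
      = (∫ x in Ω, ⟪W x, gradient η x⟫) + ∫ x in Ω, wdiv Ω W x * η x := by
    rw [integral_domain (M := M) hΩ fun i => integrable_inner_of_memLp
        (hW.1.mono_measure (restrict_elem_le hΩ i))
        (memLp_elem_vec (contDiff_gradient h1).continuous i),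
      integral_domain (M := M) hΩ fun i => integrable_mul_of_memLp
        (hW.wdiv_spec.1.mono_measure (restrict_elem_le hΩ i)) (memLp_elem h1.continuous i),
      ← Finset.sum_add_distrib]
    exact Finset.sum_congr rfl fun i _ => ((h i).green_wdiv hΩ hW (hwW i) h1).symm
  rw [← h0, add_neg_cancel, sum_faces_shared hij hi hj fun l f' hne =>
      setIntegral_face_eq_zero hne (h3.trans inter_subset_right) fun x hx => by
        rw [eq_zero_of_notMem_tsupport hx, mul_zero]] at hsum
  simp only [mul_add]
  rw [integral_add (integrable_mul_of_memLp (memLp_face h1.continuous f) mi)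
    (integrable_mul_of_memLp (memLp_face h1.continuous f) mj), ← hsum]
  simp only [mul_comm]

end PolyPartition

/-! ### Conforming piecewise smooth test fields -/

namespace PolyPartition

variable {Ω : Set E3} {M : PolyPartition Ω}

lemma HasGrad.congr {i : Fin M.N} {w w' γ : E3 → ℝ} {G : E3 → E3} (h : M.HasGrad i w G γ)
    (hw : ∀ x ∈ M.elem i, w x = w' x) : M.HasGrad i w' G γ where
  memLp := h.memLp.ae_eq (by
    filter_upwards [ae_restrict_mem (M.elem_isOpen i).measurableSet] with x hx using hw x hx)
  memLp_grad := h.memLp_grad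
  memLp_trace := h.memLp_trace
  green ψ hψ j := by
    rw [← h.green ψ hψ j]
    congr 1
    exact setIntegral_congr_fun (M.elem_isOpen i).measurableSet fun x hx => by simp only [hw x hx]

lemma HasVGrad.congr {i : Fin M.N} {w w' γ : E3 → E3} {G : Fin 3 → E3 → E3}
    (h : M.HasVGrad i w G γ) (hw : ∀ x ∈ M.elem i, w x = w' x) : M.HasVGrad i w' G γ :=
  fun a => (h a).congr fun x hx => by rw [hw x hx]

variable (M) in
/-- The fields `v i`, one on each element, fit together to a field in `H(curl; Ω)` with zero
tangential trace whose product with `μ` is in `H(div; Ω)`. -/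
structure IsConforming (μ : Fin M.N → Matrix (Fin 3) (Fin 3) ℝ) (v : Fin M.N → E3 → E3) : Prop where
  smooth : ∀ i, ContDiff ℝ ∞ (v i)
  tangential : ∀ i j f, i ≠ j → f ∈ M.faces i → f ∈ M.faces j → ∀ x ∈ M.face f,
    cross (v i x) (M.normal i f) + cross (v j x) (M.normal j f) = 0
  normal : ∀ i j f, i ≠ j → f ∈ M.faces i → f ∈ M.faces j → ∀ x ∈ M.face f,
    ⟪app (μ i) (v i x), M.normal i f⟫ + ⟪app (μ j) (v j x), M.normal j f⟫ = 0
  boundary : ∀ i f, f ∈ M.faces i → M.face f ⊆ frontier Ω → ∀ x ∈ M.face f,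
    cross (v i x) (M.normal i f) = 0

variable {μ : Fin M.N → Matrix (Fin 3) (Fin 3) ℝ} {v : Fin M.N → E3 → E3}

lemma IsConforming.hasVGrad (hv : M.IsConforming μ v) (i : Fin M.N) :
    M.HasVGrad i (M.glue v) (fun a => gradient fun x => v i x a) (v i) :=
  (hasVGrad_of_contDiff (hv.smooth i) i).congr fun _ hx => (glue_eq v hx).symm

lemma IsConforming.hasVGrad_app (hv : M.IsConforming μ v) (i : Fin M.N) :
    M.HasVGrad i (fun x => app (μ i) (v i x)) (fun a => gradient fun x => app (μ i) (v i x) a)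
      fun x => app (μ i) (v i x) :=
  hasVGrad_of_contDiff (contDiff_app (hv.smooth i) (μ i)) i

lemma IsConforming.sum_cross_eq_zero (hv : M.IsConforming μ v) {φ : E3 → E3}
    (hφ : Continuous φ) :
    ∑ i, ∑ f ∈ M.faces i, ∫ x in M.face f, ⟪cross (v i x) (M.normal i f), φ x⟫ ∂area = 0 := by
  classical
  rw [sum_faces_eq_boundary]
  · refine Finset.sum_eq_zero fun i _ => Finset.sum_eq_zero fun f hf => ?_
    rw [Finset.mem_filter] at hf
    refine setIntegral_eq_zero_of_forall_eq_zero fun x hx => ?_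
    rw [hv.boundary i f hf.1 hf.2 x hx, inner_zero_left]
  · intro i j f hij hi hj
    have hint : ∀ l, IntegrableOn (fun x => ⟪cross (v l x) (M.normal l f), φ x⟫) (M.face f) area :=
      fun l => integrable_inner_of_memLp
        (memLp_cross (memLp_face_vec (hv.smooth l).continuous f) _) (memLp_face_vec hφ f)
    rw [← integral_add (hint i) (hint j)]
    refine setIntegral_eq_zero_of_forall_eq_zero fun x hx => ?_
    rw [← inner_add_left, hv.tangential i j f hij hi hj x hx, inner_zero_left]

lemma IsConforming.memHCurl (hΩ : IsLipschitzDomain Ω) (hv : M.IsConforming μ v) :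
    MemHCurl Ω (M.glue v) := by
  have hc : ∀ i, MemLp (curl (v i)) 2 (volume.restrict (M.elem i)) := fun i =>
    memLp_elem_vec (contDiff_curl (hv.smooth i)).continuous i
  have hcl : MemLp (M.glue fun i => curl (v i)) 2 (volume.restrict Ω) := memLp_glue hc
  refine ⟨memLp_glue fun i => memLp_elem_vec (hv.smooth i).continuous i, _, hcl, ?_⟩
  intro φ hφ _ _
  rw [integral_domain (M := M) hΩ fun i => integrable_inner_of_memLp (hv.hasVGrad i).memLp
      (memLp_elem_vec (contDiff_curl hφ).continuous i),
    integral_domain (M := M) hΩ fun i => integrable_inner_of_memLp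
      (hcl.mono_measure (restrict_elem_le hΩ i)) (memLp_elem_vec hφ.continuous i),
    ← sub_eq_zero, ← Finset.sum_sub_distrib, ← hv.sum_cross_eq_zero hφ.continuous]
  refine Finset.sum_congr rfl fun i _ => ?_
  rw [← (hv.hasVGrad i).green_curl hφ, curlOf_gradient (hv.smooth i)]
  congr 1
  exact setIntegral_congr_fun (M.elem_isOpen i).measurableSet fun x hx => by
    simp only [glue_eq _ hx]

lemma IsConforming.wcurl_ae_eq (hΩ : IsLipschitzDomain Ω) (hv : M.IsConforming μ v)
    (i : Fin M.N) :
    ∀ᵐ x ∂(volume.restrict (M.elem i)), wcurl Ω (M.glue v) x = curl (v i) x := by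
  have := (hv.hasVGrad i).wcurl_ae_eq hΩ (hv.memHCurl hΩ)
  rwa [curlOf_gradient (hv.smooth i)] at this

lemma IsConforming.hasTangentialTrace (hΩ : IsLipschitzDomain Ω) (hv : M.IsConforming μ v) :
    HasTangentialTrace Ω (M.glue v) 0 := by
  intro φ hφ
  rw [sum_green_wcurl hΩ (hv.memHCurl hΩ) hv.hasVGrad hφ, hv.sum_cross_eq_zero hφ.continuous]
  simp

lemma coeff_glue_eq {i : Fin M.N} {x : E3} (hx : x ∈ M.elem i) :
    app (M.coeff μ x) (M.glue v x) = app (μ i) (v i x) := by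
  rw [coeff_eq μ hx, glue_eq v hx]

lemma IsConforming.memHDiv (hΩ : IsLipschitzDomain Ω) (hv : M.IsConforming μ v) :
    MemHDiv Ω fun x => app (M.coeff μ x) (M.glue v x) := by
  have hs : ∀ i, ContDiff ℝ ∞ fun x => app (μ i) (v i x) := fun i =>
    contDiff_app (hv.smooth i) (μ i)
  have hd : ∀ i, MemLp (sdiv fun x => app (μ i) (v i x)) 2 (volume.restrict (M.elem i)) := fun i =>
    memLp_elem (contDiff_sdiv (hs i)).continuous i
  have hdl : MemLp (M.glue fun i => sdiv fun x => app (μ i) (v i x)) 2 (volume.restrict Ω) :=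
    memLp_glue hd
  have hW : MemLp (fun x => app (M.coeff μ x) (M.glue v x)) 2 (volume.restrict Ω) := by
    have h1 : MemLp (M.glue fun i x => app (μ i) (v i x)) 2 (volume.restrict Ω) :=
      memLp_glue fun i => memLp_elem_vec (hs i).continuous i
    refine h1.ae_eq ?_
    rw [EventuallyEq, ae_restrict_congr_set (ae_eq_iUnion_elem (M := M) hΩ),
      ae_restrict_iff' (MeasurableSet.iUnion fun i => (M.elem_isOpen i).measurableSet)]
    refine Eventually.of_forall fun x hx => ?_
    obtain ⟨i, hi⟩ := mem_iUnion.1 hx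
    rw [coeff_glue_eq hi, glue_eq _ hi]
  refine ⟨hW, _, hdl, ?_⟩
  intro φ hφ _ hφs
  have hφ0 : ∀ x ∈ frontier Ω, φ x = 0 := fun x hx => eq_zero_of_notMem_tsupport fun h =>
    disjoint_left.1 (disjoint_frontier_iff_isOpen.2 hΩ.isOpen) hx (hφs h)
  have h0 : ∑ i, ∑ f ∈ M.faces i,
      ∫ x in M.face f, ⟪app (μ i) (v i x), M.normal i f⟫ * φ x ∂area = 0 := by
    classical
    rw [sum_faces_eq_boundary]
    · refine Finset.sum_eq_zero fun i _ => Finset.sum_eq_zero fun f hf => ?_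
      rw [Finset.mem_filter] at hf
      refine setIntegral_eq_zero_of_forall_eq_zero fun x hx => ?_
      rw [hφ0 x (hf.2 hx), mul_zero]
    · intro i j f hij hi hj
      have hint : ∀ l, IntegrableOn (fun x => ⟪app (μ l) (v l x), M.normal l f⟫ * φ x)
          (M.face f) area := fun l => integrable_mul_of_memLp
          ((memLp_face_vec (hs l).continuous f).inner_const (𝕜 := ℝ) _)
          (memLp_face hφ.continuous f)
      rw [← integral_add (hint i) (hint j)]
      refine setIntegral_eq_zero_of_forall_eq_zero fun x hx => ?_
      rw [← add_mul, hv.normal i j f hij hi hj x hx, zero_mul]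
  rw [integral_domain (M := M) hΩ fun i => integrable_inner_of_memLp
      (hW.mono_measure (restrict_elem_le hΩ i))
      (memLp_elem_vec (contDiff_gradient hφ).continuous i),
    integral_domain (M := M) hΩ fun i => integrable_mul_of_memLp
      (hdl.mono_measure (restrict_elem_le hΩ i)) (memLp_elem hφ.continuous i),
    neg_eq_iff_add_eq_zero, ← Finset.sum_add_distrib, ← h0]
  refine Finset.sum_congr rfl fun i _ => ?_
  rw [← (hv.hasVGrad_app i).green_div hφ, divOf_gradient]
  congr 1
  · exact setIntegral_congr_fun (M.elem_isOpen i).measurableSet fun x hx => by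
      simp only [coeff_glue_eq hx]
  · exact setIntegral_congr_fun (M.elem_isOpen i).measurableSet fun x hx => by
      simp only [glue_eq _ hx]

lemma IsConforming.wdiv_ae_eq (hΩ : IsLipschitzDomain Ω) (hv : M.IsConforming μ v)
    (i : Fin M.N) : ∀ᵐ x ∂(volume.restrict (M.elem i)),
      divMu Ω (M.coeff μ) (M.glue v) x = sdiv (fun x => app (μ i) (v i x)) x := by
  have := (hv.hasVGrad_app i).wdiv_ae_eq hΩ (hv.memHDiv hΩ) fun x hx => (coeff_glue_eq hx).symm
  rwa [divOf_gradient] at this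

open Classical in
variable (M μ v) in
/-- The flux of `μ v` through a part `C` of the boundary, for a piecewise smooth field `v`. -/
def muFlux (C : Set E3) : ℝ := ∑ i, ∑ f ∈ M.faces i with M.face f ⊆ C,
  ∫ x in M.face f, ⟪app (μ i) (v i x), M.normal i f⟫ ∂area

lemma IsConforming.fluxMu_eq (hΩ : IsLipschitzDomain Ω) {m : ℕ} {Γ : Fin (m + 1) → Set E3}
    (hΓ : IsBoundaryComponents Ω Γ) (hv : M.IsConforming μ v) (b : Fin (m + 1)) :
    fluxMu Ω (M.coeff μ) (M.glue v) (Γ b) = M.muFlux μ v (Γ b) := by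
  refine normalFlux_eq hΩ hΓ b (hv.memHDiv hΩ)
    (τ := fun i f x => ⟪app (μ i) (v i x), M.normal i f⟫) (fun i φ hφ => ?_)
    (fun i f _ => ?_) fun i j f hij hi hj => ?_
  · exact (hv.hasVGrad_app i).green_wdiv hΩ (hv.memHDiv hΩ)
      (fun x hx => (coeff_glue_eq hx).symm) hφ
  · exact (memLp_face_vec (contDiff_app (hv.smooth i) (μ i)).continuous f).inner_const (𝕜 := ℝ) _
  · filter_upwards [ae_restrict_mem (M.measurableSet_face f)] with x hx
      using hv.normal i j f hij hi hj x hx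

/-! ### The equations satisfied piecewise by the solution -/

section Model

variable {m : ℕ} {Γ : Fin (m + 1) → Set E3} {κ : Fin M.N → Matrix (Fin 3) (Fin 3) ℝ}
  {g ξ : E3 → E3} {f : E3 → ℝ} {β : Fin m → ℝ} {u : E3 → E3} {p : E3 → ℝ}

/-- The variational equation for conforming piecewise smooth test fields without flux through the
interior boundary components. -/
lemma weak_form (hΩ : IsLipschitzDomain Ω) (hΓ : IsBoundaryComponents Ω Γ)
    (hg : MemLp g 2 (volume.restrict Ω))
    (hsol : IsModelSolution Ω Γ (M.coeff κ) (M.coeff μ) g ξ f β u p)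
    (hv : M.IsConforming μ v)
    (hflux : ∀ l : Fin m, M.muFlux μ v (Γ l.succ) = 0) :
    ∑ i, ((∫ x in M.elem i, ⟪app (κ i) (wcurl Ω u x), curl (v i) x⟫)
      + (∫ x in M.elem i, p x * sdiv (fun y => app (μ i) (v i y)) x)
      - ∫ x in M.elem i, ⟪g x, v i x⟫) = 0 := by
  have h := hsol.curl_eq (M.glue v) ⟨hv.memHCurl hΩ, hv.memHDiv hΩ⟩ (hv.hasTangentialTrace hΩ)
    fun l => by rw [hv.fluxMu_eq hΩ hΓ]; exact hflux l
  have hcu := hsol.u_mem.1.wcurl_spec.1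
  have a1 : ∀ i, ∀ᵐ x ∂(volume.restrict (M.elem i)),
      ⟪app (κ i) (wcurl Ω u x), curl (v i) x⟫
        = ⟪app (M.coeff κ x) (wcurl Ω u x), wcurl Ω (M.glue v) x⟫ := fun i => by
    filter_upwards [hv.wcurl_ae_eq hΩ i, ae_restrict_mem (M.elem_isOpen i).measurableSet]
      with x h1 h2
    rw [h1, coeff_eq κ h2]
  have a2 : ∀ i, ∀ᵐ x ∂(volume.restrict (M.elem i)),
      p x * sdiv (fun y => app (μ i) (v i y)) x
        = divMu Ω (M.coeff μ) (M.glue v) x * p x := fun i => by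
    filter_upwards [hv.wdiv_ae_eq hΩ i] with x h1
    rw [h1, mul_comm]
  have a3 : ∀ i, ∀ᵐ x ∂(volume.restrict (M.elem i)), ⟪g x, v i x⟫ = ⟪g x, M.glue v x⟫ := fun i => by
    filter_upwards [ae_restrict_mem (M.elem_isOpen i).measurableSet] with x h1
    rw [glue_eq v h1]
  have i1 : ∀ i, Integrable (fun x => ⟪app (κ i) (wcurl Ω u x), curl (v i) x⟫)
      (volume.restrict (M.elem i)) := fun i => integrable_inner_of_memLp
    (memLp_app (hcu.mono_measure (restrict_elem_le hΩ i)) _)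
    (memLp_elem_vec (contDiff_curl (hv.smooth i)).continuous i)
  have i2 : ∀ i, Integrable (fun x => p x * sdiv (fun y => app (μ i) (v i y)) x)
      (volume.restrict (M.elem i)) := fun i => integrable_mul_of_memLp
    (hsol.p_mem.mono_measure (restrict_elem_le hΩ i))
    (memLp_elem (contDiff_sdiv (contDiff_app (hv.smooth i) _)).continuous i)
  have i3 : ∀ i, Integrable (fun x => ⟪g x, v i x⟫) (volume.restrict (M.elem i)) := fun i =>
    integrable_inner_of_memLp (hg.mono_measure (restrict_elem_le hΩ i))
      (memLp_elem_vec (hv.smooth i).continuous i)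
  rw [integral_domain (M := M) hΩ fun i => (i1 i).congr (a1 i),
    integral_domain (M := M) hΩ fun i => (i2 i).congr (a2 i),
    integral_domain (M := M) hΩ fun i => (i3 i).congr (a3 i), ← sub_eq_zero,
    ← Finset.sum_add_distrib, ← Finset.sum_sub_distrib] at h
  rw [← h]
  refine Finset.sum_congr rfl fun i _ => ?_
  rw [integral_congr_ae (a1 i), integral_congr_ae (a2 i), integral_congr_ae (a3 i)]

lemma inner_app_comm {A : Matrix (Fin 3) (Fin 3) ℝ} (hA : A.PosDef) (a b : E3) :
    ⟪app A a, b⟫ = ⟪a, app A b⟫ := by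
  have h := hA.isHermitian
  have h' : ∀ i j, A i j = A j i := fun i j => by
    have := h.apply i j; simpa using this.symm
  simp only [inner_three, app_apply, Fin.sum_univ_three]
  rw [h' 1 0, h' 2 0, h' 2 1]
  ring

variable {GK : Fin M.N → Fin 3 → E3 → E3} {γK : Fin M.N → E3 → E3} {P : Fin M.N → E3 → E3}
  {π : Fin M.N → E3 → ℝ}

/-- Green's formulas in the variational equation. -/
lemma weak_form_green (hΩ : IsLipschitzDomain Ω) (hΓ : IsBoundaryComponents Ω Γ)
    (hμ : ∀ i, (μ i).PosDef) (hg : MemLp g 2 (volume.restrict Ω))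
    (hsol : IsModelSolution Ω Γ (M.coeff κ) (M.coeff μ) g ξ f β u p)
    (hK : ∀ i, M.HasVGrad i (fun x => app (κ i) (wcurl Ω u x)) (GK i) (γK i))
    (hP : ∀ i, M.HasGrad i p (P i) (π i)) (hv : M.IsConforming μ v)
    (hflux : ∀ l : Fin m, M.muFlux μ v (Γ l.succ) = 0) :
    ∑ i, (∫ x in M.elem i, ⟪curlOf (GK i) x - app (μ i) (P i x) - g x, v i x⟫)
      + ∑ i, ∑ e ∈ M.faces i, ∫ x in M.face e, (⟪cross (γK i x) (M.normal i e), v i x⟫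
          + π i x * ⟪app (μ i) (v i x), M.normal i e⟫) ∂area = 0 := by
  rw [← weak_form hΩ hΓ hg hsol hv hflux, ← Finset.sum_add_distrib]
  refine Finset.sum_congr rfl fun i _ => ?_
  have hvs := memLp_elem_vec (hv.smooth i).continuous i
  have j1 := integrable_inner_of_memLp (memLp_curlOf fun a => (hK i a).memLp_grad) hvs
  have j2 := integrable_inner_of_memLp (memLp_app (hP i).memLp_grad (μ i)) hvs
  have j3 := integrable_inner_of_memLp (hg.mono_measure (restrict_elem_le hΩ i)) hvs
  have e1 := (hK i).green_curl (hv.smooth i)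
  have e2 := (hP i).green_sdiv (contDiff_app (hv.smooth i) (μ i))
  have hb : ∑ e ∈ M.faces i, ∫ x in M.face e, (⟪cross (γK i x) (M.normal i e), v i x⟫
          + π i x * ⟪app (μ i) (v i x), M.normal i e⟫) ∂area
      = (∑ e ∈ M.faces i, ∫ x in M.face e, ⟪cross (γK i x) (M.normal i e), v i x⟫ ∂area)
        + ∑ e ∈ M.faces i, ∫ x in M.face e, π i x * ⟪app (μ i) (v i x), M.normal i e⟫ ∂area := by
    rw [← Finset.sum_add_distrib]
    refine Finset.sum_congr rfl fun e he => integral_add ?_ ?_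
    · exact integrable_inner_of_memLp (memLp_cross ((hK i).memLp_trace he) _)
        (memLp_face_vec (hv.smooth i).continuous e)
    · exact integrable_mul_of_memLp ((hP i).memLp_trace e he)
        ((memLp_face_vec (contDiff_app (hv.smooth i) (μ i)).continuous e).inner_const (𝕜 := ℝ) _)
  rw [hb, ← e1, ← e2]
  have j12 : Integrable (fun x => ⟪curlOf (GK i) x, v i x⟫ - ⟪app (μ i) (P i x), v i x⟫)
      (volume.restrict (M.elem i)) := j1.sub j2
  simp only [inner_sub_left]
  rw [integral_sub j12 j3, integral_sub j1 j2]
  simp only [inner_app_comm (hμ i)]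
  ring

/-- The differential equation `∇ × (κ ∇ × u) - μ ∇p = g` on each element. -/
lemma strong_form (hΩ : IsLipschitzDomain Ω) (hΓ : IsBoundaryComponents Ω Γ)
    (hμ : ∀ i, (μ i).PosDef) (hg : MemLp g 2 (volume.restrict Ω))
    (hsol : IsModelSolution Ω Γ (M.coeff κ) (M.coeff μ) g ξ f β u p)
    (hK : ∀ i, M.HasVGrad i (fun x => app (κ i) (wcurl Ω u x)) (GK i) (γK i))
    (hP : ∀ i, M.HasGrad i p (P i) (π i)) (i : Fin M.N) :
    ∀ᵐ x ∂(volume.restrict (M.elem i)), curlOf (GK i) x - app (μ i) (P i x) = g x := by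
  have hL : MemLp (fun x => curlOf (GK i) x - app (μ i) (P i x) - g x) 2
      (volume.restrict (M.elem i)) :=
    ((memLp_curlOf fun a => (hK i a).memLp_grad).sub (memLp_app (hP i).memLp_grad (μ i))).sub
      (hg.mono_measure (restrict_elem_le hΩ i))
  have key : ∀ k, ∀ᵐ x ∂(volume.restrict (M.elem i)),
      (curlOf (GK i) x - app (μ i) (P i x) - g x) k = 0 := by
    intro k
    have := ae_eq_zero_of_test (M.elem_isOpen i) (integrable_of_memLp_two (memLp_apply hL k))
      fun η h1 h2 h3 => by
        have hη : ∀ e ∈ M.faces i, ∀ x ∈ M.face e, η x = 0 := fun e he x hx =>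
          eq_zero_of_notMem_tsupport fun h => notMem_face_of_mem_elem he hx (h3 h)
        -- the test field is supported in the element
        set v : Fin M.N → E3 → E3 := fun l x => (if l = i then η x else 0) • ev k with hvdef
        have hv0 : ∀ l e, e ∈ M.faces l → ∀ x ∈ M.face e, v l x = 0 := by
          intro l e he x hx
          by_cases hl : l = i
          · subst hl; simp [hvdef, hη e he x hx]
          · simp [hvdef, hl]
        have hcr : ∀ n, cross (0 : E3) n = 0 := fun n => by ext j; fin_cases j <;> simp
        have hap : ∀ A, app A (0 : E3) = 0 := fun A => by ext j; simp
        have hv : M.IsConforming μ v :=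
          { smooth := fun l => by
              by_cases hl : l = i
              · simpa [hvdef, hl] using contDiff_smul_const h1 (ev k)
              · simpa [hvdef, hl] using contDiff_const
            tangential := fun l l' e _ he he' x hx => by
              rw [hv0 l e he x hx, hv0 l' e he' x hx, hcr, hcr, add_zero]
            normal := fun l l' e _ he he' x hx => by
              rw [hv0 l e he x hx, hv0 l' e he' x hx, hap, hap, inner_zero_left, inner_zero_left,
                add_zero]
            boundary := fun l e he _ x hx => by rw [hv0 l e he x hx, hcr] }
        have h := weak_form_green hΩ hΓ hμ hg hsol hK hP hv fun l => by
          classical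
          refine Finset.sum_eq_zero fun l _ => Finset.sum_eq_zero fun e he => ?_
          refine setIntegral_eq_zero_of_forall_eq_zero fun x hx => ?_
          rw [hv0 l e (Finset.mem_filter.1 he).1 x hx, hap, inner_zero_left]
        rw [Finset.sum_eq_zero (s := Finset.univ) (f := fun l => ∑ e ∈ M.faces l, _) fun l _ =>
          Finset.sum_eq_zero fun e he => setIntegral_eq_zero_of_forall_eq_zero fun x hx => by
            rw [hv0 l e he x hx, hap, inner_zero_left, inner_zero_right, mul_zero, add_zero],
          add_zero, Finset.sum_eq_single i] at h
        · simpa only [hvdef, if_true, inner_smul_ev] using h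
        · intro l _ hl
          simp [hvdef, hl]
        · simp
    filter_upwards [this, ae_restrict_mem (M.elem_isOpen i).measurableSet] with x hx hxT
    exact hx hxT
  filter_upwards [ae_all_iff.2 key] with x hx
  refine sub_eq_zero.1 ?_
  ext k
  exact hx k

/-- What remains of the variational equation after the differential equation is used. -/
lemma boundary_form (hΩ : IsLipschitzDomain Ω) (hΓ : IsBoundaryComponents Ω Γ)
    (hμ : ∀ i, (μ i).PosDef) (hg : MemLp g 2 (volume.restrict Ω))
    (hsol : IsModelSolution Ω Γ (M.coeff κ) (M.coeff μ) g ξ f β u p)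
    (hK : ∀ i, M.HasVGrad i (fun x => app (κ i) (wcurl Ω u x)) (GK i) (γK i))
    (hP : ∀ i, M.HasGrad i p (P i) (π i)) (hv : M.IsConforming μ v)
    (hflux : ∀ l : Fin m, M.muFlux μ v (Γ l.succ) = 0) :
    ∑ i, ∑ e ∈ M.faces i, ∫ x in M.face e, (⟪cross (γK i x) (M.normal i e), v i x⟫
          + π i x * ⟪app (μ i) (v i x), M.normal i e⟫) ∂area = 0 := by
  have h := weak_form_green hΩ hΓ hμ hg hsol hK hP hv hflux
  rwa [Finset.sum_eq_zero fun i _ => ?_, zero_add] at h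
  refine integral_eq_zero_of_ae ?_
  filter_upwards [strong_form hΩ hΓ hμ hg hsol hK hP i] with x hx
  rw [hx, sub_self, inner_zero_left, Pi.zero_apply]

end Model

end PolyPartition

/-! ### Transmission conditions and boundary values of the solution -/

lemma cross_zero_left (n : E3) : cross 0 n = 0 := by ext j; fin_cases j <;> simp

lemma app_zero_right (A : Matrix (Fin 3) (Fin 3) ℝ) : app A 0 = 0 := by ext j; simp

lemma cross_self (a : E3) : cross a a = 0 := by
  ext j; fin_cases j <;> simp [mul_comm]

lemma cross_smul_left (t : ℝ) (a n : E3) : cross (t • a) n = t • cross a n := by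
  ext j; fin_cases j <;> simp <;> ring

lemma cross_add_left (a b n : E3) : cross (a + b) n = cross a n + cross b n := by
  ext j; fin_cases j <;> simp <;> ring

lemma cross_neg_right (a n : E3) : cross a (-n) = -cross a n := by
  ext j; fin_cases j <;> simp <;> ring

lemma app_smul (A : Matrix (Fin 3) (Fin 3) ℝ) (t : ℝ) (a : E3) : app A (t • a) = t • app A a := by
  ext j; simp [Fin.sum_univ_three]; ring

lemma app_add (A : Matrix (Fin 3) (Fin 3) ℝ) (a b : E3) : app A (a + b) = app A a + app A b := by
  ext j; simp [Fin.sum_univ_three]; ring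

lemma inner_cross_left (a n v : E3) : ⟪cross a n, v⟫ = -⟪a, cross v n⟫ := by
  simp only [inner_three, cross_zero', cross_one', cross_two']; ring

lemma inner_cross_self (a n : E3) : ⟪cross a n, n⟫ = 0 := by
  rw [inner_cross_left, cross_self, inner_zero_right, neg_zero]

lemma inner_app_self_pos {A : Matrix (Fin 3) (Fin 3) ℝ} (hA : A.PosDef) {n : E3} (hn : n ≠ 0) :
    0 < ⟪app A n, n⟫ := by
  have h := hA.dotProduct_mulVec_pos (x := n.ofLp) (fun h => hn (by ext j; simp [h]))
  rw [inner_three]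
  simpa [dotProduct, Fin.sum_univ_three, app, mul_comm] using h

namespace PolyPartition

variable {Ω : Set E3} {M : PolyPartition Ω}

lemma normal_ne_zero {i : Fin M.N} {f : Fin M.L} (hi : f ∈ M.faces i) : M.normal i f ≠ 0 := by
  intro h
  have := M.normal_unit i f hi
  rw [h, norm_zero] at this
  exact zero_ne_one this

section Model

variable {m : ℕ} {Γ : Fin (m + 1) → Set E3} {κ μ : Fin M.N → Matrix (Fin 3) (Fin 3) ℝ}
  {g ξ : E3 → E3} {f : E3 → ℝ} {β : Fin m → ℝ} {u : E3 → E3} {p : E3 → ℝ}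
  {GK : Fin M.N → Fin 3 → E3 → E3} {γK : Fin M.N → E3 → E3} {P : Fin M.N → E3 → E3}
  {π : Fin M.N → E3 → ℝ}

open Classical in
/-- The boundary form for test fields that equal `η e • a i e` on each face `e` of the
element `i`. -/
lemma face_form (hΩ : IsLipschitzDomain Ω) (hΓ : IsBoundaryComponents Ω Γ)
    (hμ : ∀ i, (μ i).PosDef) (hg : MemLp g 2 (volume.restrict Ω))
    (hsol : IsModelSolution Ω Γ (M.coeff κ) (M.coeff μ) g ξ f β u p)
    (hK : ∀ i, M.HasVGrad i (fun x => app (κ i) (wcurl Ω u x)) (GK i) (γK i))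
    (hP : ∀ i, M.HasGrad i p (P i) (π i)) {η : Fin M.L → E3 → ℝ}
    (hη : ∀ e, ContDiff ℝ ∞ (η e)) (hη0 : ∀ e x, x ∉ M.around e → η e x = 0)
    {a : Fin M.N → Fin M.L → E3}
    (hat : ∀ i j e, i ≠ j → e ∈ M.faces i → e ∈ M.faces j →
      cross (a i e) (M.normal i e) + cross (a j e) (M.normal j e) = 0)
    (han : ∀ i j e, i ≠ j → e ∈ M.faces i → e ∈ M.faces j →
      ⟪app (μ i) (a i e), M.normal i e⟫ + ⟪app (μ j) (a j e), M.normal j e⟫ = 0)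
    (hab : ∀ i e, e ∈ M.faces i → M.face e ⊆ frontier Ω → cross (a i e) (M.normal i e) = 0)
    (hflux : ∀ l : Fin m, ∑ i, ∑ e ∈ M.faces i with M.face e ⊆ Γ l.succ,
      ∫ x in M.face e, η e x * ⟪app (μ i) (a i e), M.normal i e⟫ ∂area = 0) :
    ∑ i, ∑ e ∈ M.faces i, ∫ x in M.face e, η e x * (⟪cross (γK i x) (M.normal i e), a i e⟫
      + π i x * ⟪app (μ i) (a i e), M.normal i e⟫) ∂area = 0 := by
  set v : Fin M.N → E3 → E3 := fun i x => ∑ e, η e x • a i e with hvdef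
  have hve : ∀ i e x, x ∈ M.face e → v i x = η e x • a i e := fun i e x hx =>
    Finset.sum_eq_single e (fun e' _ hne => by
      rw [hη0 e' x fun h => M.notMem_face_of_mem_around (Ne.symm hne) h hx, zero_smul])
      fun h => absurd (Finset.mem_univ e) h
  have hv : M.IsConforming μ v :=
    { smooth := fun i => ContDiff.sum fun e _ => contDiff_smul_const (hη e) _
      tangential := fun i j e hij hi hj x hx => by
        rw [hve i e x hx, hve j e x hx, cross_smul_left, cross_smul_left, ← smul_add,
          hat i j e hij hi hj, smul_zero]
      normal := fun i j e hij hi hj x hx => by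
        rw [hve i e x hx, hve j e x hx, app_smul, app_smul, real_inner_smul_left,
          real_inner_smul_left, ← mul_add, han i j e hij hi hj, mul_zero]
      boundary := fun i e hi hsub x hx => by
        rw [hve i e x hx, cross_smul_left, hab i e hi hsub, smul_zero] }
  rw [← boundary_form hΩ hΓ hμ hg hsol hK hP hv fun l => ?_]
  · refine Finset.sum_congr rfl fun i _ => Finset.sum_congr rfl fun e _ =>
      setIntegral_congr_fun (M.measurableSet_face e) fun x hx => ?_
    simp only [hve i e x hx, app_smul, real_inner_smul_left, real_inner_smul_right]
    ring
  · rw [← hflux l, muFlux]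
    refine Finset.sum_congr rfl fun i _ => Finset.sum_congr rfl fun e _ =>
      setIntegral_congr_fun (M.measurableSet_face e) fun x hx => ?_
    simp only [hve i e x hx, app_smul, real_inner_smul_left]

lemma trace_memLp_combination
    (hK : ∀ i, M.HasVGrad i (fun x => app (κ i) (wcurl Ω u x)) (GK i) (γK i))
    (hP : ∀ i, M.HasGrad i p (P i) (π i)) {i : Fin M.N} {e : Fin M.L} (hi : e ∈ M.faces i)
    (a : E3) (c : ℝ) :
    MemLp (fun x => ⟪cross (γK i x) (M.normal i e), a⟫ + π i x * c) 2
      (area.restrict (M.face e)) :=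
  ((memLp_cross ((hK i).memLp_trace hi) _).inner_const (𝕜 := ℝ) a).add
    (((hP i).memLp_trace e hi).mul_const c)

/-- The face terms of the two elements sharing a face cancel for compatible test vectors. -/
lemma interior_form (hΩ : IsLipschitzDomain Ω) (hΓ : IsBoundaryComponents Ω Γ)
    (hμ : ∀ i, (μ i).PosDef) (hg : MemLp g 2 (volume.restrict Ω))
    (hsol : IsModelSolution Ω Γ (M.coeff κ) (M.coeff μ) g ξ f β u p)
    (hK : ∀ i, M.HasVGrad i (fun x => app (κ i) (wcurl Ω u x)) (GK i) (γK i))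
    (hP : ∀ i, M.HasGrad i p (P i) (π i)) {i j : Fin M.N} {e : Fin M.L} (hij : i ≠ j)
    (hi : e ∈ M.faces i) (hj : e ∈ M.faces j) {a b : E3}
    (hat : cross a (M.normal i e) + cross b (M.normal j e) = 0)
    (han : ⟪app (μ i) a, M.normal i e⟫ + ⟪app (μ j) b, M.normal j e⟫ = 0) :
    ∀ᵐ x ∂(area.restrict (M.face e)),
      (⟪cross (γK i x) (M.normal i e), a⟫ + π i x * ⟪app (μ i) a, M.normal i e⟫)
      + (⟪cross (γK j x) (M.normal j e), b⟫ + π j x * ⟪app (μ j) b, M.normal j e⟫) = 0 := by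
  classical
  have mi := trace_memLp_combination hK hP hi a ⟪app (μ i) a, M.normal i e⟫
  have mj := trace_memLp_combination hK hP hj b ⟪app (μ j) b, M.normal j e⟫
  refine ae_face_eq_zero (mi.add mj) univ isOpen_univ (Eventually.of_forall fun _ => mem_univ _)
    fun ζ h1 h2 h3 => ?_
  rw [univ_inter] at h3
  have hζ0 : ∀ x, x ∉ M.around e → ζ x = 0 := fun x hx =>
    eq_zero_of_notMem_tsupport fun h => hx (h3 h)
  set η : Fin M.L → E3 → ℝ := fun e' x => if e' = e then ζ x else 0 with hηdef
  set A : Fin M.N → Fin M.L → E3 := fun l e' =>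
    if e' = e then (if l = i then a else if l = j then b else 0) else 0 with hA
  have hAi : A i e = a := by simp [hA]
  have hAj : A j e = b := by simp [hA, hij.symm]
  have hA0 : ∀ l e', e' ≠ e → A l e' = 0 := fun l e' h => by simp [hA, h]
  have hpair : ∀ {l l'}, l ≠ l' → e ∈ M.faces l → e ∈ M.faces l' →
      l = i ∧ l' = j ∨ l = j ∧ l' = i := by
    intro l l' hne hl hl'
    rcases eq_or_eq_of_mem_faces hij hi hj hl with rfl | rfl <;>
      rcases eq_or_eq_of_mem_faces hij hi hj hl' with rfl | rfl <;> simp_all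
  have h := face_form hΩ hΓ hμ hg hsol hK hP (η := η) (a := A)
    (fun e' => by by_cases he : e' = e <;> simp [hηdef, he, h1, contDiff_const])
    (fun e' x hx => by
      by_cases he : e' = e
      · subst he; simp [hηdef, hζ0 x hx]
      · simp [hηdef, he])
    (fun l l' e' hne hl hl' => by
      by_cases he : e' = e
      · subst he
        rcases hpair hne hl hl' with ⟨rfl, rfl⟩ | ⟨rfl, rfl⟩
        · rw [hAi, hAj, hat]
        · rw [hAi, hAj, add_comm, hat]
      · rw [hA0 l e' he, hA0 l' e' he, cross_zero_left, cross_zero_left, add_zero])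
    (fun l l' e' hne hl hl' => by
      by_cases he : e' = e
      · subst he
        rcases hpair hne hl hl' with ⟨rfl, rfl⟩ | ⟨rfl, rfl⟩
        · rw [hAi, hAj, han]
        · rw [hAi, hAj, add_comm, han]
      · rw [hA0 l e' he, hA0 l' e' he, app_zero_right, app_zero_right, inner_zero_left,
          inner_zero_left, add_zero])
    (fun l e' _ hsub => by
      by_cases he : e' = e
      · subst he; exact absurd hsub (not_subset_frontier hΩ hij hi hj)
      · rw [hA0 l e' he, cross_zero_left])
    (fun b => Finset.sum_eq_zero fun l _ => Finset.sum_eq_zero fun e' he' => by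
      have he : e' ≠ e := fun h => by
        subst h
        exact not_subset_frontier hΩ hij hi hj
          ((Finset.mem_filter.1 he').2.trans (hΓ.subset_frontier _))
      simp [hA0 l e' he, app_zero_right])
  rw [sum_faces_shared hij hi hj fun l e' he => by simp [hηdef, he], hAi, hAj] at h
  have hc : MemLp ζ 2 (area.restrict (M.face e)) := memLp_face h1.continuous e
  have ii := integrable_mul_of_memLp hc mi
  have ij := integrable_mul_of_memLp hc mj
  simp only [hηdef, if_true] at h
  rw [← integral_add ii ij] at h
  rw [← h]
  refine integral_congr_ae (Eventually.of_forall fun x => ?_)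
  ring

/-- The traces of `p` from both sides of an interior face agree. -/
lemma trace_p_match (hΩ : IsLipschitzDomain Ω) (hΓ : IsBoundaryComponents Ω Γ)
    (hμ : ∀ i, (μ i).PosDef) (hg : MemLp g 2 (volume.restrict Ω))
    (hsol : IsModelSolution Ω Γ (M.coeff κ) (M.coeff μ) g ξ f β u p)
    (hK : ∀ i, M.HasVGrad i (fun x => app (κ i) (wcurl Ω u x)) (GK i) (γK i))
    (hP : ∀ i, M.HasGrad i p (P i) (π i)) {i j : Fin M.N} {e : Fin M.L} (hij : i ≠ j)
    (hi : e ∈ M.faces i) (hj : e ∈ M.faces j) :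
    ∀ᵐ x ∂(area.restrict (M.face e)), π i x = π j x := by
  set n := M.normal i e with hn
  have hnj : M.normal j e = -n := normal_eq_neg hij hi hj
  have qi := inner_app_self_pos (hμ i) (normal_ne_zero hi)
  have qj := inner_app_self_pos (hμ j) (normal_ne_zero hi)
  rw [← hn] at qi qj
  have ei : ⟪app (μ i) (⟪app (μ i) n, n⟫⁻¹ • n), n⟫ = 1 := by
    rw [app_smul, real_inner_smul_left, inv_mul_cancel₀ qi.ne']
  have ej : ⟪app (μ j) (⟪app (μ j) n, n⟫⁻¹ • n), n⟫ = 1 := by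
    rw [app_smul, real_inner_smul_left, inv_mul_cancel₀ qj.ne']
  have h := interior_form hΩ hΓ hμ hg hsol hK hP hij hi hj (a := ⟪app (μ i) n, n⟫⁻¹ • n)
    (b := ⟪app (μ j) n, n⟫⁻¹ • n)
    (by rw [hnj, ← hn, cross_neg_right, cross_smul_left, cross_smul_left, cross_self]; simp)
    (by rw [hnj, ← hn, inner_neg_right, ei, ej]; norm_num)
  filter_upwards [h] with x hx
  rw [hnj, ← hn, inner_neg_right, ei, ej, cross_neg_right, inner_neg_left, real_inner_smul_right,
    real_inner_smul_right, inner_cross_self, inner_cross_self] at hx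
  linarith

/-- The tangential trace of `κ ∇ × u` does not jump across an interior face. -/
lemma trace_curl_match (hΩ : IsLipschitzDomain Ω) (hΓ : IsBoundaryComponents Ω Γ)
    (hμ : ∀ i, (μ i).PosDef) (hg : MemLp g 2 (volume.restrict Ω))
    (hsol : IsModelSolution Ω Γ (M.coeff κ) (M.coeff μ) g ξ f β u p)
    (hK : ∀ i, M.HasVGrad i (fun x => app (κ i) (wcurl Ω u x)) (GK i) (γK i))
    (hP : ∀ i, M.HasGrad i p (P i) (π i)) {i j : Fin M.N} {e : Fin M.L} (hij : i ≠ j)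
    (hi : e ∈ M.faces i) (hj : e ∈ M.faces j) :
    ∀ᵐ x ∂(area.restrict (M.face e)),
      cross (γK i x) (M.normal i e) + cross (γK j x) (M.normal j e) = 0 := by
  set n := M.normal i e with hn
  have hnj : M.normal j e = -n := normal_eq_neg hij hi hj
  have qj := inner_app_self_pos (hμ j) (normal_ne_zero hi)
  rw [← hn] at qj
  have key : ∀ k, ∀ᵐ x ∂(area.restrict (M.face e)),
      (cross (γK i x) n + cross (γK j x) (M.normal j e)) k = 0 := by
    intro k
    -- the normal component of the second test vector is fixed by the continuity of the flux
    set c := (⟪app (μ i) (ev k), n⟫ - ⟪app (μ j) (ev k), n⟫) / ⟪app (μ j) n, n⟫ with hc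
    have hcq : c * ⟪app (μ j) n, n⟫ = ⟪app (μ i) (ev k), n⟫ - ⟪app (μ j) (ev k), n⟫ :=
      div_mul_cancel₀ _ qj.ne'
    have ej : ⟪app (μ j) (ev k + c • n), n⟫ = ⟪app (μ i) (ev k), n⟫ := by
      rw [app_add, app_smul, inner_add_left, real_inner_smul_left, hcq]; ring
    have h := interior_form hΩ hΓ hμ hg hsol hK hP hij hi hj (a := ev k) (b := ev k + c • n)
      (by rw [hnj, ← hn, cross_neg_right, cross_add_left, cross_smul_left, cross_self]; simp)
      (by rw [hnj, ← hn, inner_neg_right, ej]; ring)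
    filter_upwards [h, trace_p_match hΩ hΓ hμ hg hsol hK hP hij hi hj] with x hx hπ
    rw [hnj, ← hn, inner_neg_right, ej, hπ, inner_add_right, real_inner_smul_right,
      cross_neg_right, inner_neg_left, inner_neg_left, inner_cross_self] at hx
    have e1 : ∀ w : E3, ⟪w, ev k⟫ = w k := fun w => by simpa using inner_smul_ev w 1 k
    rw [hnj, cross_neg_right, PiLp.add_apply, PiLp.neg_apply]
    rw [e1, e1] at hx
    linarith
  filter_upwards [ae_all_iff.2 key] with x hx
  ext k
  exact hx k

open Classical in
/-- On the boundary, the trace of `p` is orthogonal to all functions without mean flux through the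
interior boundary components. -/
lemma trace_p_boundary_form (hΩ : IsLipschitzDomain Ω) (hΓ : IsBoundaryComponents Ω Γ)
    (hμ : ∀ i, (μ i).PosDef) (hg : MemLp g 2 (volume.restrict Ω))
    (hsol : IsModelSolution Ω Γ (M.coeff κ) (M.coeff μ) g ξ f β u p)
    (hK : ∀ i, M.HasVGrad i (fun x => app (κ i) (wcurl Ω u x)) (GK i) (γK i))
    (hP : ∀ i, M.HasGrad i p (P i) (π i)) {η : Fin M.L → E3 → ℝ}
    (hη : ∀ e, ContDiff ℝ ∞ (η e)) (hη0 : ∀ e x, x ∉ M.around e → η e x = 0)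
    (hflux : ∀ l : Fin m, ∑ i, ∑ e ∈ M.faces i,
      (if M.face e ⊆ Γ l.succ then ∫ x in M.face e, η e x ∂area else 0) = 0) :
    ∑ i, ∑ e ∈ M.faces i,
      (if M.face e ⊆ frontier Ω then ∫ x in M.face e, η e x * π i x ∂area else 0) = 0 := by
  set a : Fin M.N → Fin M.L → E3 := fun i e => if M.face e ⊆ frontier Ω then
    ⟪app (μ i) (M.normal i e), M.normal i e⟫⁻¹ • M.normal i e else 0 with ha
  have h1 : ∀ i e, e ∈ M.faces i → M.face e ⊆ frontier Ω →
      ⟪app (μ i) (a i e), M.normal i e⟫ = 1 := fun i e he hsub => by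
    simp only [ha, if_pos hsub]
    rw [app_smul, real_inner_smul_left,
      inv_mul_cancel₀ (inner_app_self_pos (hμ i) (normal_ne_zero he)).ne']
  have h0 : ∀ i e, ¬ M.face e ⊆ frontier Ω → a i e = 0 := fun i e h => by simp [ha, h]
  have h := face_form hΩ hΓ hμ hg hsol hK hP hη hη0 (a := a)
    (fun i j e hij hi hj => by
      rw [h0 i e (not_subset_frontier hΩ hij hi hj), h0 j e (not_subset_frontier hΩ hij hi hj),
        cross_zero_left, cross_zero_left, add_zero])
    (fun i j e hij hi hj => by
      rw [h0 i e (not_subset_frontier hΩ hij hi hj), h0 j e (not_subset_frontier hΩ hij hi hj),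
        app_zero_right, app_zero_right, inner_zero_left, inner_zero_left, add_zero])
    (fun i e _ hsub => by
      simp only [ha, if_pos hsub]
      rw [cross_smul_left, cross_self, smul_zero])
    (fun l => by
      rw [← hflux l]
      refine Finset.sum_congr rfl fun i _ => ?_
      rw [Finset.sum_filter]
      refine Finset.sum_congr rfl fun e he => ?_
      split_ifs with hs
      · rw [h1 i e he (hs.trans (hΓ.subset_frontier _))]
        simp only [mul_one]
      · rfl)
  refine Eq.trans ?_ h
  refine Finset.sum_congr rfl fun i _ => Finset.sum_congr rfl fun e he => ?_
  split_ifs with hs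
  · refine integral_congr_ae (Eventually.of_forall fun x => ?_)
    have : ⟪cross (γK i x) (M.normal i e), a i e⟫ = 0 := by
      simp only [ha, if_pos hs]
      rw [real_inner_smul_right, inner_cross_self, mul_zero]
    simp only [h1 i e he hs, this, mul_one, zero_add]
  · simp [h0 i e hs, app_zero_right]

/-- There is a bump function near a face whose integral over the face is one. -/
lemma exists_bump (e : Fin M.L) :
    ∃ η : E3 → ℝ, ContDiff ℝ ∞ η ∧ (∀ x, x ∉ M.around e → η x = 0) ∧
      ∫ x in M.face e, η x ∂area = 1 := by
  by_contra! hcon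
  have h0 : ∀ᵐ x ∂(area.restrict (M.face e)), (fun _ : E3 => (1 : ℝ)) x = 0 := by
    refine ae_face_eq_zero (memLp_const 1) univ isOpen_univ
      (Eventually.of_forall fun _ => mem_univ _) fun η h1 h2 h3 => ?_
    rw [univ_inter] at h3
    simp only [mul_one]
    by_contra hne
    refine hcon (fun x => (∫ x in M.face e, η x ∂area)⁻¹ * η x) (contDiff_const.mul h1)
      (fun x hx => ?_) ?_
    · rw [eq_zero_of_notMem_tsupport fun h => hx (h3 h), mul_zero]
    · rw [integral_const_mul, inv_mul_cancel₀ hne]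
  simp only [one_ne_zero, eventually_false_iff_eq_bot, ae_eq_bot, Measure.restrict_eq_zero] at h0
  exact M.area_face_ne_zero e h0

/-- On each component of the boundary the trace of `p` is constant, and it is zero on the exterior
component. -/
lemma trace_p_boundary (hΩ : IsLipschitzDomain Ω) (hΓ : IsBoundaryComponents Ω Γ)
    (hμ : ∀ i, (μ i).PosDef) (hg : MemLp g 2 (volume.restrict Ω))
    (hsol : IsModelSolution Ω Γ (M.coeff κ) (M.coeff μ) g ξ f β u p)
    (hK : ∀ i, M.HasVGrad i (fun x => app (κ i) (wcurl Ω u x)) (GK i) (γK i))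
    (hP : ∀ i, M.HasGrad i p (P i) (π i)) :
    ∃ c : Fin (m + 1) → ℝ, c 0 = 0 ∧ ∀ b i e, e ∈ M.faces i → M.face e ⊆ Γ b →
      ∀ᵐ x ∂(area.restrict (M.face e)), π i x = c b := by
  classical
  have hbc : ∀ {b c : Fin (m + 1)} {e : Fin M.L}, M.face e ⊆ Γ b → M.face e ⊆ Γ c → b = c := by
    intro b c e hb hc
    obtain ⟨x, hx⟩ := M.face_nonempty e
    exact hΓ.eq_of_mem (hb hx) (hc hx)
  -- a weight that corrects the flux reduces the claim to integrals over one face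
  have key : ∀ (b : Fin (m + 1)) (c : ℝ), (∀ i e (η : E3 → ℝ), e ∈ M.faces i → M.face e ⊆ Γ b →
      ContDiff ℝ ∞ η → (∀ x, x ∉ M.around e → η x = 0) →
      ∫ x in M.face e, η x * π i x ∂area = c * ∫ x in M.face e, η x ∂area) →
      ∀ i e, e ∈ M.faces i → M.face e ⊆ Γ b →
      ∀ᵐ x ∂(area.restrict (M.face e)), π i x = c := by
    intro b c h i e hi hsub
    have hL : MemLp (fun x => π i x - c) 2 (area.restrict (M.face e)) :=
      ((hP i).memLp_trace e hi).sub (memLp_const c)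
    have := ae_face_eq_zero hL univ isOpen_univ (Eventually.of_forall fun _ => mem_univ _)
      fun η h1 h2 h3 => by
        rw [univ_inter] at h3
        have hη := memLp_face (M := M) h1.continuous e
        have := h i e η hi hsub h1 fun x hx => eq_zero_of_notMem_tsupport fun h => hx (h3 h)
        simp only [mul_sub]
        rw [integral_sub (integrable_mul_of_memLp hη ((hP i).memLp_trace e hi))
          (integrable_mul_of_memLp hη (memLp_const c)), this, integral_mul_const]
        ring
    filter_upwards [this] with x hx
    exact sub_eq_zero.1 hx
  have hone : ∀ i e (η : E3 → ℝ), e ∈ M.faces i → M.face e ⊆ Γ 0 → ContDiff ℝ ∞ η →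
      (∀ x, x ∉ M.around e → η x = 0) → ∫ x in M.face e, η x * π i x ∂area = 0 := by
    intro i e η hi hsub h1 h2
    have h := trace_p_boundary_form hΩ hΓ hμ hg hsol hK hP
      (η := fun e' x => if e' = e then η x else 0)
      (fun e' => by by_cases he : e' = e <;> simp [he, h1, contDiff_const])
      (fun e' x hx => by
        by_cases he : e' = e
        · subst he; simp [h2 x hx]
        · simp [he])
      (fun l => Finset.sum_eq_zero fun i' _ => Finset.sum_eq_zero fun e' _ => by
        by_cases hs : M.face e' ⊆ Γ l.succ
        · have he : e' ≠ e := fun h => by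
            subst h; exact absurd (hbc hs hsub) (Fin.succ_ne_zero l)
          simp [he]
        · rw [if_neg hs])
    rw [sum_faces_boundary hΩ hi (hsub.trans (hΓ.subset_frontier _))
      fun l e' he => by simp [he]] at h
    simpa [hsub.trans (hΓ.subset_frontier _)] using h
  have htwo : ∀ b i e (η : E3 → ℝ) i' e' (η' : E3 → ℝ), e ∈ M.faces i → M.face e ⊆ Γ b →
      ContDiff ℝ ∞ η → (∀ x, x ∉ M.around e → η x = 0) → e' ∈ M.faces i' → M.face e' ⊆ Γ b →
      ContDiff ℝ ∞ η' → (∀ x, x ∉ M.around e' → η' x = 0) →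
      (∫ x in M.face e, η x ∂area) + ∫ x in M.face e', η' x ∂area = 0 →
      (∫ x in M.face e, η x * π i x ∂area) + ∫ x in M.face e', η' x * π i' x ∂area = 0 := by
    intro b i e η i' e' η' hi hsub h1 h2 hi' hsub' h1' h2' hsum
    have split : ∀ (S : Set E3) (F : Fin M.N → E3 → ℝ), (∀ l d, d ∈ M.faces l →
        MemLp (F l) 2 (area.restrict (M.face d))) → Γ b ⊆ S →
        ∑ l, ∑ d ∈ M.faces l, (if M.face d ⊆ S then ∫ x in M.face d,
          ((if d = e then η x else 0) + if d = e' then η' x else 0) * F l x ∂area else 0)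
        = (∫ x in M.face e, η x * F i x ∂area) + ∫ x in M.face e', η' x * F i' x ∂area := by
      intro S F hF hS
      have t1 : ∑ l, ∑ d ∈ M.faces l, (if M.face d ⊆ S then ∫ x in M.face d,
          (if d = e then η x else 0) * F l x ∂area else 0) = ∫ x in M.face e, η x * F i x ∂area := by
        rw [sum_faces_boundary hΩ hi (hsub.trans (hΓ.subset_frontier _))
          fun l d hd => by simp [hd]]
        simp [hsub.trans hS]
      have t2 : ∑ l, ∑ d ∈ M.faces l, (if M.face d ⊆ S then ∫ x in M.face d,
          (if d = e' then η' x else 0) * F l x ∂area else 0)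
          = ∫ x in M.face e', η' x * F i' x ∂area := by
        rw [sum_faces_boundary hΩ hi' (hsub'.trans (hΓ.subset_frontier _))
          fun l d hd => by simp [hd]]
        simp [hsub'.trans hS]
      rw [← t1, ← t2, ← Finset.sum_add_distrib]
      refine Finset.sum_congr rfl fun l _ => ?_
      rw [← Finset.sum_add_distrib]
      refine Finset.sum_congr rfl fun d hd => ?_
      by_cases hds : M.face d ⊆ S
      · rw [if_pos hds, if_pos hds, if_pos hds]
        simp only [add_mul]
        have c1 : Continuous fun x => if d = e then η x else 0 := by
          by_cases hd : d = e <;> simp [hd, h1.continuous, continuous_const]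
        have c2 : Continuous fun x => if d = e' then η' x else 0 := by
          by_cases hd : d = e' <;> simp [hd, h1'.continuous, continuous_const]
        exact integral_add (integrable_mul_of_memLp (memLp_face c1 d) (hF l d hd))
          (integrable_mul_of_memLp (memLp_face c2 d) (hF l d hd))
      · rw [if_neg hds, if_neg hds, if_neg hds, add_zero]
    have hη : ∀ (ψ : E3 → ℝ) e₀, ContDiff ℝ ∞ ψ → ∀ d : Fin M.L,
        ContDiff ℝ ∞ fun x => if d = e₀ then ψ x else 0 := fun ψ e₀ hψ d => by
      by_cases hd : d = e₀ <;> simp [hd, hψ, contDiff_const]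
    have h := trace_p_boundary_form hΩ hΓ hμ hg hsol hK hP
      (η := fun d x => (if d = e then η x else 0) + if d = e' then η' x else 0)
      (fun d => (hη η e h1 d).add (hη η' e' h1' d))
      (fun d x hx => by
        have t1 : (if d = e then η x else 0) = 0 := by
          split_ifs with hd
          · subst hd; exact h2 x hx
          · rfl
        have t2 : (if d = e' then η' x else 0) = 0 := by
          split_ifs with hd
          · subst hd; exact h2' x hx
          · rfl
        simp only [t1, t2, add_zero])
      (fun l => by
        by_cases hl : l.succ = b
        · have := split (Γ b) (fun _ _ => 1)
            (fun _ _ _ => memLp_const 1) Subset.rfl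
          simp only [mul_one] at this
          rw [hl, this, hsum]
        · refine Finset.sum_eq_zero fun l' _ => Finset.sum_eq_zero fun d _ => ?_
          by_cases hs : M.face d ⊆ Γ l.succ
          · have hd : d ≠ e := fun h => by subst h; exact hl (hbc hs hsub)
            have hd' : d ≠ e' := fun h => by subst h; exact hl (hbc hs hsub')
            simp [hd, hd']
          · rw [if_neg hs])
    rwa [split (frontier Ω) π
      (fun l d hd => (hP l).memLp_trace d hd) (hΓ.subset_frontier b)] at h
  have hex : ∀ b : Fin (m + 1), ∃ c : ℝ, (b = 0 → c = 0) ∧ ∀ i e, e ∈ M.faces i →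
      M.face e ⊆ Γ b → ∀ᵐ x ∂(area.restrict (M.face e)), π i x = c := by
    intro b
    by_cases hb : b = 0
    · subst hb
      exact ⟨0, fun _ => rfl, key 0 0 fun i e η hi hsub h1 h2 => by
        rw [hone i e η hi hsub h1 h2, zero_mul]⟩
    by_cases hne : ∃ i e, e ∈ M.faces i ∧ M.face e ⊆ Γ b
    · obtain ⟨i, e, hi, hsub⟩ := hne
      obtain ⟨ψ, hψ, hψ0, hψ1⟩ := exists_bump (M := M) e
      refine ⟨∫ x in M.face e, ψ x * π i x ∂area, fun h => absurd h hb, key b _ ?_⟩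
      intro i' e' η hi' hsub' h1 h2
      have := htwo b i e (fun x => -(∫ x in M.face e', η x ∂area) * ψ x) i' e' η hi hsub
        (contDiff_const.mul hψ) (fun x hx => by rw [hψ0 x hx, mul_zero]) hi' hsub' h1 h2
        (by rw [integral_const_mul, hψ1]; ring)
      simp only [mul_assoc] at this
      rw [integral_const_mul] at this
      linarith
    · exact ⟨0, fun _ => rfl, fun i e hi hsub => absurd ⟨i, e, hi, hsub⟩ hne⟩
  choose c hc0 hc using hex
  exact ⟨c, hc0 0 rfl, hc⟩

/-- The traces of `p` and the fluxes of a face field in `U_h^0` are orthogonal. -/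
lemma sum_trace_p_eq_zero (hΩ : IsLipschitzDomain Ω) (hΓ : IsBoundaryComponents Ω Γ)
    (hμ : ∀ i, (μ i).PosDef) (hg : MemLp g 2 (volume.restrict Ω))
    (hsol : IsModelSolution Ω Γ (M.coeff κ) (M.coeff μ) g ξ f β u p)
    (hK : ∀ i, M.HasVGrad i (fun x => app (κ i) (wcurl Ω u x)) (GK i) (γK i))
    (hP : ∀ i, M.HasGrad i p (P i) (π i)) {v : M.Weak} (hv : ∀ e, Continuous (v.2 e))
    (hflux : ∀ l : Fin m, M.bflux v (Γ l.succ) = 0) :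
    ∑ i, ∑ e ∈ M.faces i, ∫ x in M.face e, π i x * ⟪v.2 e x, M.normal i e⟫ ∂area = 0 := by
  classical
  have hint : ∀ i e, e ∈ M.faces i →
      IntegrableOn (fun x => π i x * ⟪v.2 e x, M.normal i e⟫) (M.face e) area := fun i e he =>
    integrable_mul_of_memLp ((hP i).memLp_trace e he)
      ((memLp_face_vec (hv e) e).inner_const (𝕜 := ℝ) _)
  rw [sum_faces_eq_boundary]
  · obtain ⟨c, hc0, hc⟩ := trace_p_boundary hΩ hΓ hμ hg hsol hK hP
    have h1 : ∑ b, c b * M.bflux v (Γ b) = 0 := by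
      rw [Fin.sum_univ_succ, hc0, zero_mul, zero_add]
      exact Finset.sum_eq_zero fun l _ => by rw [hflux l, mul_zero]
    rw [← h1]
    simp only [bflux, Finset.mul_sum]
    rw [Finset.sum_comm]
    refine Finset.sum_congr rfl fun i _ => ?_
    simp only [Finset.sum_filter]
    rw [Finset.sum_comm]
    refine Finset.sum_congr rfl fun e he => ?_
    split_ifs with hs
    · obtain ⟨x, hx⟩ := M.face_nonempty e
      obtain ⟨b, hb⟩ := hΓ.exists_mem (hs hx)
      have hsub := hΓ.subset_of_mem (M.face_isPolygon e).isConnected.isPreconnected hs hx hb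
      rw [Finset.sum_eq_single b]
      · rw [if_pos hsub, ← integral_const_mul]
        refine integral_congr_ae ?_
        filter_upwards [hc b i e he hsub] with y hy
        rw [hy]
      · intro b' _ hne
        rw [if_neg fun h => hne (hΓ.eq_of_mem (h hx) hb)]
      · simp
    · refine (Finset.sum_eq_zero fun b _ => ?_).symm
      rw [if_neg fun h => hs (h.trans (hΓ.subset_frontier b))]
  · intro i j e hij hi hj
    rw [← integral_add (hint i e hi) (hint j e hj)]
    refine integral_eq_zero_of_ae ?_
    filter_upwards [trace_p_match hΩ hΓ hμ hg hsol hK hP hij hi hj] with x hx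
    rw [normal_eq_neg hij hi hj, inner_neg_right, hx, Pi.zero_apply]
    ring

/-- The tangential traces of `κ ∇ × u` are orthogonal to face fields that are normal on the
boundary. -/
lemma sum_trace_curl_eq_zero (hΩ : IsLipschitzDomain Ω) (hΓ : IsBoundaryComponents Ω Γ)
    (hμ : ∀ i, (μ i).PosDef) (hg : MemLp g 2 (volume.restrict Ω))
    (hsol : IsModelSolution Ω Γ (M.coeff κ) (M.coeff μ) g ξ f β u p)
    (hK : ∀ i, M.HasVGrad i (fun x => app (κ i) (wcurl Ω u x)) (GK i) (γK i))
    (hP : ∀ i, M.HasGrad i p (P i) (π i)) {v : M.Weak} (hv : ∀ e, Continuous (v.2 e))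
    (hbd : ∀ i, ∀ e ∈ M.faces i, M.face e ⊆ frontier Ω →
      ∀ᵐ x ∂(area.restrict (M.face e)), cross (v.2 e x) (M.normal i e) = 0) :
    ∑ i, ∑ e ∈ M.faces i,
      ∫ x in M.face e, ⟪cross (γK i x) (M.normal i e), v.2 e x⟫ ∂area = 0 := by
  classical
  rw [sum_faces_eq_boundary]
  · refine Finset.sum_eq_zero fun i _ => Finset.sum_eq_zero fun e he => ?_
    rw [Finset.mem_filter] at he
    refine integral_eq_zero_of_ae ?_
    filter_upwards [hbd i e he.1 he.2] with x hx
    rw [inner_cross_left, hx, inner_zero_right, neg_zero, Pi.zero_apply]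
  · intro i j e hij hi hj
    have hint : ∀ l, e ∈ M.faces l →
        IntegrableOn (fun x => ⟪cross (γK l x) (M.normal l e), v.2 e x⟫) (M.face e) area :=
      fun l hl => integrable_inner_of_memLp (memLp_cross ((hK l).memLp_trace hl) _)
        (memLp_face_vec (hv e) e)
    rw [← integral_add (hint i hi) (hint j hj)]
    refine integral_eq_zero_of_ae ?_
    filter_upwards [trace_curl_match hΩ hΓ hμ hg hsol hK hP hij hi hj] with x hx
    rw [← inner_add_left, hx, inner_zero_left, Pi.zero_apply]

end Model

end PolyPartition

/-- A solution of the formulation with Lagrange multipliers solves the model problem. -/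
lemma IsMultiplierSolution.isModelSolution {Ω : Set E3} {m : ℕ} {Γ : Fin (m + 1) → Set E3}
    {κ μ : E3 → Matrix (Fin 3) (Fin 3) ℝ} {g ξ : E3 → E3} {f : E3 → ℝ} {β lam : Fin m → ℝ}
    {u : E3 → E3} {p : E3 → ℝ} (h : IsMultiplierSolution Ω Γ κ μ g ξ f β u p lam) :
    IsModelSolution Ω Γ κ μ g ξ f β u p where
  u_mem := h.u_mem
  p_mem := h.p_mem
  curl_eq v hv ht hflux := by
    have := h.curl_eq v hv ht
    simpa [hflux] using this
  div_eq w hw := by simpa using h.div_eq w 0 hw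
  flux_eq i := by
    have := h.div_eq 0 (Pi.single i 1) MemLp.zero
    simpa [Pi.single_apply] using this
  boundary := h.boundary

/-! ### Polynomial spaces -/

lemma polyFun_apply (P : MvPolynomial (Fin 3) ℝ) (x : E3) :
    polyFun P x = MvPolynomial.eval x.ofLp P := rfl

lemma contDiff_polyFun (P : MvPolynomial (Fin 3) ℝ) : ContDiff ℝ ∞ (polyFun P) := by
  induction P using MvPolynomial.induction_on with
  | C a =>
    have : polyFun (MvPolynomial.C a) = fun _ => a := by ext x; simp [polyFun_apply]
    rw [this]; exact contDiff_const
  | add P Q hP hQ => rw [map_add]; exact hP.add hQ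
  | mul_X P j hP =>
    have : polyFun (P * MvPolynomial.X j) = fun x => polyFun P x * x j := by
      ext x; simp [polyFun_apply]
    rw [this]
    exact hP.mul (contDiff_comp_apply contDiff_id j)

lemma fderiv_polyFun (P : MvPolynomial (Fin 3) ℝ) (x : E3) (i : Fin 3) :
    fderiv ℝ (polyFun P) x (ev i) = polyFun (MvPolynomial.pderiv i P) x := by
  have hd : ∀ Q, DifferentiableAt ℝ (polyFun Q) x := fun Q =>
    (contDiff_polyFun Q).differentiable (by simp) x
  induction P using MvPolynomial.induction_on with
  | C a =>
    have : polyFun (MvPolynomial.C a) = fun _ => a := by ext x; simp [polyFun_apply]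
    rw [this]; simp
  | add P Q hP hQ =>
    rw [map_add, fderiv_add (hd P) (hd Q), _root_.add_apply, hP, hQ, map_add, map_add]
    rfl
  | mul_X P j hP =>
    have h1 : polyFun (P * MvPolynomial.X j) = fun x => polyFun P x * x j := by
      ext x; simp [polyFun_apply]
    have h2 : HasFDerivAt (fun y : E3 => y j) (EuclideanSpace.proj (𝕜 := ℝ) j : E3 →L[ℝ] ℝ) x :=
      (EuclideanSpace.proj (𝕜 := ℝ) j).hasFDerivAt
    rw [h1, fderiv_fun_mul (hd P) h2.differentiableAt, h2.fderiv]
    simp only [_root_.add_apply, _root_.smul_apply, hP,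
      polyFun_apply, Derivation.leibniz, MvPolynomial.pderiv_X, smul_eq_mul, map_add, map_mul,
      MvPolynomial.eval_X]
    by_cases hij : j = i
    · subst hij; simp
    · simp [hij]

lemma pderiv_mem {k : ℕ} {P : MvPolynomial (Fin 3) ℝ}
    (hP : P ∈ MvPolynomial.restrictTotalDegree (Fin 3) ℝ k) (i : Fin 3) :
    MvPolynomial.pderiv i P ∈ MvPolynomial.restrictTotalDegree (Fin 3) ℝ (k - 1) := by
  rw [MvPolynomial.mem_restrictTotalDegree] at hP
  rw [P.as_sum, map_sum]
  refine Submodule.sum_mem _ fun s hs => ?_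
  rw [MvPolynomial.pderiv_monomial]
  by_cases h0 : s i = 0
  · simp [h0]
  rw [MvPolynomial.mem_restrictTotalDegree]
  refine (MvPolynomial.totalDegree_monomial_le _ _).trans ?_
  have h1 := (MvPolynomial.le_totalDegree hs).trans hP
  rw [Finsupp.sum_fintype _ _ fun _ => rfl, Fin.sum_univ_three] at h1 ⊢
  fin_cases i <;> simp at h0 ⊢ <;> omega

variable {k : ℕ}

lemma contDiff_of_mem_poly {q : E3 → ℝ} (hq : q ∈ Poly k) : ContDiff ℝ ∞ q := by
  obtain ⟨P, -, rfl⟩ := hq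
  exact contDiff_polyFun P

lemma poly_mono {k' : ℕ} (h : k ≤ k') : Poly k ≤ Poly k' :=
  Submodule.map_mono fun P hP => by
    rw [MvPolynomial.mem_restrictTotalDegree] at hP ⊢
    exact hP.trans h

lemma const_mem_poly (c : ℝ) : (fun _ => c) ∈ Poly k :=
  ⟨MvPolynomial.C c, by
    rw [SetLike.mem_coe, MvPolynomial.mem_restrictTotalDegree, MvPolynomial.totalDegree_C]
    exact Nat.zero_le k, by ext x; simp [polyFun_apply]⟩

lemma fderiv_mem_poly {q : E3 → ℝ} (hq : q ∈ Poly k) (i : Fin 3) :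
    (fun x => fderiv ℝ q x (ev i)) ∈ Poly (k - 1) := by
  obtain ⟨P, hP, rfl⟩ := hq
  exact ⟨_, pderiv_mem hP i, funext fun x => (fderiv_polyFun P x i).symm⟩

instance : FiniteDimensional ℝ (Poly k) := by unfold Poly; infer_instance

lemma contDiff_of_mem_vpoly {w : E3 → E3} (hw : w ∈ VPoly k) : ContDiff ℝ ∞ w := by
  rw [contDiff_euclidean]
  exact fun j => contDiff_of_mem_poly (hw j)

lemma vpoly_mono {k' : ℕ} (h : k ≤ k') {w : E3 → E3} (hw : w ∈ VPoly k) : w ∈ VPoly k' :=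
  fun j => poly_mono h (hw j)

lemma sub_mem_vpoly {w w' : E3 → E3} (hw : w ∈ VPoly k) (hw' : w' ∈ VPoly k) :
    (fun x => w x - w' x) ∈ VPoly k := fun j => (Poly k).sub_mem (hw j) (hw' j)

lemma add_mem_vpoly {w w' : E3 → E3} (hw : w ∈ VPoly k) (hw' : w' ∈ VPoly k) :
    (fun x => w x + w' x) ∈ VPoly k := fun j => (Poly k).add_mem (hw j) (hw' j)

lemma smul_mem_vpoly {q : E3 → ℝ} (hq : q ∈ Poly k) (n : E3) :
    (fun x => q x • n) ∈ VPoly k := fun j => by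
  have : (fun x => (q x • n) j) = n j • q := by ext x; simp [mul_comm]
  rw [this]; exact (Poly k).smul_mem _ hq

lemma app_mem_vpoly {w : E3 → E3} (hw : w ∈ VPoly k) (A : Matrix (Fin 3) (Fin 3) ℝ) :
    (fun x => app A (w x)) ∈ VPoly k := fun j => by
  have : (fun x => app A (w x) j) = ∑ a, A j a • fun x => w x a := by
    ext x; simp
  rw [this]
  exact (Poly k).sum_mem fun a _ => (Poly k).smul_mem _ (hw a)

lemma cross_mem_vpoly {w : E3 → E3} (hw : w ∈ VPoly k) (n : E3) :
    (fun x => cross (w x) n) ∈ VPoly k := fun j => by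
  have key : ∀ a b, (fun x => w x a * n b - w x b * n a) ∈ Poly k := fun a b => by
    have : (fun x => w x a * n b - w x b * n a)
        = n b • (fun x => w x a) - n a • fun x => w x b := by ext x; simp [mul_comm]
    rw [this]
    exact (Poly k).sub_mem ((Poly k).smul_mem _ (hw a)) ((Poly k).smul_mem _ (hw b))
  fin_cases j
  · simpa using key 1 2
  · simpa using key 2 0
  · simpa using key 0 1

lemma gradient_mem_vpoly {q : E3 → ℝ} (hq : q ∈ Poly k) : gradient q ∈ VPoly (k - 1) := fun j => by
  simp only [gradient_apply]
  exact fderiv_mem_poly hq j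

lemma curl_mem_vpoly {w : E3 → E3} (hw : w ∈ VPoly k) : curl w ∈ VPoly (k - 1) := fun j => by
  have h : ∀ a b, (fun x => pd w a b x) ∈ Poly (k - 1) := fun a b => by
    simp only [pd_eq (contDiff_of_mem_vpoly hw)]
    exact fderiv_mem_poly (hw b) a
  fin_cases j
  · exact (Poly _).sub_mem (h 1 2) (h 2 1)
  · exact (Poly _).sub_mem (h 2 0) (h 0 2)
  · exact (Poly _).sub_mem (h 0 1) (h 1 0)

lemma sdiv_mem_poly {w : E3 → E3} (hw : w ∈ VPoly k) : sdiv w ∈ Poly (k - 1) := by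
  have : sdiv w = ∑ j, fun x => fderiv ℝ (fun y => w y j) x (ev j) := by ext x; simp [sdiv]
  rw [this]
  exact (Poly _).sum_mem fun j _ => fderiv_mem_poly (hw j) j

/-! ### Existence and properties of the projections -/

/-- A functional on a finite-dimensional space that vanishes on the kernel of a symmetric bilinear
form is represented by that form. -/
lemma exists_represents {V : Type*} [AddCommGroup V] [Module ℝ V] [FiniteDimensional ℝ V]
    (B : V →ₗ[ℝ] V →ₗ[ℝ] ℝ) (hB : ∀ x y, B x y = B y x) (F : V →ₗ[ℝ] ℝ)
    (hF : ∀ x, B x = 0 → F x = 0) : ∃ q, B q = F := by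
  have h1 : F ∈ (LinearMap.ker B).dualAnnihilator := by
    rw [Submodule.mem_dualAnnihilator]
    exact fun x hx => hF x (LinearMap.mem_ker.1 hx)
  rw [← LinearMap.range_dualMap_eq_dualAnnihilator_ker] at h1
  obtain ⟨Φ, hΦ⟩ := h1
  obtain ⟨q, rfl⟩ := (Module.evalEquiv ℝ V).surjective Φ
  refine ⟨q, ?_⟩
  rw [← hΦ]
  ext x
  simp [hB q x]

section Projection

variable {ν : Measure E3}

lemma memLp_of_mem_poly (hν : ∀ φ : E3 → ℝ, Continuous φ → MemLp φ 2 ν)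
    {q : E3 → ℝ} (hq : q ∈ Poly k) : MemLp q 2 ν :=
  hν q (contDiff_of_mem_poly hq).continuous

/-- Representation of functionals on polynomials in `L²(ν)`. -/
lemma exists_poly_represents (hν : ∀ φ : E3 → ℝ, Continuous φ → MemLp φ 2 ν)
    (F : Poly k →ₗ[ℝ] ℝ)
    (hF : ∀ φ : Poly k, (∀ᵐ x ∂ν, φ.1 x = 0) → F φ = 0) :
    ∃ q ∈ Poly k, ∀ φ : Poly k, ∫ x, q x * φ.1 x ∂ν = F φ := by
  have hint : ∀ φ ψ : Poly k, Integrable (fun x => φ.1 x * ψ.1 x) ν := fun φ ψ =>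
    integrable_mul_of_memLp (memLp_of_mem_poly hν φ.2) (memLp_of_mem_poly hν ψ.2)
  let B : Poly k →ₗ[ℝ] Poly k →ₗ[ℝ] ℝ := LinearMap.mk₂ ℝ (fun φ ψ => ∫ x, φ.1 x * ψ.1 x ∂ν)
    (fun φ φ' ψ => by
      rw [← integral_add (hint φ ψ) (hint φ' ψ)]
      simp [add_mul])
    (fun c φ ψ => by
      rw [smul_eq_mul, ← integral_const_mul]
      simp [mul_assoc])
    (fun φ ψ ψ' => by
      rw [← integral_add (hint φ ψ) (hint φ ψ')]
      simp [mul_add])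
    (fun c φ ψ => by
      rw [smul_eq_mul, ← integral_const_mul]
      simp [mul_left_comm])
  obtain ⟨q, hq⟩ := exists_represents B
    (fun φ ψ => by
      change ∫ x, φ.1 x * ψ.1 x ∂ν = ∫ x, ψ.1 x * φ.1 x ∂ν
      simp only [mul_comm]) F fun φ hφ => hF φ <| by
    have h0 : ∫ x, φ.1 x * φ.1 x ∂ν = 0 := by
      have := congrArg (fun L => L φ) hφ
      exact this
    rw [integral_eq_zero_iff_of_nonneg (fun x => mul_self_nonneg _) (hint φ φ)] at h0
    filter_upwards [h0] with x hx using mul_self_eq_zero.1 hx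
  exact ⟨q.1, q.2, fun φ => by rw [← hq]; rfl⟩

lemma proj_spec (hν : ∀ φ : E3 → ℝ, Continuous φ → MemLp φ 2 ν)
    {w : E3 → ℝ} (hw : MemLp w 2 ν) :
    proj ν k w ∈ Poly k ∧ ∀ φ ∈ Poly k, ∫ x, (w x - proj ν k w x) * φ x ∂ν = 0 := by
  have hint : ∀ φ : Poly k, Integrable (fun x => w x * φ.1 x) ν := fun φ =>
    integrable_mul_of_memLp hw (memLp_of_mem_poly hν φ.2)
  have hex : ∃ q ∈ Poly k, ∀ φ ∈ Poly k, ∫ x, (w x - q x) * φ x ∂ν = 0 := by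
    obtain ⟨q, hq, h⟩ := exists_poly_represents hν
      (F := { toFun := fun φ : Poly k => ∫ x, w x * φ.1 x ∂ν
              map_add' := fun φ ψ => by
                rw [← integral_add (hint φ) (hint ψ)]; simp [mul_add]
              map_smul' := fun c φ => by
                rw [RingHom.id_apply, smul_eq_mul, ← integral_const_mul]; simp [mul_left_comm] })
      (fun φ hφ => integral_eq_zero_of_ae (by
        filter_upwards [hφ] with x hx
        rw [hx, mul_zero, Pi.zero_apply]))
    refine ⟨q, hq, fun φ hφ => ?_⟩
    simp only [sub_mul]
    rw [integral_sub (hint ⟨φ, hφ⟩)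
      (integrable_mul_of_memLp (memLp_of_mem_poly hν hq) (memLp_of_mem_poly hν hφ)), sub_eq_zero]
    exact (h ⟨φ, hφ⟩).symm
  rw [proj, dif_pos hex]
  exact hex.choose_spec

lemma integral_proj_mul (hν : ∀ φ : E3 → ℝ, Continuous φ → MemLp φ 2 ν)
    {w : E3 → ℝ} (hw : MemLp w 2 ν) {φ : E3 → ℝ} (hφ : φ ∈ Poly k) :
    ∫ x, proj ν k w x * φ x ∂ν = ∫ x, w x * φ x ∂ν := by
  obtain ⟨h1, h2⟩ := proj_spec hν hw (k := k)
  have := h2 φ hφ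
  simp only [sub_mul] at this
  rw [integral_sub (integrable_mul_of_memLp hw (memLp_of_mem_poly hν hφ))
    (integrable_mul_of_memLp (memLp_of_mem_poly hν h1) (memLp_of_mem_poly hν hφ))] at this
  linarith

lemma vproj_mem (hν : ∀ φ : E3 → ℝ, Continuous φ → MemLp φ 2 ν)
    {w : E3 → E3} (hw : MemLp w 2 ν) : vproj ν k w ∈ VPoly k := fun j =>
  (proj_spec hν (memLp_apply hw j)).1

lemma memLp_of_mem_vpoly (hν : ∀ φ : E3 → ℝ, Continuous φ → MemLp φ 2 ν)
    {w : E3 → E3} (hw : w ∈ VPoly k) : MemLp w 2 ν :=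
  memLp_of_apply fun j => memLp_of_mem_poly hν (hw j)

lemma integral_inner_eq_sum {w φ : E3 → E3} (hw : MemLp w 2 ν) (hφ : MemLp φ 2 ν) :
    ∫ x, ⟪w x, φ x⟫ ∂ν = ∑ j, ∫ x, w x j * φ x j ∂ν := by
  rw [← integral_finsetSum _ fun j _ =>
    integrable_mul_of_memLp (memLp_apply hw j) (memLp_apply hφ j)]
  simp only [inner_three, Fin.sum_univ_three]

lemma integral_vproj_inner (hν : ∀ φ : E3 → ℝ, Continuous φ → MemLp φ 2 ν)
    {w : E3 → E3} (hw : MemLp w 2 ν) {φ : E3 → E3} (hφ : φ ∈ VPoly k) :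
    ∫ x, ⟪vproj ν k w x, φ x⟫ ∂ν = ∫ x, ⟪w x, φ x⟫ ∂ν := by
  rw [integral_inner_eq_sum (memLp_of_mem_vpoly hν (vproj_mem hν hw))
    (memLp_of_mem_vpoly hν hφ), integral_inner_eq_sum hw (memLp_of_mem_vpoly hν hφ)]
  exact Finset.sum_congr rfl fun j _ => integral_proj_mul hν (memLp_apply hw j) (hφ j)

/-- A polynomial field with the moments of `w` is the projection of `w`. -/
lemma ae_eq_vproj (hν : ∀ φ : E3 → ℝ, Continuous φ → MemLp φ 2 ν)
    {w c : E3 → E3} (hw : MemLp w 2 ν) (hc : c ∈ VPoly k)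
    (h : ∀ φ ∈ VPoly k, ∫ x, ⟪c x, φ x⟫ ∂ν = ∫ x, ⟪w x, φ x⟫ ∂ν) :
    ∀ᵐ x ∂ν, c x = vproj ν k w x := by
  have hp := vproj_mem hν hw (k := k)
  have hd : (fun x => c x - vproj ν k w x) ∈ VPoly k := sub_mem_vpoly hc hp
  have mc := memLp_of_mem_vpoly hν hc
  have mp := memLp_of_mem_vpoly hν hp
  have md := memLp_of_mem_vpoly hν hd
  have h0 : ∫ x, ⟪c x - vproj ν k w x, c x - vproj ν k w x⟫ ∂ν = 0 := by
    have : ∀ x, ⟪c x - vproj ν k w x, c x - vproj ν k w x⟫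
        = ⟪c x, c x - vproj ν k w x⟫ - ⟪vproj ν k w x, c x - vproj ν k w x⟫ := fun x =>
      inner_sub_left _ _ _
    simp only [this]
    rw [integral_sub (integrable_inner_of_memLp mc md) (integrable_inner_of_memLp mp md),
      h _ hd, integral_vproj_inner hν hw hd, sub_self]
  rw [integral_eq_zero_iff_of_nonneg (fun x => real_inner_self_nonneg)
    (integrable_inner_of_memLp md md)] at h0
  filter_upwards [h0] with x hx
  exact sub_eq_zero.1 (inner_self_eq_zero.1 hx)

/-- Representation of functionals on polynomial fields in `L²(ν)`. -/
lemma exists_vpoly_represents (hν : ∀ φ : E3 → ℝ, Continuous φ → MemLp φ 2 ν)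
    (F : (Fin 3 → Poly k) →ₗ[ℝ] ℝ)
    (hF : ∀ φ : Fin 3 → Poly k, (∀ j, ∀ᵐ x ∂ν, (φ j).1 x = 0) → F φ = 0) :
    ∃ c ∈ VPoly k, ∀ φ : Fin 3 → Poly k,
      ∫ x, ⟪c x, WithLp.toLp 2 fun j => (φ j).1 x⟫ ∂ν = F φ := by
  have hex : ∀ j, ∃ q ∈ Poly k, ∀ φ : Poly k,
      ∫ x, q x * φ.1 x ∂ν = F (Pi.single j φ) := fun j =>
    exists_poly_represents hν (F := F ∘ₗ LinearMap.single ℝ (fun _ => Poly k) j) fun φ hφ =>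
      hF _ fun l => by
        by_cases hl : l = j
        · subst hl; simpa using hφ
        · exact Eventually.of_forall fun x => by simp [hl]
  choose q hq h using hex
  have hc : (fun x => WithLp.toLp 2 fun j => q j x : E3 → E3) ∈ VPoly k := fun j => hq j
  refine ⟨_, hc, fun φ => ?_⟩
  have hφ : (fun x => WithLp.toLp 2 fun j => (φ j).1 x : E3 → E3) ∈ VPoly k := fun j => (φ j).2
  rw [integral_inner_eq_sum (memLp_of_mem_vpoly hν hc) (memLp_of_mem_vpoly hν hφ)]
  have : F φ = ∑ j, F (Pi.single j (φ j)) := by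
    rw [← map_sum, Finset.univ_sum_single]
  rw [this]
  exact Finset.sum_congr rfl fun j _ => h j (φ j)

end Projection

/-! ### Linearity of the differential operators -/

lemma app_sub (A : Matrix (Fin 3) (Fin 3) ℝ) (a b : E3) : app A (a - b) = app A a - app A b := by
  ext j; simp [Fin.sum_univ_three]; ring

lemma cross_sub_left (a b n : E3) : cross (a - b) n = cross a n - cross b n := by
  ext j; fin_cases j <;> simp <;> ring

lemma gradient_add' {φ ψ : E3 → ℝ} (hφ : ContDiff ℝ ∞ φ) (hψ : ContDiff ℝ ∞ ψ) :
    gradient (φ + ψ) = gradient φ + gradient ψ := by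
  ext x j
  rw [gradient_apply, fderiv_add (hφ.differentiable (by simp) x) (hψ.differentiable (by simp) x)]
  simp [gradient_apply]

lemma gradient_smul' {φ : E3 → ℝ} (hφ : ContDiff ℝ ∞ φ) (c : ℝ) :
    gradient (c • φ) = c • gradient φ := by
  ext x j
  rw [gradient_apply, fderiv_const_smul (hφ.differentiable (by simp) x)]
  simp [gradient_apply]

lemma pd_add {w w' : E3 → E3} (hw : ContDiff ℝ ∞ w) (hw' : ContDiff ℝ ∞ w') (a b : Fin 3)
    (x : E3) : pd (w + w') a b x = pd w a b x + pd w' a b x := by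
  rw [pd, fderiv_add (hw.differentiable (by simp) x) (hw'.differentiable (by simp) x)]
  simp [pd]

lemma pd_smul {w : E3 → E3} (hw : ContDiff ℝ ∞ w) (c : ℝ) (a b : Fin 3)
    (x : E3) : pd (c • w) a b x = c * pd w a b x := by
  rw [pd, fderiv_const_smul (hw.differentiable (by simp) x)]
  simp [pd]

lemma curl_add {w w' : E3 → E3} (hw : ContDiff ℝ ∞ w) (hw' : ContDiff ℝ ∞ w') :
    curl (w + w') = curl w + curl w' := by
  ext x j
  fin_cases j <;> simp [curl, pd_add hw hw'] <;> ring

lemma curl_smul {w : E3 → E3} (hw : ContDiff ℝ ∞ w) (c : ℝ) :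
    curl (c • w) = c • curl w := by
  ext x j
  fin_cases j <;> simp [curl, pd_smul hw] <;> ring

lemma curl_eq_zero_of_eqOn {T : Set E3} (hT : IsOpen T) {w : E3 → E3} (hw : ∀ x ∈ T, w x = 0)
    {x : E3} (hx : x ∈ T) : curl w x = 0 := by
  have h : w =ᶠ[𝓝 x] fun _ => 0 := by
    filter_upwards [hT.mem_nhds hx] with y hy using hw y hy
  have h' : ∀ a b, pd w a b x = 0 := fun a b => by rw [pd, h.fderiv_eq]; simp
  ext j
  fin_cases j <;> simp [curl, h']

lemma gradient_eq_zero_of_eqOn {T : Set E3} (hT : IsOpen T) {φ : E3 → ℝ} (hφ : ∀ x ∈ T, φ x = 0)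
    {x : E3} (hx : x ∈ T) : gradient φ x = 0 := by
  have h : φ =ᶠ[𝓝 x] fun _ => 0 := by
    filter_upwards [hT.mem_nhds hx] with y hy using hφ y hy
  ext j
  rw [gradient_apply, h.fderiv_eq]; simp

namespace PolyPartition

/-! ### The discrete weak operators -/

variable {Ω : Set E3} {M : PolyPartition Ω} {k : ℕ} {μ κ : Fin M.N → Matrix (Fin 3) (Fin 3) ℝ}
  {v w : M.Weak} {i : Fin M.N}

/-- A continuous function that vanishes almost everywhere in an element vanishes on its closure. -/
lemma eq_zero_of_ae {φ : E3 → ℝ} (hφ : Continuous φ)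
    (h : ∀ᵐ x ∂(volume.restrict (M.elem i)), φ x = 0) : ∀ x ∈ closure (M.elem i), φ x = 0 := by
  have h1 : EqOn φ (fun _ => 0) (M.elem i) :=
    Measure.eqOn_open_of_ae_eq h (M.elem_isOpen i) hφ.continuousOn continuousOn_const
  exact fun x hx => h1.closure hφ continuous_const hx

lemma mem_closure_of_mem_face {f : Fin M.L} (hf : f ∈ M.faces i) {x : E3} (hx : x ∈ M.face f) :
    x ∈ closure (M.elem i) :=
  frontier_subset_closure (M.face_subset_frontier hf hx)

variable (M μ v i) in
/-- The right-hand side of the definition of the discrete weak divergence. -/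
def divForm (φ : E3 → ℝ) : ℝ :=
  -(∫ x in M.elem i, ⟪app (μ i) (v.1 i x), gradient φ x⟫)
    + ∑ f ∈ M.faces i, ∫ x in M.face f, ⟪v.2 f x, M.normal i f⟫ * φ x ∂area

variable (M v i) in
/-- The right-hand side of the definition of the discrete weak curl. -/
def curlForm (φ : E3 → E3) : ℝ :=
  (∫ x in M.elem i, ⟪v.1 i x, curl φ x⟫)
    - ∑ f ∈ M.faces i, ∫ x in M.face f, ⟪cross (v.2 f x) (M.normal i f), φ x⟫ ∂area

section Linear

lemma memLp_fst (hv : v ∈ M.V k) (i : Fin M.N) : MemLp (v.1 i) 2 (volume.restrict (M.elem i)) :=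
  memLp_elem_vec (contDiff_of_mem_vpoly (hv.1 i)).continuous i

lemma memLp_fst_face (hv : v ∈ M.V k) (i : Fin M.N) (f : Fin M.L) :
    MemLp (v.1 i) 2 (area.restrict (M.face f)) :=
  memLp_face_vec (contDiff_of_mem_vpoly (hv.1 i)).continuous f

lemma memLp_snd (hv : v ∈ M.V k) (f : Fin M.L) : MemLp (v.2 f) 2 (area.restrict (M.face f)) :=
  memLp_face_vec (contDiff_of_mem_vpoly (hv.2 f)).continuous f

lemma integrable_divForm_elem (hv : v ∈ M.V k) (i : Fin M.N) {φ : E3 → ℝ} (hφ : ContDiff ℝ ∞ φ) :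
    Integrable (fun x => ⟪app (μ i) (v.1 i x), gradient φ x⟫) (volume.restrict (M.elem i)) :=
  integrable_inner_of_memLp (memLp_app (memLp_fst hv i) _)
    (memLp_elem_vec (contDiff_gradient hφ).continuous i)

lemma integrable_divForm_face (hv : v ∈ M.V k) (i : Fin M.N) (f : Fin M.L) {φ : E3 → ℝ}
    (hφ : ContDiff ℝ ∞ φ) :
    Integrable (fun x => ⟪v.2 f x, M.normal i f⟫ * φ x) (area.restrict (M.face f)) :=
  integrable_mul_of_memLp ((memLp_snd hv f).inner_const (𝕜 := ℝ) _) (memLp_face hφ.continuous f)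

lemma integrable_curlForm_elem (hv : v ∈ M.V k) (i : Fin M.N) {φ : E3 → E3}
    (hφ : ContDiff ℝ ∞ φ) :
    Integrable (fun x => ⟪v.1 i x, curl φ x⟫) (volume.restrict (M.elem i)) :=
  integrable_inner_of_memLp (memLp_fst hv i) (memLp_elem_vec (contDiff_curl hφ).continuous i)

lemma integrable_curlForm_face (hv : v ∈ M.V k) (i : Fin M.N) (f : Fin M.L) {φ : E3 → E3}
    (hφ : ContDiff ℝ ∞ φ) :
    Integrable (fun x => ⟪cross (v.2 f x) (M.normal i f), φ x⟫) (area.restrict (M.face f)) :=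
  integrable_inner_of_memLp (memLp_cross (memLp_snd hv f) _) (memLp_face_vec hφ.continuous f)

lemma divForm_add (hv : v ∈ M.V k) {φ ψ : E3 → ℝ} (hφ : ContDiff ℝ ∞ φ) (hψ : ContDiff ℝ ∞ ψ) :
    M.divForm μ v i (φ + ψ) = M.divForm μ v i φ + M.divForm μ v i ψ := by
  simp only [divForm, gradient_add' hφ hψ, Pi.add_apply, inner_add_right, mul_add]
  rw [integral_add (integrable_divForm_elem hv i hφ) (integrable_divForm_elem hv i hψ),
    Finset.sum_congr rfl fun f _ => integral_add (integrable_divForm_face hv i f hφ)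
      (integrable_divForm_face hv i f hψ), Finset.sum_add_distrib]
  ring

lemma divForm_smul {φ : E3 → ℝ} (hφ : ContDiff ℝ ∞ φ) (c : ℝ) :
    M.divForm μ v i (c • φ) = c * M.divForm μ v i φ := by
  simp only [divForm, gradient_smul' hφ, Pi.smul_apply, real_inner_smul_right, smul_eq_mul,
    mul_left_comm _ c, integral_const_mul, ← Finset.mul_sum]
  ring

lemma curlForm_add (hv : v ∈ M.V k) {φ ψ : E3 → E3} (hφ : ContDiff ℝ ∞ φ) (hψ : ContDiff ℝ ∞ ψ) :
    M.curlForm v i (φ + ψ) = M.curlForm v i φ + M.curlForm v i ψ := by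
  simp only [curlForm, curl_add hφ hψ, Pi.add_apply, inner_add_right]
  rw [integral_add (integrable_curlForm_elem hv i hφ) (integrable_curlForm_elem hv i hψ),
    Finset.sum_congr rfl fun f _ => integral_add (integrable_curlForm_face hv i f hφ)
      (integrable_curlForm_face hv i f hψ), Finset.sum_add_distrib]
  ring

lemma curlForm_smul {φ : E3 → E3} (hφ : ContDiff ℝ ∞ φ) (c : ℝ) :
    M.curlForm v i (c • φ) = c * M.curlForm v i φ := by
  simp only [curlForm, curl_smul hφ, Pi.smul_apply, real_inner_smul_right,
    integral_const_mul, ← Finset.mul_sum]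
  ring

lemma divForm_sub (hv : v ∈ M.V k) (hw : w ∈ M.V k) {φ : E3 → ℝ} (hφ : ContDiff ℝ ∞ φ) :
    M.divForm μ (v - w) i φ = M.divForm μ v i φ - M.divForm μ w i φ := by
  simp only [divForm, Prod.fst_sub, Prod.snd_sub, Pi.sub_apply, app_sub, inner_sub_left, sub_mul]
  rw [integral_sub (integrable_divForm_elem hv i hφ) (integrable_divForm_elem hw i hφ),
    Finset.sum_congr rfl fun f _ => integral_sub (integrable_divForm_face hv i f hφ)
      (integrable_divForm_face hw i f hφ), Finset.sum_sub_distrib]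
  ring

lemma curlForm_sub (hv : v ∈ M.V k) (hw : w ∈ M.V k) {φ : E3 → E3} (hφ : ContDiff ℝ ∞ φ) :
    M.curlForm (v - w) i φ = M.curlForm v i φ - M.curlForm w i φ := by
  simp only [curlForm, Prod.fst_sub, Prod.snd_sub, Pi.sub_apply, cross_sub_left, inner_sub_left]
  rw [integral_sub (integrable_curlForm_elem hv i hφ) (integrable_curlForm_elem hw i hφ),
    Finset.sum_congr rfl fun f _ => integral_sub (integrable_curlForm_face hv i f hφ)
      (integrable_curlForm_face hw i f hφ), Finset.sum_sub_distrib]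
  ring

lemma sub_mem_V (hv : v ∈ M.V k) (hw : w ∈ M.V k) : v - w ∈ M.V k :=
  ⟨fun i => sub_mem_vpoly (hv.1 i) (hw.1 i), fun f => sub_mem_vpoly (hv.2 f) (hw.2 f)⟩

end Linear

lemma weakDiv_spec (hv : v ∈ M.V k) (i : Fin M.N) :
    M.weakDiv k μ v i ∈ Poly (k - 1) ∧ ∀ φ ∈ Poly (k - 1),
      ∫ x in M.elem i, M.weakDiv k μ v i x * φ x = M.divForm μ v i φ := by
  have hex : ∃ d ∈ Poly (k - 1), ∀ φ ∈ Poly (k - 1),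
      ∫ x in M.elem i, d x * φ x = -(∫ x in M.elem i, ⟪app (μ i) (v.1 i x), gradient φ x⟫)
        + ∑ f ∈ M.faces i, ∫ x in M.face f, ⟪v.2 f x, M.normal i f⟫ * φ x ∂area := by
    obtain ⟨d, hd, h⟩ := exists_poly_represents (k := k - 1)
      (ν := volume.restrict (M.elem i)) (fun φ hφ => memLp_elem hφ i)
      (F := { toFun := fun φ : Poly (k - 1) => M.divForm μ v i φ.1
              map_add' := fun φ ψ =>
                divForm_add hv (contDiff_of_mem_poly φ.2) (contDiff_of_mem_poly ψ.2)
              map_smul' := fun c φ => divForm_smul (contDiff_of_mem_poly φ.2) c })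
      fun φ hφ => by
        have h0 := eq_zero_of_ae (contDiff_of_mem_poly φ.2).continuous hφ
        change M.divForm μ v i φ.1 = 0
        rw [divForm, setIntegral_eq_zero_of_forall_eq_zero fun x hx => ?_, neg_zero, zero_add]
        · refine Finset.sum_eq_zero fun f hf => setIntegral_eq_zero_of_forall_eq_zero fun x hx => ?_
          rw [h0 x (mem_closure_of_mem_face hf hx), mul_zero]
        · rw [gradient_eq_zero_of_eqOn (M.elem_isOpen i) (fun y hy => h0 y (subset_closure hy)) hx,
            inner_zero_right]
    exact ⟨d, hd, fun φ hφ => h ⟨φ, hφ⟩⟩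
  rw [weakDiv, dif_pos hex]
  exact hex.choose_spec

lemma weakCurl_spec (hv : v ∈ M.V k) (i : Fin M.N) :
    M.weakCurl k v i ∈ VPoly (k - 1) ∧ ∀ φ ∈ VPoly (k - 1),
      ∫ x in M.elem i, ⟪M.weakCurl k v i x, φ x⟫ = M.curlForm v i φ := by
  have hex : ∃ c ∈ VPoly (k - 1), ∀ φ ∈ VPoly (k - 1),
      ∫ x in M.elem i, ⟪c x, φ x⟫ = (∫ x in M.elem i, ⟪v.1 i x, curl φ x⟫)
        - ∑ f ∈ M.faces i, ∫ x in M.face f, ⟪cross (v.2 f x) (M.normal i f), φ x⟫ ∂area := by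
    let vec : (Fin 3 → Poly (k - 1)) → E3 → E3 := fun φ x => WithLp.toLp 2 fun j => (φ j).1 x
    have hs : ∀ φ, ContDiff ℝ ∞ (vec φ) := fun φ =>
      contDiff_of_mem_vpoly (k := k - 1) fun j => (φ j).2
    have hadd : ∀ φ ψ, vec (φ + ψ) = vec φ + vec ψ := fun φ ψ => rfl
    have hsmul : ∀ (c : ℝ) φ, vec (c • φ) = c • vec φ := fun c φ => rfl
    let F : (Fin 3 → Poly (k - 1)) →ₗ[ℝ] ℝ :=
      { toFun := fun φ => M.curlForm v i (vec φ)
        map_add' := fun φ ψ => by rw [hadd]; exact curlForm_add hv (hs φ) (hs ψ)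
        map_smul' := fun c φ => by rw [hsmul]; exact curlForm_smul (hs φ) c }
    have hF : ∀ φ, F φ = M.curlForm v i (vec φ) := fun φ => rfl
    obtain ⟨c, hc, h⟩ := exists_vpoly_represents (k := k - 1)
      (ν := volume.restrict (M.elem i)) (fun φ hφ => memLp_elem hφ i)
      (F := F)
      fun φ hφ => by
        have h0 : ∀ x ∈ closure (M.elem i), vec φ x = 0 := by
          intro x hx
          ext j
          exact eq_zero_of_ae (contDiff_of_mem_poly (φ j).2).continuous (hφ j) x hx
        rw [hF, curlForm, setIntegral_eq_zero_of_forall_eq_zero fun x hx => ?_, zero_sub, neg_eq_zero]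
        · refine Finset.sum_eq_zero fun f hf => setIntegral_eq_zero_of_forall_eq_zero fun x hx => ?_
          rw [h0 x (mem_closure_of_mem_face hf hx), inner_zero_right]
        · rw [curl_eq_zero_of_eqOn (M.elem_isOpen i) (fun y hy => h0 y (subset_closure hy)) hx,
            inner_zero_right]
    exact ⟨c, hc, fun φ hφ => h fun j => ⟨_, hφ j⟩⟩
  rw [weakCurl, dif_pos hex]
  exact hex.choose_spec

lemma b_eq (hv : v ∈ M.V k) {q : Fin M.N → E3 → ℝ} (hq : q ∈ M.W k) :
    M.b k μ v q = ∑ i, M.divForm μ v i (q i) :=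
  Finset.sum_congr rfl fun i _ => (weakDiv_spec hv i).2 _ (hq i)

lemma b_sub_left (hv : v ∈ M.V k) (hw : w ∈ M.V k) {q : Fin M.N → E3 → ℝ} (hq : q ∈ M.W k) :
    M.b k μ (v - w) q = M.b k μ v q - M.b k μ w q := by
  rw [b_eq (sub_mem_V hv hw) hq, b_eq hv hq, b_eq hw hq, ← Finset.sum_sub_distrib]
  exact Finset.sum_congr rfl fun i _ => divForm_sub hv hw (contDiff_of_mem_poly (hq i))

lemma b_sub_right (hv : v ∈ M.V k) {q r : Fin M.N → E3 → ℝ} (hq : q ∈ M.W k) (hr : r ∈ M.W k) :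
    M.b k μ v (q - r) = M.b k μ v q - M.b k μ v r := by
  rw [b, b, b, ← Finset.sum_sub_distrib]
  refine Finset.sum_congr rfl fun i _ => ?_
  have hm : ∀ q : E3 → ℝ, q ∈ Poly (k - 1) → MemLp q 2 (volume.restrict (M.elem i)) :=
    fun q hq => memLp_elem (contDiff_of_mem_poly hq).continuous i
  have hd := hm _ (weakDiv_spec (μ := μ) hv i).1
  simp only [Pi.sub_apply, mul_sub]
  exact integral_sub (integrable_mul_of_memLp hd (hm _ (hq i)))
    (integrable_mul_of_memLp hd (hm _ (hr i)))

/-- The curl part of the bilinear form `a`. -/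
lemma integral_weakCurl (hκ : ∀ i, (κ i).PosDef) (hv : v ∈ M.V k) (hw : w ∈ M.V k) (i : Fin M.N) :
    ∫ x in M.elem i, ⟪app (κ i) (M.weakCurl k v i x), M.weakCurl k w i x⟫
      = M.curlForm v i fun x => app (κ i) (M.weakCurl k w i x) := by
  simp only [inner_app_comm (hκ i)]
  exact (weakCurl_spec hv i).2 _ (app_mem_vpoly (weakCurl_spec hw i).1 _)

lemma nJump_sub (i : Fin M.N) (f : Fin M.L) (x : E3) :
    M.nJump μ (v - w) i f x = M.nJump μ v i f x - M.nJump μ w i f x := by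
  simp only [nJump, Prod.fst_sub, Prod.snd_sub, Pi.sub_apply, app_sub, ← inner_sub_left]
  congr 1
  abel

lemma tJump_sub (i : Fin M.N) (f : Fin M.L) (x : E3) :
    M.tJump (v - w) i f x = M.tJump v i f x - M.tJump w i f x := by
  simp only [tJump, Prod.fst_sub, Prod.snd_sub, Pi.sub_apply, ← cross_sub_left]
  congr 1
  abel

lemma memLp_nJump (hv : v ∈ M.V k) (i : Fin M.N) (f : Fin M.L) :
    MemLp (M.nJump μ v i f) 2 (area.restrict (M.face f)) :=
  ((memLp_app (memLp_fst_face hv i f) (μ i)).sub (memLp_snd hv f)).inner_const (𝕜 := ℝ) _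

lemma memLp_tJump (hv : v ∈ M.V k) (i : Fin M.N) (f : Fin M.L) :
    MemLp (M.tJump v i f) 2 (area.restrict (M.face f)) :=
  memLp_cross ((memLp_fst_face hv i f).sub (memLp_snd hv f)) _

lemma s_sub_left {z : M.Weak} (hv : v ∈ M.V k) (hw : w ∈ M.V k) (hz : z ∈ M.V k) :
    M.s μ (v - w) z = M.s μ v z - M.s μ w z := by
  simp only [s, nJump_sub, tJump_sub, sub_mul, inner_sub_left]
  rw [add_sub_add_comm, ← Finset.sum_sub_distrib, ← Finset.sum_sub_distrib]
  congr 1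
  · refine Finset.sum_congr rfl fun i _ => ?_
    rw [← mul_sub, ← Finset.sum_sub_distrib]
    congr 1
    exact Finset.sum_congr rfl fun f _ => integral_sub
      (integrable_mul_of_memLp (memLp_nJump hv i f) (memLp_nJump hz i f))
      (integrable_mul_of_memLp (memLp_nJump hw i f) (memLp_nJump hz i f))
  · refine Finset.sum_congr rfl fun i _ => ?_
    rw [← mul_sub, ← Finset.sum_sub_distrib]
    congr 1
    exact Finset.sum_congr rfl fun f _ => integral_sub
      (integrable_inner_of_memLp (memLp_tJump hv i f) (memLp_tJump hz i f))
      (integrable_inner_of_memLp (memLp_tJump hw i f) (memLp_tJump hz i f))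

lemma a_sub_left (hκ : ∀ i, (κ i).PosDef) {z : M.Weak} (hv : v ∈ M.V k) (hw : w ∈ M.V k)
    (hz : z ∈ M.V k) : M.a k κ μ (v - w) z = M.a k κ μ v z - M.a k κ μ w z := by
  rw [a, a, a, s_sub_left hv hw hz, add_sub_add_comm, ← Finset.sum_sub_distrib]
  congr 1
  refine Finset.sum_congr rfl fun i _ => ?_
  rw [integral_weakCurl hκ (sub_mem_V hv hw) hz, integral_weakCurl hκ hv hz,
    integral_weakCurl hκ hw hz]
  exact curlForm_sub hv hw (contDiff_app (contDiff_of_mem_vpoly (weakCurl_spec hz i).1) _)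

open Classical in
lemma bflux_sub (hv : v ∈ M.V k) (hw : w ∈ M.V k) (C : Set E3) :
    M.bflux (v - w) C = M.bflux v C - M.bflux w C := by
  simp only [bflux, Prod.snd_sub, Pi.sub_apply, inner_sub_left]
  rw [← Finset.sum_sub_distrib]
  refine Finset.sum_congr rfl fun i _ => ?_
  rw [← Finset.sum_sub_distrib]
  exact Finset.sum_congr rfl fun f _ => integral_sub
    (integrable_of_memLp_two ((memLp_snd hv f).inner_const (𝕜 := ℝ) _))
    (integrable_of_memLp_two ((memLp_snd hw f).inner_const (𝕜 := ℝ) _))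

end PolyPartition

/-! ### The projection of the solution -/

lemma cross_comm (a b : E3) : cross a b = -cross b a := by
  ext j; fin_cases j <;> simp <;> ring

lemma inner_cross_right_self (n c : E3) : ⟪cross n c, n⟫ = 0 := by
  rw [cross_comm, inner_neg_left, inner_cross_self, neg_zero]

/-- The tangential component `n × (a × n)` has the same cross product with `n` as `a`. -/
lemma cross_cross_cross {n : E3} (hn : ⟪n, n⟫ = (1 : ℝ)) (a : E3) :
    cross (cross n (cross a n)) n = cross a n := by
  rw [inner_three] at hn
  ext j
  fin_cases j
  · simp; linear_combination (a 1 * n 2 - a 2 * n 1) * hn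
  · simp; linear_combination (a 2 * n 0 - a 0 * n 2) * hn
  · simp; linear_combination (a 0 * n 1 - a 1 * n 0) * hn

namespace PolyPartition

variable {Ω : Set E3} {M : PolyPartition Ω} {k : ℕ} {μ κ : Fin M.N → Matrix (Fin 3) (Fin 3) ℝ}
  {v w : M.Weak} {i : Fin M.N} {side : Fin M.L → Fin M.N} {u : E3 → E3}
  {G : Fin M.N → Fin 3 → E3 → E3}

lemma memLp_tangential {γ : E3 → E3} {e : Fin M.L} (hγ : MemLp γ 2 (area.restrict (M.face e)))
    (n : E3) : MemLp (fun x => cross n (cross (γ x) n)) 2 (area.restrict (M.face e)) := by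
  have h := (memLp_cross (memLp_cross hγ n) n).neg
  refine h.ae_eq (Eventually.of_forall fun x => ?_)
  simp only [Pi.neg_apply]
  rw [cross_comm n]

lemma Qh_mem_V (hside : ∀ e, e ∈ M.faces (side e))
    (hu : ∀ i, M.HasVGrad i u (G i) (vtrace (M.elem i) u)) : M.Qh k μ side u ∈ M.V k := by
  refine ⟨fun i => vproj_mem (fun φ hφ => memLp_elem hφ i) (hu i).memLp, fun e => ?_⟩
  have hγ := (hu (side e)).memLp_trace (hside e)
  exact add_mem_vpoly (smul_mem_vpoly (proj_spec (fun φ hφ => memLp_face hφ e)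
      ((memLp_app hγ _).inner_const (𝕜 := ℝ) _)).1 _)
    (vproj_mem (fun φ hφ => memLp_face hφ e) (memLp_tangential hγ _))

/-- The normal component of `Q_h u` on a face has the moments of the normal trace of `μ u`, taken
from the chosen side. -/
lemma integral_Qh_normal_side (hside : ∀ e, e ∈ M.faces (side e))
    (hu : ∀ i, M.HasVGrad i u (G i) (vtrace (M.elem i) u)) (e : Fin M.L) {q : E3 → ℝ}
    (hq : q ∈ Poly k) :
    ∫ x in M.face e, ⟪(M.Qh k μ side u).2 e x, M.normal (side e) e⟫ * q x ∂area
      = ∫ x in M.face e, ⟪app (μ (side e)) (vtrace (M.elem (side e)) u x), M.normal (side e) e⟫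
          * q x ∂area := by
  have hν : ∀ φ : E3 → ℝ, Continuous φ → MemLp φ 2 (area.restrict (M.face e)) :=
    fun φ hφ => memLp_face hφ e
  have hγ := (hu (side e)).memLp_trace (hside e)
  set n := M.normal (side e) e with hn
  set α : E3 → ℝ := fun y => ⟪app (μ (side e)) (vtrace (M.elem (side e)) u y), n⟫ with hα
  set T : E3 → E3 := fun y => cross n (cross (vtrace (M.elem (side e)) u y) n) with hT
  have hαL : MemLp α 2 (area.restrict (M.face e)) := (memLp_app hγ _).inner_const (𝕜 := ℝ) _
  have hTL : MemLp T 2 (area.restrict (M.face e)) := memLp_tangential hγ _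
  have hqL := memLp_of_mem_poly hν hq
  have hx : ∀ x, ⟪(M.Qh k μ side u).2 e x, n⟫ * q x
      = proj (area.restrict (M.face e)) k α x * q x
        + ⟪vproj (area.restrict (M.face e)) k T x, q x • n⟫ := by
    intro x
    change ⟪proj (area.restrict (M.face e)) k α x • n
      + vproj (area.restrict (M.face e)) k T x, n⟫ * q x = _
    rw [inner_add_left, real_inner_smul_left, real_inner_smul_right, inner_normal_self (hside e)]
    ring
  simp only [hx]
  have hqn : (fun x => q x • n) ∈ VPoly k := smul_mem_vpoly hq n
  rw [integral_add (integrable_mul_of_memLp (memLp_of_mem_poly hν (proj_spec hν hαL).1) hqL)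
    (integrable_inner_of_memLp (memLp_of_mem_vpoly hν (vproj_mem hν hTL))
      (memLp_of_mem_vpoly hν hqn)), integral_proj_mul hν hαL hq, integral_vproj_inner hν hTL hqn]
  have h0 : ∀ x, ⟪T x, q x • n⟫ = 0 := fun x => by
    rw [real_inner_smul_right, hT, inner_cross_right_self, mul_zero]
  simp only [h0, integral_zero, add_zero, hα]

/-- The tangential component of `Q_h u` on a face has the moments of the tangential trace of `u`,
taken from the chosen side. -/
lemma integral_Qh_cross_side (hside : ∀ e, e ∈ M.faces (side e))
    (hu : ∀ i, M.HasVGrad i u (G i) (vtrace (M.elem i) u)) (e : Fin M.L) {φ : E3 → E3}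
    (hφ : φ ∈ VPoly k) :
    ∫ x in M.face e, ⟪cross ((M.Qh k μ side u).2 e x) (M.normal (side e) e), φ x⟫ ∂area
      = ∫ x in M.face e,
          ⟪cross (vtrace (M.elem (side e)) u x) (M.normal (side e) e), φ x⟫ ∂area := by
  have hν : ∀ φ : E3 → ℝ, Continuous φ → MemLp φ 2 (area.restrict (M.face e)) :=
    fun φ hφ => memLp_face hφ e
  have hγ := (hu (side e)).memLp_trace (hside e)
  set n := M.normal (side e) e with hn
  set α : E3 → ℝ := fun y => ⟪app (μ (side e)) (vtrace (M.elem (side e)) u y), n⟫ with hα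
  set T : E3 → E3 := fun y => cross n (cross (vtrace (M.elem (side e)) u y) n) with hT
  have hTL : MemLp T 2 (area.restrict (M.face e)) := memLp_tangential hγ _
  have hx : ∀ x, ⟪cross ((M.Qh k μ side u).2 e x) n, φ x⟫
      = -⟪vproj (area.restrict (M.face e)) k T x, cross (φ x) n⟫ := by
    intro x
    change ⟪cross (proj (area.restrict (M.face e)) k α x • n
      + vproj (area.restrict (M.face e)) k T x) n, φ x⟫ = _
    rw [cross_add_left, cross_smul_left, cross_self, smul_zero, zero_add, inner_cross_left]
  have hy : ∀ x, -⟪T x, cross (φ x) n⟫ = ⟪cross (vtrace (M.elem (side e)) u x) n, φ x⟫ := by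
    intro x
    rw [← inner_cross_left, hT, cross_cross_cross (inner_normal_self (hside e))]
  simp only [hx]
  rw [integral_neg, integral_vproj_inner hν hTL (cross_mem_vpoly hφ n), ← integral_neg]
  simp only [hy]

lemma normal_trace_match (hΩ : IsLipschitzDomain Ω)
    (hu : ∀ i, M.HasVGrad i u (G i) (vtrace (M.elem i) u))
    (hdiv : MemHDiv Ω fun x => app (M.coeff μ x) (u x)) {i j : Fin M.N} {e : Fin M.L} (hij : i ≠ j)
    (hi : e ∈ M.faces i) (hj : e ∈ M.faces j) : ∀ᵐ x ∂(area.restrict (M.face e)),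
      ⟪app (μ i) (vtrace (M.elem i) u x), M.normal i e⟫
        + ⟪app (μ j) (vtrace (M.elem j) u x), M.normal j e⟫ = 0 :=
  normal_match hΩ hdiv (fun i => (hu i).app (μ i)) (fun i x hx => by rw [coeff_eq μ hx]) hij hi hj

lemma integral_Qh_normal (hΩ : IsLipschitzDomain Ω) (hside : ∀ e, e ∈ M.faces (side e))
    (hu : ∀ i, M.HasVGrad i u (G i) (vtrace (M.elem i) u))
    (hdiv : MemHDiv Ω fun x => app (M.coeff μ x) (u x)) {i : Fin M.N} {e : Fin M.L}
    (hi : e ∈ M.faces i) {q : E3 → ℝ} (hq : q ∈ Poly k) :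
    ∫ x in M.face e, ⟪(M.Qh k μ side u).2 e x, M.normal i e⟫ * q x ∂area
      = ∫ x in M.face e, ⟪app (μ i) (vtrace (M.elem i) u x), M.normal i e⟫ * q x ∂area := by
  have h := integral_Qh_normal_side (μ := μ) hside hu e hq
  by_cases hs : side e = i
  · rw [hs] at h; exact h
  have hn : M.normal i e = -M.normal (side e) e := normal_eq_neg hs (hside e) hi
  have h1 : ∫ x in M.face e, ⟪app (μ i) (vtrace (M.elem i) u x), M.normal i e⟫ * q x ∂area
      = ∫ x in M.face e, -(⟪app (μ (side e)) (vtrace (M.elem (side e)) u x),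
          M.normal (side e) e⟫ * q x) ∂area := by
    refine integral_congr_ae ?_
    filter_upwards [normal_trace_match hΩ hu hdiv hs (hside e) hi] with x hx
    rw [← neg_mul, ← eq_neg_of_add_eq_zero_right hx]
  rw [h1, integral_neg, ← h, ← integral_neg, hn]
  simp only [inner_neg_right, neg_mul]

lemma integral_Qh_cross (hΩ : IsLipschitzDomain Ω) (hside : ∀ e, e ∈ M.faces (side e))
    (hu : ∀ i, M.HasVGrad i u (G i) (vtrace (M.elem i) u))
    (hcurl : MemHCurl Ω u) {i : Fin M.N} {e : Fin M.L}
    (hi : e ∈ M.faces i) {φ : E3 → E3} (hφ : φ ∈ VPoly k) :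
    ∫ x in M.face e, ⟪cross ((M.Qh k μ side u).2 e x) (M.normal i e), φ x⟫ ∂area
      = ∫ x in M.face e, ⟪cross (vtrace (M.elem i) u x) (M.normal i e), φ x⟫ ∂area := by
  have h := integral_Qh_cross_side (μ := μ) hside hu e hφ
  by_cases hs : side e = i
  · rw [hs] at h; exact h
  have hn : M.normal i e = -M.normal (side e) e := normal_eq_neg hs (hside e) hi
  have h1 : ∫ x in M.face e, ⟪cross (vtrace (M.elem i) u x) (M.normal i e), φ x⟫ ∂area
      = ∫ x in M.face e, -⟪cross (vtrace (M.elem (side e)) u x) (M.normal (side e) e), φ x⟫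
          ∂area := by
    refine integral_congr_ae ?_
    filter_upwards [tangential_match hΩ hcurl hu hs (hside e) hi] with x hx
    rw [eq_neg_of_add_eq_zero_right hx, inner_neg_left]
  rw [h1, integral_neg, ← h, ← integral_neg, hn]
  simp only [cross_neg_right, inner_neg_left]

/-- The discrete weak divergence of `Q_h u` has the moments of `∇ · (μ u)`. -/
lemma divForm_Qh (hΩ : IsLipschitzDomain Ω) (hμ : ∀ i, (μ i).PosDef)
    (hside : ∀ e, e ∈ M.faces (side e))
    (hu : ∀ i, M.HasVGrad i u (G i) (vtrace (M.elem i) u))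
    (hdiv : MemHDiv Ω fun x => app (M.coeff μ x) (u x)) (i : Fin M.N) {q : E3 → ℝ}
    (hq : q ∈ Poly (k - 1)) :
    M.divForm μ (M.Qh k μ side u) i q = ∫ x in M.elem i, divMu Ω (M.coeff μ) u x * q x := by
  have hg := ((hu i).app (μ i)).green_wdiv hΩ hdiv (fun x hx => by rw [coeff_eq μ hx])
    (contDiff_of_mem_poly hq)
  have h1 : ∫ x in M.elem i, ⟪app (μ i) ((M.Qh k μ side u).1 i x), gradient q x⟫
      = ∫ x in M.elem i, ⟪app (M.coeff μ x) (u x), gradient q x⟫ := by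
    simp only [inner_app_comm (hμ i)]
    refine (integral_vproj_inner (fun φ hφ => memLp_elem hφ i) (hu i).memLp
      (app_mem_vpoly (vpoly_mono ((Nat.sub_le _ 1).trans (Nat.sub_le k 1))
        (gradient_mem_vpoly hq)) (μ i))).trans ?_
    refine setIntegral_congr_fun (M.elem_isOpen i).measurableSet fun x hx => ?_
    simp only [← inner_app_comm (hμ i), coeff_eq μ hx]
  rw [divForm, h1, Finset.sum_congr rfl fun f hf =>
    integral_Qh_normal hΩ hside hu hdiv hf (poly_mono (Nat.sub_le k 1) hq), ← hg]
  rw [neg_add_cancel_left]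
  rfl

/-- The discrete weak curl of `Q_h u` has the moments of `∇ × u`. -/
lemma curlForm_Qh (hΩ : IsLipschitzDomain Ω) (hside : ∀ e, e ∈ M.faces (side e))
    (hu : ∀ i, M.HasVGrad i u (G i) (vtrace (M.elem i) u))
    (hcurl : MemHCurl Ω u) (i : Fin M.N) {φ : E3 → E3} (hφ : φ ∈ VPoly (k - 1)) :
    M.curlForm (M.Qh k μ side u) i φ = ∫ x in M.elem i, ⟪wcurl Ω u x, φ x⟫ := by
  have hg := (hu i).green_wcurl hΩ hcurl (contDiff_of_mem_vpoly hφ)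
  have h1 : ∫ x in M.elem i, ⟪(M.Qh k μ side u).1 i x, curl φ x⟫
      = ∫ x in M.elem i, ⟪u x, curl φ x⟫ :=
    integral_vproj_inner (fun φ hφ => memLp_elem hφ i) (hu i).memLp
      (vpoly_mono ((Nat.sub_le _ 1).trans (Nat.sub_le k 1)) (curl_mem_vpoly hφ))
  rw [curlForm, h1, Finset.sum_congr rfl fun f hf =>
    integral_Qh_cross hΩ hside hu hcurl hf (vpoly_mono (Nat.sub_le k 1) hφ), ← hg, sub_sub_cancel]

/-- The tangential component of `Q_h u` on the boundary is the projection of the boundary data. -/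
lemma Qh_boundary (hΩ : IsLipschitzDomain Ω) (hside : ∀ e, e ∈ M.faces (side e))
    (hu : ∀ i, M.HasVGrad i u (G i) (vtrace (M.elem i) u))
    (hcurl : MemHCurl Ω u) {ξ : E3 → E3} (hξ : HasTangentialTrace Ω u ξ)
    (hξ2 : MemLp ξ 2 (area.restrict (frontier Ω))) {i : Fin M.N} {e : Fin M.L}
    (hi : e ∈ M.faces i) (hsub : M.face e ⊆ frontier Ω) :
    ∀ᵐ x ∂(area.restrict (M.face e)), cross ((M.Qh k μ side u).2 e x) (M.normal i e)
      = vproj (area.restrict (M.face e)) k ξ x := by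
  refine ae_eq_vproj (fun φ hφ => memLp_face hφ e)
    (hξ2.mono_measure (Measure.restrict_mono hsub le_rfl))
    (cross_mem_vpoly ((Qh_mem_V hside hu).2 e) _) fun φ hφ => ?_
  rw [integral_Qh_cross hΩ hside hu hcurl hi hφ]
  refine integral_congr_ae ?_
  filter_upwards [tangential_boundary hΩ hcurl hu hξ hξ2 hi hsub] with x hx
  rw [hx]

/-- The fluxes of `Q_h u` through the boundary components are those of `μ u`. -/
lemma bflux_Qh (hΩ : IsLipschitzDomain Ω) {m : ℕ} {Γ : Fin (m + 1) → Set E3}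
    (hΓ : IsBoundaryComponents Ω Γ) (hside : ∀ e, e ∈ M.faces (side e))
    (hu : ∀ i, M.HasVGrad i u (G i) (vtrace (M.elem i) u))
    (hdiv : MemHDiv Ω fun x => app (M.coeff μ x) (u x)) (b : Fin (m + 1)) :
    M.bflux (M.Qh k μ side u) (Γ b) = fluxMu Ω (M.coeff μ) u (Γ b) := by
  classical
  rw [fluxMu, normalFlux_eq hΩ hΓ b hdiv
    (τ := fun i f x => ⟪app (μ i) (vtrace (M.elem i) u x), M.normal i f⟫)
    (fun i φ hφ => ((hu i).app (μ i)).green_wdiv hΩ hdiv (fun x hx => by rw [coeff_eq μ hx]) hφ)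
    (fun i f hf => (memLp_app ((hu i).memLp_trace hf) _).inner_const (𝕜 := ℝ) _)
    fun i j f hij hi hj => normal_trace_match hΩ hu hdiv hij hi hj, bflux]
  refine Finset.sum_congr rfl fun i _ => Finset.sum_congr (by congr) fun f hf => ?_
  have := integral_Qh_normal (k := k) hΩ hside hu hdiv (Finset.mem_filter.1 hf).1 (const_mem_poly 1)
  simpa only [mul_one] using this

/-! ### The error equations -/

section Error

variable {p : E3 → ℝ} {K : E3 → E3}

/-- The weak curl form applied to the projection of `K`: an elementwise integration by parts in
which the projection is replaced by `K` itself, up to face terms. -/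
lemma curlForm_vproj (hv : v ∈ M.V k) {G : Fin 3 → E3 → E3} {γ : E3 → E3}
    (hK : M.HasVGrad i K G γ) :
    M.curlForm v i (vproj (volume.restrict (M.elem i)) (k - 1) K)
      = (∫ x in M.elem i, ⟪curlOf G x, v.1 i x⟫)
        + ((∑ e ∈ M.faces i, ∫ x in M.face e,
            ⟪vproj (volume.restrict (M.elem i)) (k - 1) K x - γ x, M.tJump v i e x⟫ ∂area)
          + ∑ e ∈ M.faces i, ∫ x in M.face e, ⟪cross (γ x) (M.normal i e), v.2 e x⟫ ∂area) := by
  have hν : ∀ φ : E3 → ℝ, Continuous φ → MemLp φ 2 (volume.restrict (M.elem i)) :=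
    fun φ hφ => memLp_elem hφ i
  set Q := vproj (volume.restrict (M.elem i)) (k - 1) K with hQ
  have hQm : Q ∈ VPoly (k - 1) := vproj_mem hν hK.memLp
  have hQs := contDiff_of_mem_vpoly hQm
  have hvs := contDiff_of_mem_vpoly (hv.1 i)
  have g1 := (hasVGrad_of_contDiff hQs i).green_curl hvs
  have g2 := hK.green_curl hvs
  have g3 : ∫ x in M.elem i, ⟪Q x, curl (v.1 i) x⟫ = ∫ x in M.elem i, ⟪K x, curl (v.1 i) x⟫ :=
    integral_vproj_inner hν hK.memLp (curl_mem_vpoly (hv.1 i))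
  rw [curlOf_gradient hQs] at g1
  have hQf := fun e => memLp_face_vec (M := M) hQs.continuous e
  have j1 : ∀ e, Integrable (fun x => ⟪cross (Q x) (M.normal i e), v.1 i x⟫)
      (area.restrict (M.face e)) := fun e =>
    integrable_inner_of_memLp (memLp_cross (hQf e) _) (memLp_fst_face hv i e)
  have j2 : ∀ e ∈ M.faces i, Integrable (fun x => ⟪cross (γ x) (M.normal i e), v.1 i x⟫)
      (area.restrict (M.face e)) := fun e he =>
    integrable_inner_of_memLp (memLp_cross (hK.memLp_trace he) _) (memLp_fst_face hv i e)
  have j3 : ∀ e ∈ M.faces i, Integrable (fun x => ⟪cross (γ x) (M.normal i e), v.2 e x⟫)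
      (area.restrict (M.face e)) := fun e he =>
    integrable_inner_of_memLp (memLp_cross (hK.memLp_trace he) _) (memLp_snd hv e)
  have j4 : ∀ e, Integrable (fun x => ⟪cross (v.2 e x) (M.normal i e), Q x⟫)
      (area.restrict (M.face e)) := fun e =>
    integrable_inner_of_memLp (memLp_cross (memLp_snd hv e) _) (hQf e)
  have hface : ∀ e ∈ M.faces i, (∫ x in M.face e, ⟪Q x - γ x, M.tJump v i e x⟫ ∂area)
      = -(∫ x in M.face e, ⟪cross (Q x) (M.normal i e), v.1 i x⟫ ∂area)
        + (∫ x in M.face e, ⟪cross (γ x) (M.normal i e), v.1 i x⟫ ∂area)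
        - (∫ x in M.face e, ⟪cross (v.2 e x) (M.normal i e), Q x⟫ ∂area)
        - ∫ x in M.face e, ⟪cross (γ x) (M.normal i e), v.2 e x⟫ ∂area := by
    intro e he
    have j0 : Integrable (fun x => -⟪cross (Q x) (M.normal i e), v.1 i x⟫)
      (area.restrict (M.face e)) := (j1 e).neg
    have j12 : Integrable (fun x => -⟪cross (Q x) (M.normal i e), v.1 i x⟫
      + ⟪cross (γ x) (M.normal i e), v.1 i x⟫) (area.restrict (M.face e)) :=
      j0.add (j2 e he)
    have j124 : Integrable (fun x => -⟪cross (Q x) (M.normal i e), v.1 i x⟫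
      + ⟪cross (γ x) (M.normal i e), v.1 i x⟫ - ⟪cross (v.2 e x) (M.normal i e), Q x⟫)
      (area.restrict (M.face e)) := j12.sub (j4 e)
    rw [← integral_neg, ← integral_add j0 (j2 e he), ← integral_sub j12 (j4 e),
      ← integral_sub j124 (j3 e he)]
    refine integral_congr_ae (Eventually.of_forall fun x => ?_)
    simp only [tJump, cross_sub_left, inner_sub_left, inner_sub_right, inner_cross_left,
      real_inner_comm (Q x) (cross (v.2 e x) _)]
    ring
  rw [Finset.sum_congr rfl hface, Finset.sum_sub_distrib, Finset.sum_sub_distrib,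
    Finset.sum_add_distrib, Finset.sum_neg_distrib, ← g1, ← g2, g3, curlForm]
  have : ∫ x in M.elem i, ⟪v.1 i x, curl Q x⟫ = ∫ x in M.elem i, ⟪curl Q x, v.1 i x⟫ := by
    simp only [real_inner_comm]
  rw [this]
  ring

/-- The weak divergence form applied to the projection of `p`: an elementwise integration by parts
in which the projection is replaced by `p` itself, up to face terms. -/
lemma divForm_proj (hμ : ∀ i, (μ i).PosDef) (hv : v ∈ M.V k) {P : E3 → E3} {π : E3 → ℝ}
    (hP : M.HasGrad i p P π) :
    M.divForm μ v i (proj (volume.restrict (M.elem i)) (k - 1) p)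
      = -(∫ x in M.elem i, ⟪app (μ i) (P x), v.1 i x⟫)
        + ((∑ e ∈ M.faces i, ∫ x in M.face e,
            (π x - proj (volume.restrict (M.elem i)) (k - 1) p x) * M.nJump μ v i e x ∂area)
          + ∑ e ∈ M.faces i, ∫ x in M.face e, π x * ⟪v.2 e x, M.normal i e⟫ ∂area) := by
  have hν : ∀ φ : E3 → ℝ, Continuous φ → MemLp φ 2 (volume.restrict (M.elem i)) :=
    fun φ hφ => memLp_elem hφ i
  set Q := proj (volume.restrict (M.elem i)) (k - 1) p with hQ
  have hQm : Q ∈ Poly (k - 1) := (proj_spec hν hP.memLp).1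
  have hQs := contDiff_of_mem_poly hQm
  have hvm := app_mem_vpoly (hv.1 i) (μ i)
  have hvs := contDiff_of_mem_vpoly hvm
  have g1 := (hasGrad_of_contDiff hQs i).green_sdiv hvs
  have g2 := hP.green_sdiv hvs
  have g3 : ∫ x in M.elem i, Q x * sdiv (fun y => app (μ i) (v.1 i y)) x
      = ∫ x in M.elem i, p x * sdiv (fun y => app (μ i) (v.1 i y)) x :=
    integral_proj_mul hν hP.memLp (sdiv_mem_poly hvm)
  have hQf := fun e => memLp_face (M := M) hQs.continuous e
  have m0 := fun e => (memLp_app (memLp_fst_face hv i e) (μ i)).inner_const (𝕜 := ℝ) (M.normal i e)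
  have mb := fun e => (memLp_snd hv e).inner_const (𝕜 := ℝ) (M.normal i e)
  have hface : ∀ e ∈ M.faces i, (∫ x in M.face e, (π x - Q x) * M.nJump μ v i e x ∂area)
      = (∫ x in M.face e, π x * ⟪app (μ i) (v.1 i x), M.normal i e⟫ ∂area)
        - (∫ x in M.face e, Q x * ⟪app (μ i) (v.1 i x), M.normal i e⟫ ∂area)
        + (∫ x in M.face e, ⟪v.2 e x, M.normal i e⟫ * Q x ∂area)
        - ∫ x in M.face e, π x * ⟪v.2 e x, M.normal i e⟫ ∂area := by
    intro e he
    have j1 := integrable_mul_of_memLp (hP.memLp_trace e he) (m0 e)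
    have j2 := integrable_mul_of_memLp (hQf e) (m0 e)
    have j3 := integrable_mul_of_memLp (mb e) (hQf e)
    have j4 := integrable_mul_of_memLp (hP.memLp_trace e he) (mb e)
    have j12 : Integrable (fun x => π x * ⟪app (μ i) (v.1 i x), M.normal i e⟫
      - Q x * ⟪app (μ i) (v.1 i x), M.normal i e⟫) (area.restrict (M.face e)) := j1.sub j2
    have j123 : Integrable (fun x => π x * ⟪app (μ i) (v.1 i x), M.normal i e⟫
      - Q x * ⟪app (μ i) (v.1 i x), M.normal i e⟫ + ⟪v.2 e x, M.normal i e⟫ * Q x)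
      (area.restrict (M.face e)) := j12.add j3
    rw [← integral_sub j1 j2, ← integral_add j12 j3, ← integral_sub j123 j4]
    refine integral_congr_ae (Eventually.of_forall fun x => ?_)
    simp only [nJump, inner_sub_left]
    ring
  rw [Finset.sum_congr rfl hface, Finset.sum_sub_distrib, Finset.sum_add_distrib,
    Finset.sum_sub_distrib, ← g1, ← g2, g3, divForm]
  have e1 : ∫ x in M.elem i, ⟪app (μ i) (v.1 i x), gradient Q x⟫
      = ∫ x in M.elem i, ⟪gradient Q x, app (μ i) (v.1 i x)⟫ := by
    simp only [real_inner_comm]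
  have e2 : ∫ x in M.elem i, ⟪app (μ i) (P x), v.1 i x⟫
      = ∫ x in M.elem i, ⟪P x, app (μ i) (v.1 i x)⟫ := by
    simp only [inner_app_comm (hμ i)]
  rw [e1, e2]
  ring

end Error

end PolyPartition

end DivCurlWG

end

open DivCurlWG MeasureTheory in
theorem theorem9p1 (Ω : Set E3) (hΩ : IsLipschitzDomain Ω)
    {m : ℕ} (Γ : Fin (m + 1) → Set E3) (hΓ : IsBoundaryComponents Ω Γ)
    (M : PolyPartition Ω) (k : ℕ) (hk : 1 ≤ k)
    (κ μ : Fin M.N → Matrix (Fin 3) (Fin 3) ℝ)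
    (hκ : ∀ i, (κ i).PosDef) (hμ : ∀ i, (μ i).PosDef)
    (g ξ : E3 → E3) (f : E3 → ℝ) (β : Fin m → ℝ)
    (hg : MemLp g 2 (volume.restrict Ω)) (hf : MemLp f 2 (volume.restrict Ω))
    (hξ : MemLp ξ 2 (area.restrict (frontier Ω)))
    (u : E3 → E3) (p : E3 → ℝ)
    (hsol : IsModelSolution Ω Γ (M.coeff κ) (M.coeff μ) g ξ f β u p ∨
      ∃ lam : Fin m → ℝ, IsMultiplierSolution Ω Γ (M.coeff κ) (M.coeff μ) g ξ f β u p lam)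
    (hu : ∀ i j, MemH1 (M.elem i) (fun x => u x j))
    (hcu : ∀ i j, MemH1 (M.elem i) (fun x => wcurl Ω u x j))
    (hp : ∀ i, MemH1 (M.elem i) p)
    (uh : M.Weak) (ph : Fin M.N → E3 → ℝ)
    (hh : M.IsWGSolution k κ μ Γ g ξ f β uh ph)
    (side : Fin M.L → Fin M.N) (hside : ∀ e, e ∈ M.faces (side e)) :
    (M.Qh k μ side u - uh) ∈ M.U0 k Γ ∧
    (M.Qp k p - ph) ∈ M.W k ∧
    (∀ v ∈ M.U0 k Γ,
      M.a k κ μ (M.Qh k μ side u - uh) v + M.b k μ v (M.Qp k p - ph)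
        = M.l k κ u v + M.theta k μ p v + M.s μ (M.Qh k μ side u) v) ∧
    (∀ q ∈ M.W k, M.b k μ (M.Qh k μ side u - uh) q = 0) := by
  classical
  -- both formulations of the model problem lead to the same boundary value problem
  have hmod : IsModelSolution Ω Γ (M.coeff κ) (M.coeff μ) g ξ f β u p := by
    rcases hsol with h | ⟨lam, h⟩
    exacts [h, h.isModelSolution]
  have hcurl := hmod.u_mem.1
  have hdiv := hmod.u_mem.2
  choose G hG using fun i => M.hasVGrad_of_memH1 (hu i)
  choose Gc hGc using fun i => M.hasVGrad_of_memH1 (hcu i)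
  choose P hP using fun i => M.hasGrad_of_memH1 (hp i)
  have hQV : M.Qh k μ side u ∈ M.V k := PolyPartition.Qh_mem_V hside hG
  have hQW : M.Qp k p ∈ M.W k := fun i =>
    (proj_spec (fun φ hφ => PolyPartition.memLp_elem hφ i) (hP i).memLp).1
  refine ⟨⟨⟨PolyPartition.sub_mem_V hQV hh.u_mem, fun i e hi hsub => ?_⟩, fun l => ?_⟩,
    fun i => (DivCurlWG.Poly _).sub_mem (hQW i) (hh.p_mem i), fun v hv => ?_, fun q hq => ?_⟩
  · filter_upwards [PolyPartition.Qh_boundary (k := k) (μ := μ) hΩ hside hG hcurl hmod.boundary hξ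
      hi hsub, hh.boundary i e hi hsub] with x h1 h2
    rw [Prod.snd_sub, Pi.sub_apply, Pi.sub_apply, cross_sub_left, h1, h2, sub_self]
  · rw [PolyPartition.bflux_sub hQV hh.u_mem, PolyPartition.bflux_Qh hΩ hΓ hside hG hdiv,
      hmod.flux_eq, hh.flux_eq, sub_self]
  · have hvV : v ∈ M.V k := hv.1.1
    have hvc : ∀ e, Continuous (v.2 e) := fun e =>
      (contDiff_of_mem_vpoly (hvV.2 e)).continuous
    have hK := fun i => (hGc i).app (κ i)
    -- the curl part of the form, after two integrations by parts
    have hcurlpart : ∀ i, ∫ x in M.elem i,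
        ⟪app (κ i) (M.weakCurl k (M.Qh k μ side u) i x), M.weakCurl k v i x⟫
        = M.curlForm v i (vproj (volume.restrict (M.elem i)) (k - 1)
            fun y => app (κ i) (wcurl Ω u y)) := fun i => by
      have hw := (PolyPartition.weakCurl_spec hvV i).1
      have hν : ∀ φ : E3 → ℝ, Continuous φ → MemLp φ 2 (volume.restrict (M.elem i)) :=
        fun φ hφ => PolyPartition.memLp_elem hφ i
      rw [PolyPartition.integral_weakCurl hκ hQV hvV,
        PolyPartition.curlForm_Qh hΩ hside hG hcurl i (app_mem_vpoly hw _),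
        ← (PolyPartition.weakCurl_spec hvV i).2 _ (vproj_mem hν (hK i).memLp)]
      simp only [← PolyPartition.inner_app_comm (hκ i)]
      rw [← integral_vproj_inner hν (hK i).memLp hw]
      simp only [real_inner_comm]
    have hdivpart : M.b k μ v (M.Qp k p) = ∑ i, M.divForm μ v i
        (proj (volume.restrict (M.elem i)) (k - 1) p) := PolyPartition.b_eq hvV hQW
    have hstrong : ∀ i, (∫ x in M.elem i, ⟪PolyPartition.curlOf (fun j x => ∑ a, κ i j a • Gc i a x) x,
        v.1 i x⟫) - (∫ x in M.elem i, ⟪app (μ i) (P i x), v.1 i x⟫)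
        = ∫ x in M.elem i, ⟪g x, v.1 i x⟫ := fun i => by
      have hvL := PolyPartition.memLp_fst hvV i
      rw [← integral_sub
        (integrable_inner_of_memLp (PolyPartition.memLp_curlOf fun a => (hK i a).memLp_grad) hvL)
        (integrable_inner_of_memLp (memLp_app (hP i).memLp_grad (μ i)) hvL)]
      refine integral_congr_ae ?_
      filter_upwards [PolyPartition.strong_form hΩ hΓ hμ hg hmod hK hP i] with x hx
      rw [← inner_sub_left, hx]
    have hpz := PolyPartition.sum_trace_p_eq_zero hΩ hΓ hμ hg hmod hK hP hvc hv.2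
    have hcz := PolyPartition.sum_trace_curl_eq_zero hΩ hΓ hμ hg hmod hK hP hvc hv.1.2
    have hsch := hh.curl_eq v hv
    rw [PolyPartition.a_sub_left hκ hQV hh.u_mem hvV,
      PolyPartition.b_sub_right hvV hQW hh.p_mem, hdivpart]
    have ha : M.a k κ μ (M.Qh k μ side u) v = (∑ i, M.curlForm v i
        (vproj (volume.restrict (M.elem i)) (k - 1) fun y => app (κ i) (wcurl Ω u y)))
        + M.s μ (M.Qh k μ side u) v := by
      rw [PolyPartition.a, Finset.sum_congr rfl fun i _ => hcurlpart i]
    rw [ha, Finset.sum_congr rfl fun i _ => PolyPartition.curlForm_vproj hvV (hK i),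
      Finset.sum_congr rfl fun i _ => PolyPartition.divForm_proj hμ hvV (hP i)]
    simp only [Finset.sum_add_distrib, Finset.sum_neg_distrib]
    rw [hcz, hpz]
    have hsum := Finset.sum_congr (rfl : (Finset.univ : Finset (Fin M.N)) = _) fun i _ => hstrong i
    rw [Finset.sum_sub_distrib, ← hsch] at hsum
    rw [PolyPartition.l, PolyPartition.theta]
    simp only [PolyPartition.Qp]
    linarith
  · rw [PolyPartition.b_sub_left hQV hh.u_mem hq, PolyPartition.b_eq hQV hq, hh.div_eq q hq,
      sub_eq_zero]
    have hqL : ∀ i, MemLp (q i) 2 (volume.restrict (M.elem i)) := fun i =>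
      PolyPartition.memLp_elem (contDiff_of_mem_poly (hq i)).continuous i
    have hqG : MemLp (M.glue q) 2 (volume.restrict Ω) := PolyPartition.memLp_glue hqL
    have hd := hmod.div_eq (M.glue q) hqG
    simp only [divMu] at hd
    rw [PolyPartition.integral_domain (M := M) hΩ fun i => integrable_mul_of_memLp
        (hdiv.wdiv_spec.1.mono_measure (PolyPartition.restrict_elem_le hΩ i))
        (hqG.mono_measure (PolyPartition.restrict_elem_le hΩ i)),
      PolyPartition.integral_domain (M := M) hΩ fun i => integrable_mul_of_memLp
        (hf.mono_measure (PolyPartition.restrict_elem_le hΩ i))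
        (hqG.mono_measure (PolyPartition.restrict_elem_le hΩ i))] at hd
    have hglue : ∀ (i : Fin M.N) (F : E3 → ℝ),
        ∫ x in M.elem i, F x * M.glue q x = ∫ x in M.elem i, F x * q i x := fun i F =>
      setIntegral_congr_fun (M.elem_isOpen i).measurableSet fun x hx => by
        simp only [PolyPartition.glue_eq q hx]
    simp only [hglue] at hd
    rw [← hd]
    exact Finset.sum_congr rfl fun i _ =>
      PolyPartition.divForm_Qh hΩ hμ hside hG hdiv i (hq i)
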